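/- Let $(M^m,\bar g)$ be a smooth Riemannian manifold, $f\in C^\infty(M)$, and let $i:\Sigma^n\to M^m$ ($n<m$) be a smooth immersion of a manifold (without boundary) with induced metric and volume element $d\sigma$. Let $\overline\nabla$ and $\nabla$ be the Levi-Civita connections of $M$ and $\Sigma$, $(\cdot)^\perp$ the projection to the normal bundle of $\Sigma$, $\nabla^\perp=(\overline\nabla\,\cdot)^\perp$ the normal connection, and $A(X,Y)=(\overline\nabla_XY)^\perp$ the second fundamental form. Let $\{e_i\}_{i=1}^n$ be a local orthonormal frame of $\Sigma$. Suppose that $\Sigma$ is $f$-minimal, that is, $\mathbf H+(\overline\nabla f)^\perp=0$ with $\mathbf H=\sum_iA(e_i,e_i)$. For a smooth normal field $T$ along $\Sigma$ put $$L_fT=\Delta_f^\perp T+R(T)+B(T)+F(T),$$ where $\Delta^\perp_fT=\sum_i(\nabla^\perp_{e_i}\nabla^\perp_{e_i}T-\nabla^\perp_{\nabla_{e_i}e_i}T)-\sum_i(e_if)\nabla^\perp_{e_i}T$, $R(T)=\sum_i[\overline{Rm}(e_i,T)e_i]^\perp$, $B(T)=\sum_{i,j}\langle A(e_i,e_j),T\rangle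 A(e_i,e_j)$, $F(T)=[\overline\nabla^2f(T)]^\perp=(\overline\nabla_T\overline\nabla f)^\perp$, and $\overline{Rm}(X,Y)Z=\overline\nabla_Y\overline\nabla_XZ-\overline\nabla_X\overline\nabla_YZ+\overline\nabla_{[X,Y]}Z$. (1) Let $\psi_t:\Sigma\to M$, $t\in(-\varepsilon,\varepsilon)$, be a smooth variation with $\psi_0=i$ that is constant in $t$ outside a compact set $K\subset\Sigma$ and whose variational field $T=\partial_t\psi_t|_{t=0}$ is normal. Then $\langle T,L_fT\rangle e^{-f}$ is integrable on $\Sigma$, and $$\frac{d^2}{dt^2}V_f(\Sigma_t)\Big|_{t=0}=-\int_\Sigma\langle T,L_fT\rangle e^{-f}\,d\sigma .$$ Here, as $V_f(\Sigma)=\int_\Sigma e^{-f}d\sigma$ may be infinite, the left side means the following: for every Borel set $D\supset K$ with $\int_De^{-f}d\sigma<\infty$, the function $t\mapsto V_f(\psi_t|_D)=\int_De^{-f\circ\psi_t}\,d\sigma_t$, with $d\sigma_t$ the volume element of $\psi_t^*\bar g$, is finite and $C^2$ near $t=0$, and its second derivative at $t=0$ is the right side. (2) Suppose moreover that $m=n+1$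 and that $\Sigma$ has a smooth global unit normal field $\nu$. For $\phi\in C^\infty(\Sigma)$ put $L_f\phi=\Delta_f\phi+|A|^2\phi+\overline{\mathrm{Ric}}_f(\nu,\nu)\phi$, with $\Delta_f\phi=\Delta\phi-\langle\nabla f,\nabla\phi\rangle$ and $\overline{\mathrm{Ric}}_f=\overline{\mathrm{Ric}}+\overline\nabla^2f$. Then $L_f(\phi\nu)=(L_f\phi)\,\nu$. For every variation as in (1), constant in $t$ outside a compact set and with variational field $\phi\nu$, the function $\phi\,L_f\phi\,e^{-f}$ is integrable and, in the sense of (1), $$\frac{d^2}{dt^2}V_f(\Sigma_t)\Big|_{t=0}=-\int_\Sigma\phi\,L_f\phi\;e^{-f}\,d\sigma .$$ -/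

import Mathlib

open MeasureTheory
open scoped Manifold ContDiff Topology

noncomputable section

namespace FMinimal

/-- The model space `ℝᵏ`. -/
abbrev Eu (k : ℕ) : Type := EuclideanSpace ℝ (Fin k)

/-- The `i`-th standard basis vector of `ℝᵏ`. -/
def stdVec {k : ℕ} (i : Fin k) : Eu k := EuclideanSpace.single i 1

/-- The Gram matrix `(b(eᵢ, eⱼ))` of a bilinear form `b` on `ℝᵏ`. -/
def gram {k : ℕ} (b : Eu k → Eu k → ℝ) : Matrix (Fin k) (Fin k) ℝ :=
  Matrix.of fun i j => b (stdVec i) (stdVec j)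

/-- The trace `∑ᵢⱼ bⁱʲ Q(eᵢ, eⱼ)` of a bilinear map `Q` with respect to an inner product `b` on
`ℝᵏ`; it equals `∑ᵢ Q(uᵢ, uᵢ)` for every `b`-orthonormal basis `u`. -/
def metricTrace {k : ℕ} {V : Type*} [AddCommGroup V] [Module ℝ V]
    (b : Eu k → Eu k → ℝ) (Q : Eu k → Eu k → V) : V :=
  ∑ i, ∑ j, (gram b)⁻¹ i j • Q (stdVec i) (stdVec j)

section Metric

variable {k : ℕ} {N : Type*} [TopologicalSpace N] [ChartedSpace (Eu k) N]

/-- A family of forms on the tangent spaces of a `k`-manifold `N`. Below it is always the metric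
of a Riemannian manifold or the pullback of such a metric by a smooth map. -/
abbrev FormField (k : ℕ) (N : Type*) [TopologicalSpace N] [ChartedSpace (Eu k) N] : Type _ :=
  ∀ x : N, TangentSpace (𝓡 k) x → TangentSpace (𝓡 k) x → ℝ

/-- Trace over the tangent space at `x` with respect to `h x`. -/
def tangentTrace {V : Type*} [AddCommGroup V] [Module ℝ V] (h : FormField k N) (x : N)
    (Q : TangentSpace (𝓡 k) x → TangentSpace (𝓡 k) x → V) : V :=
  metricTrace (k := k) (h x) Q

/-- The metric in the chart around `c`, at the point `z` of the chart's target. -/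
def chartMetric (h : FormField k N) (c : N) (z : Eu k) (v w : Eu k) : ℝ :=
  h ((extChartAt (𝓡 k) c).symm z)
    (mfderiv 𝓘(ℝ, Eu k) (𝓡 k) (extChartAt (𝓡 k) c).symm z v)
    (mfderiv 𝓘(ℝ, Eu k) (𝓡 k) (extChartAt (𝓡 k) c).symm z w)

/-- The Christoffel symbols of the metric in the chart around `c`, as a bilinear map:
`Γ(v, w) = ∑ₐᵦ hᵃᵇ ½ (∂ᵥ h(w, eₐ) + ∂_w h(v, eₐ) - ∂ₐ h(v, w)) eᵦ`. -/
def christoffel (h : FormField k N) (c : N) (z : Eu k) (v w : Eu k) : Eu k :=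
  metricTrace (chartMetric h c z) fun a b =>
    ((1 / 2 : ℝ) *
      (fderiv ℝ (fun z' => chartMetric h c z' w a) z v
        + fderiv ℝ (fun z' => chartMetric h c z' v a) z w
        - fderiv ℝ (fun z' => chartMetric h c z' v w) z a)) • b

/-- The derivative `X φ` of a function `φ` in the direction `X`. -/
def dirDeriv (φ : N → ℝ) (x : N) (X : TangentSpace (𝓡 k) x) : ℝ :=
  mfderiv (𝓡 k) 𝓘(ℝ, ℝ) φ x X

/-- The form field of a smooth Riemannian metric. -/
def metricForm [IsManifold (𝓡 k) ∞ N]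
    (G : Bundle.ContMDiffRiemannianMetric (𝓡 k) ∞ (Eu k) (fun x : N => TangentSpace (𝓡 k) x)) :
    FormField k N := fun x X Y => G.inner x X Y

/-- The gradient of a function `φ`: the vector field dual to `dφ`. -/
def gradient (h : FormField k N) (φ : N → ℝ) (x : N) : TangentSpace (𝓡 k) x :=
  tangentTrace h x fun X Y => dirDeriv φ x X • Y

/-- The curvature tensor `Rm(X, Y)Z = ∇_Y ∇_X Z - ∇_X ∇_Y Z + ∇_[X,Y] Z` at `x`, computed in the
chart around `x`:
`-(DΓ(X)(Y, Z) - DΓ(Y)(X, Z) + Γ(X, Γ(Y, Z)) - Γ(Y, Γ(X, Z)))`. With this sign convention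
`⟨Rm(X, Y)X, Y⟩` is the sectional curvature of an orthonormal pair `X, Y`. -/
def curvature (h : FormField k N) (x : N) (X Y Z : TangentSpace (𝓡 k) x) :
    TangentSpace (𝓡 k) x :=
  let z : Eu k := extChartAt (𝓡 k) x x
  let L : TangentSpace (𝓡 k) x →L[ℝ] Eu k := mfderiv (𝓡 k) 𝓘(ℝ, Eu k) (extChartAt (𝓡 k) x) x
  let Γ : Eu k → Eu k → Eu k → Eu k := christoffel h x
  L.inverse (-(fderiv ℝ (fun z' => Γ z' (L Y) (L Z)) z (L X)
    - fderiv ℝ (fun z' => Γ z' (L X) (L Z)) z (L Y)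
    + Γ z (L X) (Γ z (L Y) (L Z)) - Γ z (L Y) (Γ z (L X) (L Z))))

/-- The Ricci tensor `Ric(Y, Z) = ∑ᵢ ⟨Rm(eᵢ, Y)eᵢ, Z⟩`. -/
def ricci (h : FormField k N) (x : N) (Y Z : TangentSpace (𝓡 k) x) : ℝ :=
  tangentTrace h x fun X X' => h x (curvature h x X Y X') Z

/-- The Riemannian measure in the chart around `c`: on the domain of the chart it has density
`√det(hᵢⱼ)` with respect to Lebesgue measure in the coordinates, and it vanishes outside. -/
def chartVolume [MeasurableSpace N] (h : FormField k N) (c : N) : Measure N :=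
  Measure.map (extChartAt (𝓡 k) c).symm
    ((volume.restrict (extChartAt (𝓡 k) c).target).withDensity fun z =>
      ENNReal.ofReal (Real.sqrt (gram (chartMetric h c z)).det))

/-- The Riemannian volume measure: the least measure that dominates the Riemannian measures of
the charts. As these agree on overlaps, it restricts to each of them on the domain of its chart. -/
def riemannianVolume [MeasurableSpace N] (h : FormField k N) : Measure N :=
  ⨆ c : N, chartVolume h c

end Metric

section Immersion

variable (n : ℕ) {m : ℕ}
  {S : Type*} [TopologicalSpace S] [ChartedSpace (Eu n) S]
  {M : Type*} [TopologicalSpace M] [ChartedSpace (Eu m) M]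

/-- The metric induced by `u : S → M`. -/
def pullbackForm (g : FormField m M) (u : S → M) : FormField n S := fun p X Y =>
  g (u p) (mfderiv (𝓡 n) (𝓡 m) u p X) (mfderiv (𝓡 n) (𝓡 m) u p Y)

/-- The Levi-Civita derivative, in the direction `X`, of a vector field `W` along a map
`u : S → M`. In the chart of `M` around `u p` it is `D_X W + Γ(du X, W)`. For `u = id` this is the
Levi-Civita connection `∇_X W` of `M`. -/
def covDeriv (g : FormField m M) (u : S → M) (W : ∀ q : S, TangentSpace (𝓡 m) (u q)) (p : S)
    (X : TangentSpace (𝓡 n) p) : TangentSpace (𝓡 m) (u p) :=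
  let y := extChartAt (𝓡 m) (u p)
  let L : ∀ x : M, TangentSpace (𝓡 m) x →L[ℝ] Eu m := fun x => mfderiv (𝓡 m) 𝓘(ℝ, Eu m) y x
  let dW : Eu m := mfderiv (𝓡 n) 𝓘(ℝ, Eu m) (fun q => L (u q) (W q)) p X
  (L (u p)).inverse
    (dW + christoffel g (u p) (y (u p)) (L (u p) (mfderiv (𝓡 n) (𝓡 m) u p X)) (L (u p) (W p)))

/-- The component of `W` normal to the immersion `u`. -/
def normalPart (g : FormField m M) (u : S → M) (p : S) (W : TangentSpace (𝓡 m) (u p)) :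
    TangentSpace (𝓡 m) (u p) :=
  W - tangentTrace (pullbackForm n g u) p fun X Y =>
    g (u p) W (mfderiv (𝓡 n) (𝓡 m) u p X) • mfderiv (𝓡 n) (𝓡 m) u p Y

/-- `W` is a normal vector field along the immersion `u`. -/
def IsNormal (g : FormField m M) (u : S → M) (W : ∀ p : S, TangentSpace (𝓡 m) (u p)) : Prop :=
  ∀ (p : S) (X : TangentSpace (𝓡 n) p), g (u p) (W p) (mfderiv (𝓡 n) (𝓡 m) u p X) = 0

/-- The normal connection `∇⊥_X W = (∇_X W)⊥`. -/
def normalDeriv (g : FormField m M) (u : S → M) (W : ∀ q : S, TangentSpace (𝓡 m) (u q)) (p : S)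
    (X : TangentSpace (𝓡 n) p) : TangentSpace (𝓡 m) (u p) :=
  normalPart n g u p (covDeriv n g u W p X)

variable [IsManifold (𝓡 n) 1 S]

/-- The second fundamental form `A(X, Y) = (∇_X Y)⊥`, where `Y` is extended to a vector field
near `p`. -/
def secondFundamentalForm (g : FormField m M) (u : S → M) (p : S)
    (X Y : TangentSpace (𝓡 n) p) : TangentSpace (𝓡 m) (u p) :=
  normalDeriv n g u (fun q => mfderiv (𝓡 n) (𝓡 m) u q (FiberBundle.extend (Eu n) Y q)) p X

/-- The mean curvature vector `H = tr A`. -/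
def meanCurvature (g : FormField m M) (u : S → M) (p : S) : TangentSpace (𝓡 m) (u p) :=
  tangentTrace (pullbackForm n g u) p (secondFundamentalForm n g u p)

/-- The weighted mean curvature vector `H_f = H + (∇f)⊥`. -/
def weightedMeanCurvature (g : FormField m M) (f : M → ℝ) (u : S → M) (p : S) :
    TangentSpace (𝓡 m) (u p) :=
  meanCurvature n g u p + normalPart n g u p (gradient g f (u p))

/-- `u` is `f`-minimal: `H_f` vanishes identically. -/
def IsFMinimal (g : FormField m M) (f : M → ℝ) (u : S → M) : Prop :=
  ∀ p : S, weightedMeanCurvature n g f u p = 0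

/-- `|A|²`, the squared norm `∑ᵢⱼ |A(eᵢ, eⱼ)|²` of the second fundamental form. -/
def normSqSecondFundamentalForm (g : FormField m M) (u : S → M) (p : S) : ℝ :=
  tangentTrace (pullbackForm n g u) p fun X X' => tangentTrace (pullbackForm n g u) p fun Y Y' =>
    g (u p) (secondFundamentalForm n g u p X Y) (secondFundamentalForm n g u p X' Y')

/-- The normal Laplacian `Δ⊥ W = ∑ᵢ (∇⊥_{eᵢ} ∇⊥_{eᵢ} W - ∇⊥_{∇_{eᵢ} eᵢ} W)`, with the Levi-Civita
connection of the induced metric in the second term. -/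
def normalLaplacian (g : FormField m M) (u : S → M) (W : ∀ q : S, TangentSpace (𝓡 m) (u q))
    (p : S) : TangentSpace (𝓡 m) (u p) :=
  tangentTrace (pullbackForm n g u) p fun X Y =>
    normalDeriv n g u (fun q => normalDeriv n g u W q (FiberBundle.extend (Eu n) Y q)) p X
      - normalDeriv n g u W p
          (covDeriv n (pullbackForm n g u) (id : S → S)
            (FiberBundle.extend (Eu n) (E := TangentSpace (𝓡 n)) Y) p X)

/-- The weighted normal Laplacian `Δ⊥_f W = Δ⊥ W - ∑ᵢ (eᵢ f) ∇⊥_{eᵢ} W`. -/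
def weightedNormalLaplacian (g : FormField m M) (f : M → ℝ) (u : S → M)
    (W : ∀ q : S, TangentSpace (𝓡 m) (u q)) (p : S) : TangentSpace (𝓡 m) (u p) :=
  normalLaplacian n g u W p - tangentTrace (pullbackForm n g u) p fun X Y =>
    dirDeriv (k := n) (fun q => f (u q)) p X • normalDeriv n g u W p Y

/-- `R(W) = ∑ᵢ [Rm(eᵢ, W)eᵢ]⊥`. -/
def curvatureTerm (g : FormField m M) (u : S → M) (p : S) (W : TangentSpace (𝓡 m) (u p)) :
    TangentSpace (𝓡 m) (u p) :=
  tangentTrace (pullbackForm n g u) p fun X Y => normalPart n g u p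
    (curvature g (u p) (mfderiv (𝓡 n) (𝓡 m) u p X) W (mfderiv (𝓡 n) (𝓡 m) u p Y))

/-- `B(W) = ∑ᵢⱼ ⟨A(eᵢ, eⱼ), W⟩ A(eᵢ, eⱼ)`. -/
def secondFundamentalTerm (g : FormField m M) (u : S → M) (p : S)
    (W : TangentSpace (𝓡 m) (u p)) : TangentSpace (𝓡 m) (u p) :=
  tangentTrace (pullbackForm n g u) p fun X X' => tangentTrace (pullbackForm n g u) p fun Y Y' =>
    g (u p) (secondFundamentalForm n g u p X Y) W • secondFundamentalForm n g u p X' Y'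

/-- The Hessian of `f` as an endomorphism, `X ↦ ∇_X ∇f`. -/
def hessian {k : ℕ} {N : Type*} [TopologicalSpace N] [ChartedSpace (Eu k) N]
    (h : FormField k N) (f : N → ℝ) (x : N) (X : TangentSpace (𝓡 k) x) : TangentSpace (𝓡 k) x :=
  covDeriv k h (id : N → N) (gradient h f) x X

/-- `F(W) = [∇²f(W)]⊥`. -/
def hessianTerm (g : FormField m M) (f : M → ℝ) (u : S → M) (p : S)
    (W : TangentSpace (𝓡 m) (u p)) : TangentSpace (𝓡 m) (u p) :=
  normalPart n g u p (hessian g f (u p) W)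

/-- The operator `L_f W = Δ⊥_f W + R(W) + B(W) + F(W)`. -/
def stabilityOperator (g : FormField m M) (f : M → ℝ) (u : S → M)
    (W : ∀ q : S, TangentSpace (𝓡 m) (u q)) (p : S) : TangentSpace (𝓡 m) (u p) :=
  weightedNormalLaplacian n g f u W p + curvatureTerm n g u p (W p)
    + secondFundamentalTerm n g u p (W p) + hessianTerm n g f u p (W p)

/-- The weighted Laplacian `Δ_w φ = Δφ - ⟨∇w, ∇φ⟩`, where `Δφ` is the trace of the Hessian. -/
def weightedLaplacian {k : ℕ} {N : Type*} [TopologicalSpace N] [ChartedSpace (Eu k) N]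
    (h : FormField k N) (w φ : N → ℝ) (x : N) : ℝ :=
  (tangentTrace h x fun X Y => h x (hessian h φ x X) Y) - h x (gradient h w x) (gradient h φ x)

/-- The Bakry-Émery Ricci tensor `Ric_f(X, Y) = Ric(X, Y) + ∇²f(X, Y)`. -/
def bakryEmeryRicci {k : ℕ} {N : Type*} [TopologicalSpace N] [ChartedSpace (Eu k) N]
    (h : FormField k N) (f : N → ℝ) (x : N) (X Y : TangentSpace (𝓡 k) x) : ℝ :=
  ricci h x X Y + h x (hessian h f x X) Y

/-- The operator `L_f φ = Δ_f φ + |A|² φ + Ric_f(ν, ν) φ` on functions on a hypersurface with unit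
normal field `ν`. -/
def hypersurfaceOperator (g : FormField m M) (f : M → ℝ) (u : S → M)
    (ν : ∀ q : S, TangentSpace (𝓡 m) (u q)) (φ : S → ℝ) (p : S) : ℝ :=
  weightedLaplacian (pullbackForm n g u) (fun q => f (u q)) φ p
    + normSqSecondFundamentalForm n g u p * φ p
    + bakryEmeryRicci g f (u p) (ν p) (ν p) * φ p

end Immersion

section Variation

variable (n : ℕ) {m : ℕ}
  {S : Type*} [TopologicalSpace S] [ChartedSpace (Eu n) S]
  {M : Type*} [TopologicalSpace M] [ChartedSpace (Eu m) M]

/-- The weighted volume `∫_D e^{-f} dσ` of the part over `D ⊆ S` of the map `u : S → M`. -/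
def weightedVolume [MeasurableSpace S] (g : FormField m M) (f : M → ℝ) (u : S → M) (D : Set S) :
    ENNReal :=
  ∫⁻ p in D, ENNReal.ofReal (Real.exp (-f (u p))) ∂(riemannianVolume (pullbackForm n g u))

/-- `u` is a smooth immersion. -/
def IsSmoothImmersion (n m : ℕ) {S : Type*} [TopologicalSpace S] [ChartedSpace (Eu n) S]
    {M : Type*} [TopologicalSpace M] [ChartedSpace (Eu m) M] (u : S → M) : Prop :=
  ContMDiff (𝓡 n) (𝓡 m) ∞ u ∧ ∀ p : S, Function.Injective (mfderiv (𝓡 n) (𝓡 m) u p)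

/-- `ψ` is a smooth variation of `u : S → M` for times in `(-ε, ε)` that moves only the points of
the compact set `K` and has variational vector field `∂ψ/∂t (0) = T`. -/
structure IsVariation (u : S → M) (T : ∀ p : S, TangentSpace (𝓡 m) (u p)) (ψ : ℝ → S → M)
    (ε : ℝ) (K : Set S) : Prop where
  pos : 0 < ε
  compact : IsCompact K
  smooth : ContMDiffOn (𝓘(ℝ, ℝ).prod (𝓡 n)) (𝓡 m) ∞ (fun z : ℝ × S => ψ z.1 z.2)
    (Set.Ioo (-ε) ε ×ˢ Set.univ)
  initial : ψ 0 = u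
  support : ∀ t ∈ Set.Ioo (-ε) ε, ∀ p ∉ K, ψ t p = u p
  velocity : ∀ p : S, tangentMap 𝓘(ℝ, ℝ) (𝓡 m) (fun t => ψ t p) ⟨0, (1 : ℝ)⟩
    = (⟨u p, T p⟩ : TangentBundle (𝓡 m) M)

/-- The weighted volume of the variation `ψ` has second derivative `c` at `t = 0`: for every
measurable `D` that contains the set `K` of moving points and has finite weighted volume at time
`0`, the weighted volume of the part of `ψ t` over `D` is finite for `t` near `0`, it is `C²` near
`t = 0`, and its second derivative at `t = 0` is `c`. -/
def HasSecondVariation [MeasurableSpace S] (g : FormField m M) (f : M → ℝ) (ψ : ℝ → S → M)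
    (K : Set S) (c : ℝ) : Prop :=
  ∀ D : Set S, MeasurableSet D → K ⊆ D → weightedVolume n g f (ψ 0) D < ⊤ →
    (∀ᶠ t in 𝓝 (0 : ℝ), weightedVolume n g f (ψ t) D < ⊤) ∧
    ContDiffAt ℝ 2 (fun t => (weightedVolume n g f (ψ t) D).toReal) 0 ∧
    iteratedDeriv 2 (fun t => (weightedVolume n g f (ψ t) D).toReal) 0 = c

end Variation

end FMinimal
end

/-! In a chart of `Σ` the weighted volume of `ψ t` has the density `w_t = √det(ψ_t^* g) ·
e^{-f∘ψ_t}`. The heart of the proof is a pointwise identity at `t = 0`, valid for an `f`-minimal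
immersion and normal velocity `T`: `∂ₜ² w = div (w X) - ⟨T, L_f T⟩ w`, where `div` is the coordinate
divergence and `X` is the vector field on `Σ` dual to the form `α(v) = ∂ₜ⟨∂ₜψ, dψ(v)⟩`.

To see it, fix a point and constant coordinate vectors `eᵢ` that are orthonormal there for the
induced metric, and let `M(t)` be the Gram matrix of the `dψ_t(eᵢ)`, so that `M(0) = 1`. Then `w' =
w λ` with `λ = ½ tr(M⁻¹M') - (f∘ψ)'`. Minimality tested against `T` says `λ(0) = 0`, so only `λ'(0)
= ½ tr M'' - ½ tr (M')² - (f∘ψ)''` survives (`deriv_deriv_sqrt_det_mul_exp`). Here `M'ᵢⱼ =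
-2⟨A(eᵢ,eⱼ), T⟩`. Commuting covariant derivatives turns `½ M''ᵢᵢ` into the derivative of `α(eᵢ)`
along `eᵢ`, a curvature term, `-⟨∇ᵢ∇ᵢT, T⟩` and a term containing the acceleration `Z = ∇ₜ∂ₜψ`
(`second_variation_metric`). Splitting `∇ᵢT` into normal and tangential parts yields the normal
Laplacian and a further square of the second fundamental form. The first term is completed to a
divergence by `divergence_formula`. The acceleration is arbitrary, but all terms containing it add
up to minimality tested against `Z`. The result is `second_variation_density`.

The operators in the statement are defined at each point in the chart around that point, whereas
iterated derivatives require a fixed chart. `christoffel_transform` and `covDeriv_inCharts` show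
that the connection does not depend on the chart, and `inner_stabilityOperator` writes `⟨L_f T, ξ⟩`
in a chart of `Σ` fixed in advance. Together these give `deriv_deriv_density`.

To globalise, the volume over `D` is split into a constant, the volume over `D \ K`, and the volume
over `K`. The latter is a finite sum of chart integrals by a partition of unity `ρ_c`, and each
integral is differentiated twice under the integral sign. Integration by parts in the charts turns
the divergence into `-∑ dρ_c(X)`, which vanishes on `K` (`ChartPartition.sum_integral_divergence`).

For a hypersurface the normal bundle is spanned by `ν` and `∇⊥(φν) = dφ ν`, because `⟨∇ν, ν⟩ = 0`.
Hence `L_f(φν)` is determined by its `ν`-component, which is computed from the same chart formula.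
-/

noncomputable section

namespace FMinimal

/-! ### Bilinear forms on `ℝᵏ`: Gram matrices, orthonormal frames and traces. -/

section LinearAlgebra

variable {k : ℕ} {V : Type*} [AddCommGroup V] [Module ℝ V]

/-- `Q` is linear in each argument. -/
structure IsBil {E V : Type*} [AddCommGroup E] [Module ℝ E] [AddCommGroup V] [Module ℝ V]
    (Q : E → E → V) : Prop where
  left : ∀ w, IsLinearMap ℝ fun v => Q v w
  right : ∀ v, IsLinearMap ℝ (Q v)

theorem isBil_clm {E V : Type*} [NormedAddCommGroup E] [NormedSpace ℝ E] [NormedAddCommGroup V]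
    [NormedSpace ℝ V] (B : E →L[ℝ] E →L[ℝ] V) : IsBil fun v w => B v w :=
  ⟨fun w => ⟨by simp, by simp⟩, fun v => ⟨by simp, by simp⟩⟩

theorem IsBil.comp {E E' V V' : Type*} [AddCommGroup E] [Module ℝ E] [AddCommGroup E']
    [Module ℝ E'] [AddCommGroup V] [Module ℝ V] [AddCommGroup V'] [Module ℝ V']
    {Q : E → E → V} (hQ : IsBil Q) (A : E' →ₗ[ℝ] E) (C : V →ₗ[ℝ] V') :
    IsBil fun v w => C (Q (A v) (A w)) :=
  ⟨fun w => ⟨by simp [(hQ.left _).map_add], by simp [(hQ.left _).map_smul]⟩,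
    fun v => ⟨by simp [(hQ.right _).map_add], by simp [(hQ.right _).map_smul]⟩⟩

theorem IsBil.sum_left {E V ι : Type*} [AddCommGroup E] [Module ℝ E] [AddCommGroup V] [Module ℝ V]
    {Q : E → E → V} (hQ : IsBil Q) (s : Finset ι) (a : ι → ℝ) (e : ι → E) (w : E) :
    Q (∑ i ∈ s, a i • e i) w = ∑ i ∈ s, a i • Q (e i) w := by
  rw [show Q (∑ i ∈ s, a i • e i) w = IsLinearMap.mk' _ (hQ.left w) (∑ i ∈ s, a i • e i) from rfl,
    map_sum]
  exact Finset.sum_congr rfl fun i _ => (hQ.left w).map_smul _ _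

theorem IsBil.sum_right {E V ι : Type*} [AddCommGroup E] [Module ℝ E] [AddCommGroup V] [Module ℝ V]
    {Q : E → E → V} (hQ : IsBil Q) (s : Finset ι) (a : ι → ℝ) (e : ι → E) (v : E) :
    Q v (∑ i ∈ s, a i • e i) = ∑ i ∈ s, a i • Q v (e i) := by
  rw [show Q v (∑ i ∈ s, a i • e i) = IsLinearMap.mk' _ (hQ.right v) (∑ i ∈ s, a i • e i) from rfl,
    map_sum]
  exact Finset.sum_congr rfl fun i _ => (hQ.right v).map_smul _ _

theorem eq_sum_stdVec (v : Eu k) : v = ∑ i, v i • stdVec i := by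
  ext j
  simp [stdVec, Pi.single_apply]

theorem IsBil.eq_sum {Q : Eu k → Eu k → V} (hQ : IsBil Q) (v w : Eu k) :
    Q v w = ∑ i, ∑ j, (v i * w j) • Q (stdVec i) (stdVec j) := by
  conv_lhs => rw [eq_sum_stdVec v, eq_sum_stdVec w, hQ.sum_left]
  refine Finset.sum_congr rfl fun i _ => ?_
  rw [hQ.sum_right, Finset.smul_sum]
  simp [mul_smul]

/-- The continuous bilinear map with prescribed values on the standard basis. -/
def mkBilin {V : Type*} [NormedAddCommGroup V] [NormedSpace ℝ V] (q : Eu k → Eu k → V) :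
    Eu k →L[ℝ] Eu k →L[ℝ] V :=
  ∑ i, ∑ j, (EuclideanSpace.proj i : Eu k →L[ℝ] ℝ).smulRight
    ((EuclideanSpace.proj j : Eu k →L[ℝ] ℝ).smulRight (q (stdVec i) (stdVec j)))

theorem mkBilin_apply {V : Type*} [NormedAddCommGroup V] [NormedSpace ℝ V] {q : Eu k → Eu k → V}
    (hq : IsBil q) (v w : Eu k) : mkBilin q v w = q v w := by
  rw [hq.eq_sum]
  simp [mkBilin, mul_smul]

theorem contDiffAt_mkBilin {V X : Type*} [NormedAddCommGroup V] [NormedSpace ℝ V]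
    [NormedAddCommGroup X] [NormedSpace ℝ X] {r : WithTop ℕ∞} {q : X → Eu k → Eu k → V} {x : X}
    (h : ∀ i j, ContDiffAt ℝ r (fun x => q x (stdVec i) (stdVec j)) x) :
    ContDiffAt ℝ r (fun x => mkBilin (q x)) x := by
  unfold mkBilin
  refine ContDiffAt.sum fun i _ => ContDiffAt.sum fun j _ => ?_
  have h1 := (ContinuousLinearMap.contDiff (n := r) (F := Eu k →L[ℝ] V)
    (ContinuousLinearMap.smulRightL ℝ (Eu k) V (EuclideanSpace.proj j))).contDiffAt.comp x (h i j)
  exact (ContinuousLinearMap.contDiff (n := r) (F := Eu k →L[ℝ] Eu k →L[ℝ] V)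
    (ContinuousLinearMap.smulRightL ℝ (Eu k) (Eu k →L[ℝ] V)
      (EuclideanSpace.proj i))).contDiffAt.comp x h1

/-- `e` is orthonormal with respect to `b`. -/
def IsON (b : Eu k → Eu k → ℝ) (e : Fin k → Eu k) : Prop :=
  ∀ i j, b (e i) (e j) = if i = j then 1 else 0

/-- The matrix with columns `e j`. -/
def frameMatrix (e : Fin k → Eu k) : Matrix (Fin k) (Fin k) ℝ := Matrix.of fun i j => e j i

theorem IsBil.gram_frame {b : Eu k → Eu k → ℝ} (hb : IsBil b) (e : Fin k → Eu k) :
    (Matrix.of fun i j => b (e i) (e j)) =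
      (frameMatrix e).transpose * gram b * frameMatrix e := by
  ext i j
  rw [Matrix.of_apply, hb.eq_sum, Matrix.mul_apply]
  simp_rw [Matrix.mul_apply, Finset.sum_mul]
  rw [Finset.sum_comm]
  refine Finset.sum_congr rfl fun a _ => Finset.sum_congr rfl fun c _ => ?_
  simp [frameMatrix, gram]
  ring

/-- Orthonormality says that `Eᵀ b` is a left inverse of the frame matrix `E`. For square matrices
it is then also a right inverse, which is the completeness of the frame. -/
theorem IsON.frame_mul {b : Eu k → Eu k → ℝ} (hb : IsBil b) {e : Fin k → Eu k} (he : IsON b e) :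
    frameMatrix e * ((frameMatrix e).transpose * gram b) = 1 := by
  apply mul_eq_one_comm.1
  rw [← hb.gram_frame]
  ext i j
  simp [he i j, Matrix.one_apply]

theorem IsON.expand {b : Eu k → Eu k → ℝ} (hb : IsBil b) {e : Fin k → Eu k} (he : IsON b e)
    (v : Eu k) : v = ∑ i, b (e i) v • e i := by
  have h := congrArg (fun A => A.mulVec (fun i => v i)) (he.frame_mul hb)
  simp only [Matrix.one_mulVec, ← Matrix.mulVec_mulVec] at h
  ext a
  have h' := congrFun h a
  rw [← h']
  simp only [Matrix.mulVec, dotProduct, WithLp.ofLp_sum, Finset.sum_apply, PiLp.smul_apply,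
    smul_eq_mul]
  refine Finset.sum_congr rfl fun i _ => ?_
  rw [hb.eq_sum]
  simp only [frameMatrix, gram, Matrix.of_apply, Matrix.transpose_apply, smul_eq_mul]
  rw [mul_comm]
  congr 1
  refine Finset.sum_congr rfl fun c _ => ?_
  rw [Finset.mul_sum]
  exact Finset.sum_congr rfl fun d _ => by ring

/-- From `E Eᵀ b = 1` one reads off `b⁻¹ = E Eᵀ`. Every trace defined through the inverse Gram
matrix thereby becomes a sum over a frame. -/
theorem metricTrace_eq_sum {b : Eu k → Eu k → ℝ} (hb : IsBil b) {e : Fin k → Eu k}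
    (he : IsON b e) {Q : Eu k → Eu k → V} (hQ : IsBil Q) :
    metricTrace b Q = ∑ i, Q (e i) (e i) := by
  have h : (gram b)⁻¹ = frameMatrix e * (frameMatrix e).transpose := by
    apply Matrix.inv_eq_left_inv
    rw [Matrix.mul_assoc, he.frame_mul hb]
  have : ∀ l, Q (e l) (e l) = _ := fun l => hQ.eq_sum (e l) (e l)
  simp_rw [this]
  rw [metricTrace, h, Finset.sum_comm' (t' := Finset.univ) (s' := fun _ => Finset.univ) (by simp)]
  conv_rhs => rw [Finset.sum_comm]
  rw [Finset.sum_comm]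
  refine Finset.sum_congr rfl fun i _ => ?_
  rw [Finset.sum_comm]
  refine Finset.sum_congr rfl fun j _ => ?_
  rw [Matrix.mul_apply, Finset.sum_smul]
  rfl

/-- With `A` the derivative of a transition map, this is the transformation law that makes `√det` a
density. -/
theorem det_gram_comp {b : Eu k → Eu k → ℝ} (hb : IsBil b) (A : Eu k →L[ℝ] Eu k) :
    (gram fun v w => b (A v) (A w)).det = A.det ^ 2 * (gram b).det := by
  have h := hb.gram_frame fun i => A (stdVec i)
  have h1 : (gram fun v w => b (A v) (A w)) = Matrix.of fun i j => b (A (stdVec i)) (A (stdVec j)) :=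
    rfl
  have h2 : (frameMatrix fun i => A (stdVec i)).det = A.det := by
    rw [ContinuousLinearMap.det, ← LinearMap.det_toMatrix (EuclideanSpace.basisFun (Fin k) ℝ).toBasis]
    congr 1
  rw [h1, h, Matrix.det_mul, Matrix.det_mul, Matrix.det_transpose, h2]; ring

/-- A symmetric form has an orthogonal basis; positivity allows its vectors to be normalised. -/
theorem exists_isON {b : Eu k → Eu k → ℝ} (hb : IsBil b) (hs : ∀ v w, b v w = b w v)
    (hp : ∀ v, v ≠ 0 → 0 < b v v) : ∃ e, IsON b e := by
  let B : LinearMap.BilinForm ℝ (Eu k) := LinearMap.mk₂ ℝ b (fun v v' w => (hb.left w).map_add v v')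
    (fun c v w => (hb.left w).map_smul c v) (fun v w w' => (hb.right v).map_add w w')
    (fun c v w => (hb.right v).map_smul c w)
  have hB : LinearMap.IsSymm B := ⟨fun v w => hs v w⟩
  obtain ⟨e, he⟩ := LinearMap.BilinForm.exists_orthogonal_basis (K := ℝ) (V := Eu k) (B := B) hB
  have hk : Module.finrank ℝ (Eu k) = k := by simp
  let e' := e.reindex (finCongr hk)
  have he' : ∀ i j, i ≠ j → b (e' i) (e' j) = 0 := fun i j hij => by
    have := he (i := (finCongr hk).symm i) (j := (finCongr hk).symm j) (by simpa using hij)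
    simpa [e', B, Function.onFun] using this
  have hpos : ∀ i, 0 < b (e' i) (e' i) := fun i => hp _ (e'.ne_zero i)
  refine ⟨fun i => (Real.sqrt (b (e' i) (e' i)))⁻¹ • e' i, fun i j => ?_⟩
  rw [(hb.left _).map_smul, (hb.right _).map_smul]
  split_ifs with hij
  · subst hij
    have := Real.mul_self_sqrt (hpos i).le
    have h0 := (Real.sqrt_pos.2 (hpos i)).ne'
    simp only [smul_eq_mul]
    field_simp
    rw [pow_two, this]
  · simp [he' i j hij]

end LinearAlgebra

/-! ### Jacobi's formula. -/

section Determinant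

/-- The product rule differentiates the determinant one column at a time. The determinant with
column `i` replaced by that of `A'` is, by Cramer's rule, a pairing with row `i` of the adjugate. -/
theorem hasDerivAt_det {k : ℕ} {A : ℝ → Matrix (Fin k) (Fin k) ℝ} {A' : Matrix (Fin k) (Fin k) ℝ}
    {t : ℝ} (h : ∀ i j, HasDerivAt (fun t => A t i j) (A' i j) t) :
    HasDerivAt (fun t => (A t).det) (∑ i, ∑ j, (A t).adjugate i j * A' j i) t := by
  have h1 : ∀ σ : Equiv.Perm (Fin k), HasDerivAt (fun t => ∏ i, A t (σ i) i)
      (∑ i, (∏ j ∈ Finset.univ.erase i, A t (σ j) j) • A' (σ i) i) t := fun σ =>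
    HasDerivAt.fun_finsetProd fun i _ => h (σ i) i
  have h2 := HasDerivAt.fun_sum (u := Finset.univ) fun σ (_ : σ ∈ Finset.univ) =>
    (h1 σ).const_mul ((Equiv.Perm.sign σ : ℤ) : ℝ)
  simp_rw [Matrix.det_apply']
  refine h2.congr_deriv ?_
  simp_rw [Finset.mul_sum]
  rw [Finset.sum_comm]
  refine Finset.sum_congr rfl fun i _ => ?_
  have h3 : ∑ j, (A t).adjugate i j * A' j i = ((A t).updateCol i fun j => A' j i).det := by
    rw [← Matrix.cramer_apply, Matrix.cramer_eq_adjugate_mulVec]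
    rfl
  rw [h3, Matrix.det_apply']
  refine Finset.sum_congr rfl fun σ _ => ?_
  rw [← Finset.mul_prod_erase _ _ (Finset.mem_univ i)]
  have : ∏ x ∈ Finset.univ.erase i, ((A t).updateCol i fun j => A' j i) (σ x) x
      = ∏ x ∈ Finset.univ.erase i, A t (σ x) x :=
    Finset.prod_congr rfl fun x hx => by
      rw [Matrix.updateCol_ne (Finset.ne_of_mem_erase hx)]
  rw [this]
  simp; ring

end Determinant

/-! ### Covariant calculus along maps between vector spaces. -/

section LocalCalculus

variable {E E' F : Type*} [NormedAddCommGroup E] [NormedSpace ℝ E] [NormedAddCommGroup E']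
  [NormedSpace ℝ E'] [NormedAddCommGroup F] [NormedSpace ℝ F]

/-- The derivative at `z` in the direction `a` of a vector field `V` along `Ψ : E → F`, for the
connection with Christoffel symbols `Γ`. -/
def covAlong (Γ : F → F →L[ℝ] F →L[ℝ] F) (Ψ V : E → F) (z a : E) : F :=
  fderiv ℝ V z a + Γ (Ψ z) (fderiv ℝ Ψ z a) (V z)

/-- The curvature `∇_X ∇_Y Z - ∇_Y ∇_X Z - ∇_[X,Y] Z` of the connection with Christoffel
symbols `Γ`. -/
def curv (Γ : F → F →L[ℝ] F →L[ℝ] F) (y X Y Z : F) : F :=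
  fderiv ℝ Γ y X Y Z - fderiv ℝ Γ y Y X Z + Γ y X (Γ y Y Z) - Γ y Y (Γ y X Z)

/-- `Γ` is metric for `G` at `y`. -/
def IsCompat (G : F → F →L[ℝ] F →L[ℝ] ℝ) (Γ : F → F →L[ℝ] F →L[ℝ] F) (y : F) : Prop :=
  ∀ v a b, fderiv ℝ G y v a b = G y (Γ y v a) b + G y a (Γ y v b)

variable {G : F → F →L[ℝ] F →L[ℝ] ℝ} {Γ : F → F →L[ℝ] F →L[ℝ] F} {Ψ V V' : E → F} {z : E}

theorem covAlong_add (hV : DifferentiableAt ℝ V z) (hV' : DifferentiableAt ℝ V' z) (a : E) :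
    covAlong Γ Ψ (fun z => V z + V' z) z a = covAlong Γ Ψ V z a + covAlong Γ Ψ V' z a := by
  simp only [covAlong, fderiv_fun_add hV hV', add_apply, map_add]
  abel

theorem covAlong_smul {φ : E → ℝ} (hφ : DifferentiableAt ℝ φ z) (hV : DifferentiableAt ℝ V z)
    (a : E) : covAlong Γ Ψ (fun z => φ z • V z) z a
      = fderiv ℝ φ z a • V z + φ z • covAlong Γ Ψ V z a := by
  simp only [covAlong, fderiv_fun_smul hφ hV, add_apply, map_smul,
    smul_apply, ContinuousLinearMap.smulRight_apply, smul_add]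
  abel

/-- Applied to `y ↦ (0, y)`, it identifies spatial derivatives along the variation at time `0` with
derivatives along the immersion. -/
theorem covAlong_comp {ι : E' → E} {x : E'} {ι' : E' →L[ℝ] E} (hι : HasFDerivAt ι ι' x)
    (hΨ : DifferentiableAt ℝ Ψ (ι x)) (hV : DifferentiableAt ℝ V (ι x)) (a : E') :
    covAlong Γ (fun x => Ψ (ι x)) (fun x => V (ι x)) x a = covAlong Γ Ψ V (ι x) (ι' a) := by
  have h1 := (hΨ.hasFDerivAt.comp x hι).fderiv
  have h2 := (hV.hasFDerivAt.comp x hι).fderiv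
  simp only [Function.comp_def] at h1 h2
  simp [covAlong, h1, h2]

theorem covAlong_congr {W W' : E → F} (h : W =ᶠ[𝓝 z] W') (a : E) :
    covAlong Γ Ψ W z a = covAlong Γ Ψ W' z a := by
  simp [covAlong, h.fderiv_eq, h.eq_of_nhds]

theorem covAlong_map_add (a b : E) : covAlong Γ Ψ V z (a + b)
    = covAlong Γ Ψ V z a + covAlong Γ Ψ V z b := by
  simp only [covAlong, map_add, add_apply]; abel

theorem covAlong_map_smul (c : ℝ) (a : E) : covAlong Γ Ψ V z (c • a) = c • covAlong Γ Ψ V z a := by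
  simp only [covAlong, map_smul, smul_apply, smul_add]

theorem hasFDerivAt_bilin {B : E → F →L[ℝ] F →L[ℝ] E'} {B' : E →L[ℝ] F →L[ℝ] F →L[ℝ] E'}
    {A A' : E →L[ℝ] F}
    (hB : HasFDerivAt B B' z) (hV : HasFDerivAt V A z) (hV' : HasFDerivAt V' A' z) (a : E) :
    fderiv ℝ (fun z => B z (V z) (V' z)) z a
      = B' a (V z) (V' z) + B z (A a) (V' z) + B z (V z) (A' a) := by
  have h := ((hB.clm_apply hV).clm_apply hV').fderiv
  rw [h]
  simp
  abel

theorem differentiableAt_bilin {B : E → F →L[ℝ] F →L[ℝ] E'}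
    (hB : DifferentiableAt ℝ B z) (hV : DifferentiableAt ℝ V z) (hV' : DifferentiableAt ℝ V' z) :
    DifferentiableAt ℝ (fun z => B z (V z) (V' z)) z :=
  (hB.clm_apply hV).clm_apply hV'

/-- Metric compatibility absorbs the derivative of `G` along `Ψ` into the two Christoffel terms. -/
theorem fderiv_metric (hG : DifferentiableAt ℝ G (Ψ z)) (hc : IsCompat G Γ (Ψ z))
    (hΨ : DifferentiableAt ℝ Ψ z) (hV : DifferentiableAt ℝ V z) (hV' : DifferentiableAt ℝ V' z)
    (a : E) : fderiv ℝ (fun z => G (Ψ z) (V z) (V' z)) z a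
      = G (Ψ z) (covAlong Γ Ψ V z a) (V' z) + G (Ψ z) (V z) (covAlong Γ Ψ V' z a) := by
  have hB : HasFDerivAt (fun z => G (Ψ z)) ((fderiv ℝ G (Ψ z)).comp (fderiv ℝ Ψ z)) z :=
    HasFDerivAt.comp (g := G) z hG.hasFDerivAt hΨ.hasFDerivAt
  rw [hasFDerivAt_bilin hB hV.hasFDerivAt hV'.hasFDerivAt]
  simp only [covAlong, map_add, add_apply, ContinuousLinearMap.comp_apply,
    hc (fderiv ℝ Ψ z a)]
  ring

theorem fderiv_fderiv_comm {F' : Type*} [NormedAddCommGroup F'] [NormedSpace ℝ F'] {f : E → F'}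
    (hf : ContDiffAt ℝ 2 f z) (a b : E) :
    fderiv ℝ (fun z => fderiv ℝ f z b) z a = fderiv ℝ (fun z => fderiv ℝ f z a) z b := by
  have hd : DifferentiableAt ℝ (fderiv ℝ f) z :=
    (hf.fderiv_right (m := 1) (by norm_num)).differentiableAt (by norm_num)
  have key : ∀ a b, fderiv ℝ (fun z => fderiv ℝ f z b) z a = fderiv ℝ (fderiv ℝ f) z a b := by
    intro a b
    rw [fderiv_clm_apply hd (differentiableAt_const b)]
    simp
  rw [key, key]
  exact (hf.isSymmSndFDerivAt (by simp)) a b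

theorem differentiableAt_fderiv_apply {F' : Type*} [NormedAddCommGroup F']
    [NormedSpace ℝ F'] {f : E → F'} (hf : ContDiffAt ℝ 2 f z) (a : E) :
    DifferentiableAt ℝ (fun z => fderiv ℝ f z a) z :=
  ((hf.fderiv_right (m := 1) (by norm_num)).differentiableAt (by norm_num)).clm_apply
    (differentiableAt_const a)

theorem contDiffAt_fderiv_apply {F' : Type*} [NormedAddCommGroup F']
    [NormedSpace ℝ F'] {f : E → F'} (hf : ContDiffAt ℝ ∞ f z) (a : E) :
    ContDiffAt ℝ ∞ (fun z => fderiv ℝ f z a) z :=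
  (hf.fderiv_right (m := ∞) (by simp)).clm_apply contDiffAt_const

/-- Absence of torsion: ordinary second derivatives commute and `Γ` is symmetric. -/
theorem covAlong_fderiv_comm (hs : ∀ v w, Γ (Ψ z) v w = Γ (Ψ z) w v) (hΨ : ContDiffAt ℝ 2 Ψ z)
    (a b : E) : covAlong Γ Ψ (fun z => fderiv ℝ Ψ z b) z a
      = covAlong Γ Ψ (fun z => fderiv ℝ Ψ z a) z b := by
  simp only [covAlong]
  rw [fderiv_fderiv_comm hΨ, hs]

theorem contDiffAt_covAlong (hΓ : ContDiffAt ℝ ∞ Γ (Ψ z)) (hΨ : ContDiffAt ℝ ∞ Ψ z)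
    (hV : ContDiffAt ℝ ∞ V z) (a : E) : ContDiffAt ℝ ∞ (fun z => covAlong Γ Ψ V z a) z :=
  (contDiffAt_fderiv_apply hV a).add
    (((hΓ.comp z hΨ).clm_apply (contDiffAt_fderiv_apply hΨ a)).clm_apply hV)

/-- In the commutator the second derivatives of `Ψ` and of `V` cancel by symmetry, and so do the
terms with one derivative of `V`. What remains involves only `Γ` and its derivative. There is no
bracket term because `a` and `b` are constant directions. -/
theorem covAlong_comm (hΓ : DifferentiableAt ℝ Γ (Ψ z)) (hΨ : ContDiffAt ℝ 2 Ψ z)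
    (hV : ContDiffAt ℝ 2 V z) (a b : E) :
    covAlong Γ Ψ (fun z => covAlong Γ Ψ V z b) z a - covAlong Γ Ψ (fun z => covAlong Γ Ψ V z a) z b
      = curv Γ (Ψ z) (fderiv ℝ Ψ z a) (fderiv ℝ Ψ z b) (V z) := by
  have hΨ1 := hΨ.differentiableAt (by norm_num)
  have hV1 := hV.differentiableAt (by norm_num)
  have h1 : ∀ a b, fderiv ℝ (fun z => covAlong Γ Ψ V z b) z a
      = fderiv ℝ (fun z => fderiv ℝ V z b) z a
        + (fderiv ℝ Γ (Ψ z) (fderiv ℝ Ψ z a) (fderiv ℝ Ψ z b) (V z)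
          + Γ (Ψ z) (fderiv ℝ (fun z => fderiv ℝ Ψ z b) z a) (V z)
          + Γ (Ψ z) (fderiv ℝ Ψ z b) (fderiv ℝ V z a)) := fun a b => by
    have hd1 := differentiableAt_fderiv_apply hΨ b
    have hd2 := differentiableAt_fderiv_apply hV b
    have hB : HasFDerivAt (fun z => Γ (Ψ z)) ((fderiv ℝ Γ (Ψ z)).comp (fderiv ℝ Ψ z)) z :=
      HasFDerivAt.comp (g := Γ) z hΓ.hasFDerivAt hΨ1.hasFDerivAt
    have := hasFDerivAt_bilin hB hd1.hasFDerivAt hV1.hasFDerivAt a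
    unfold covAlong
    rw [fderiv_fun_add hd2 (differentiableAt_bilin hB.differentiableAt hd1 hV1),
      add_apply]
    exact congrArg _ this
  have e : ∀ a b, covAlong Γ Ψ (fun z => covAlong Γ Ψ V z b) z a
      = fderiv ℝ (fun z => covAlong Γ Ψ V z b) z a
        + Γ (Ψ z) (fderiv ℝ Ψ z a) (fderiv ℝ V z b + Γ (Ψ z) (fderiv ℝ Ψ z b) (V z)) :=
    fun a b => rfl
  rw [e, e, h1, h1, fderiv_fderiv_comm hΨ a b, fderiv_fderiv_comm hV a b, curv]
  simp only [map_add]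
  abel

/-- The second variation of the pulled back metric `G(dΨ, dΨ)`. -/
theorem second_variation_metric (hG : ContDiffAt ℝ ∞ G (Ψ z)) (hΓ : ContDiffAt ℝ ∞ Γ (Ψ z))
    (hΨ : ContDiffAt ℝ ∞ Ψ z) (hsG : ∀ᶠ y in 𝓝 (Ψ z), ∀ v w, G y v w = G y w v)
    (hsΓ : ∀ᶠ y in 𝓝 (Ψ z), ∀ v w, Γ y v w = Γ y w v)
    (hc : ∀ᶠ y in 𝓝 (Ψ z), IsCompat G Γ y) (s a : E) :
    (1 / 2 : ℝ) * fderiv ℝ (fun z => fderiv ℝ (fun z => G (Ψ z) (fderiv ℝ Ψ z a) (fderiv ℝ Ψ z a))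
        z s) z s
      = fderiv ℝ (fun z => fderiv ℝ (fun z => G (Ψ z) (fderiv ℝ Ψ z s) (fderiv ℝ Ψ z a)) z s) z a
        - G (Ψ z) (covAlong Γ Ψ (fun z => covAlong Γ Ψ (fun z => fderiv ℝ Ψ z s) z a) z a)
            (fderiv ℝ Ψ z s)
        + G (Ψ z) (curv Γ (Ψ z) (fderiv ℝ Ψ z a) (fderiv ℝ Ψ z s) (fderiv ℝ Ψ z a))
            (fderiv ℝ Ψ z s)
        - G (Ψ z) (covAlong Γ Ψ (fun z => fderiv ℝ Ψ z a) z a)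
            (covAlong Γ Ψ (fun z => fderiv ℝ Ψ z s) z s) := by
  have hct := hΨ.continuousAt
  have hΨa := contDiffAt_fderiv_apply hΨ a
  have hΨs := contDiffAt_fderiv_apply hΨ s
  have hGΨ := hG.comp z hΨ
  have hsa : ContDiffAt ℝ ∞ (fun z => G (Ψ z) (fderiv ℝ Ψ z s) (fderiv ℝ Ψ z a)) z :=
    (hGΨ.clm_apply hΨs).clm_apply hΨa
  have haa : ContDiffAt ℝ ∞ (fun z => G (Ψ z) (fderiv ℝ Ψ z a) (fderiv ℝ Ψ z a)) z :=
    (hGΨ.clm_apply hΨa).clm_apply hΨa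
  have le2 : (2 : WithTop ℕ∞) ≤ ∞ :=
    WithTop.coe_le_coe.2 le_top
  have ev2 : ∀ᶠ x in 𝓝 z, ContDiffAt ℝ 2 Ψ x := (hΨ.of_le le2).eventually (by simp)
  have evG : ∀ᶠ x in 𝓝 z, DifferentiableAt ℝ G (Ψ x) :=
    hct.eventually (((hG.of_le le2).eventually (by simp)).mono
      fun y hy => hy.differentiableAt (by norm_num))
  -- `⟨∇ₐΨₐ, Ψₛ⟩ = ∂ₐ⟨Ψₛ, Ψₐ⟩ - ½ ∂ₛ⟨Ψₐ, Ψₐ⟩`, where `Ψₐ`, `Ψₛ` are the derivatives of `Ψ`. It holds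
  -- near `z`, so it may be differentiated in the direction `s`, which produces the wanted second
  -- derivative.
  have koszul : ∀ᶠ x in 𝓝 z, G (Ψ x) (covAlong Γ Ψ (fun z => fderiv ℝ Ψ z a) x a) (fderiv ℝ Ψ x s)
      = fderiv ℝ (fun z => G (Ψ z) (fderiv ℝ Ψ z s) (fderiv ℝ Ψ z a)) x a
        - (1 / 2 : ℝ) * fderiv ℝ (fun z => G (Ψ z) (fderiv ℝ Ψ z a) (fderiv ℝ Ψ z a)) x s := by
    filter_upwards [ev2, evG, hct.eventually hsG, hct.eventually hsΓ, hct.eventually hc]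
      with x h1 h2 h3 h4 h5
    have da := differentiableAt_fderiv_apply h1 a
    have ds := differentiableAt_fderiv_apply h1 s
    have d1 := h1.differentiableAt (by norm_num)
    rw [fderiv_metric h2 h5 d1 ds da, fderiv_metric h2 h5 d1 da da,
      covAlong_fderiv_comm h4 h1 s a, h3 (fderiv ℝ Ψ x s) (covAlong _ _ _ _ _),
      h3 (fderiv ℝ Ψ x a) (covAlong _ _ _ _ _)]
    ring
  have hcs : ∀ᶠ x in 𝓝 z, covAlong Γ Ψ (fun z => fderiv ℝ Ψ z a) x s
      = covAlong Γ Ψ (fun z => fderiv ℝ Ψ z s) x a := by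
    filter_upwards [ev2, hct.eventually hsΓ] with x h1 h2
    exact covAlong_fderiv_comm h2 h1 s a
  have hcov := contDiffAt_covAlong hΓ hΨ hΨa a
  have hd : ∀ {f : E → F}, ContDiffAt ℝ ∞ f z → DifferentiableAt ℝ f z :=
    fun h => h.differentiableAt (by simp)
  have hd' : ∀ {f : E → ℝ}, ContDiffAt ℝ ∞ f z → DifferentiableAt ℝ f z :=
    fun h => h.differentiableAt (by simp)
  have key := congrArg (fun L => L s) (Filter.EventuallyEq.fderiv_eq (𝕜 := ℝ) koszul)
  rw [fderiv_metric (hG.differentiableAt (by simp)) hc.self_of_nhds (hd hΨ) (hd hcov) (hd hΨs),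
    fderiv_fun_sub (hd' (contDiffAt_fderiv_apply hsa a))
      ((hd' (contDiffAt_fderiv_apply haa s)).const_mul _),
    fderiv_const_mul (hd' (contDiffAt_fderiv_apply haa s))] at key
  -- `∇ₛ∇ₐΨₐ` differs from `∇ₐ∇ₛΨₐ = ∇ₐ∇ₐΨₛ` by the curvature.
  have h7 := covAlong_comm (hΓ.differentiableAt (by simp)) (hΨ.of_le le2) (hΨa.of_le le2) a s
  rw [covAlong_congr hcs, sub_eq_iff_eq_add] at h7
  simp only [sub_apply, smul_apply, smul_eq_mul] at key
  rw [fderiv_fderiv_comm (hsa.of_le le2) s a] at key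
  rw [h7]
  simp only [map_add, add_apply]
  linarith

end LocalCalculus

/-! ### Riemannian metrics on open sets of `ℝᵏ` and their Christoffel symbols. -/

section LocalMetric

variable {k : ℕ}

theorem det_gram_pos_of_isON {b : Eu k → Eu k → ℝ} (hb : IsBil b) {e : Fin k → Eu k}
    (he : IsON b e) : 0 < (gram b).det := by
  have h := congrArg Matrix.det (he.frame_mul hb)
  simp only [Matrix.det_mul, Matrix.det_transpose, Matrix.det_one] at h
  have h2 : (frameMatrix e).det ^ 2 * (gram b).det = 1 := by linarith
  by_contra hn
  nlinarith [sq_nonneg (frameMatrix e).det]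

/-- Expanding `v` in the orthonormal frame `e` reduces the claim to the linearity of `α`. Both
gradients and Christoffel symbols are traces of this form. -/
theorem riesz_of_isON {b : Eu k → Eu k → ℝ} (hb : IsBil b) {e : Fin k → Eu k} (he : IsON b e)
    {α : Eu k → ℝ} (hα : IsLinearMap ℝ α) (v : Eu k) :
    b (metricTrace b fun a c => α a • c) v = α v := by
  have hQ : IsBil fun a c : Eu k => α a • c :=
    ⟨fun w => ⟨fun a b => by simp [hα.map_add, add_smul], fun a b => by
      simp [hα.map_smul, mul_smul]⟩, fun v => ⟨fun a b => by simp, fun a b =>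
      smul_comm _ _ _⟩⟩
  rw [metricTrace_eq_sum hb he hQ, hb.sum_left]
  conv_rhs => rw [he.expand hb v]
  rw [show α (∑ i, b (e i) v • e i) = IsLinearMap.mk' _ hα (∑ i, b (e i) v • e i) from rfl, map_sum]
  refine Finset.sum_congr rfl fun i _ => ?_
  rw [map_smul]
  exact mul_comm _ _

/-- A Riemannian metric on an open subset of `ℝᵏ`. -/
structure LocalMetric (b : Eu k → Eu k → Eu k → ℝ) (O : Set (Eu k)) : Prop where
  isOpen : IsOpen O
  bil : ∀ z ∈ O, IsBil (b z)
  symm : ∀ z ∈ O, ∀ v w, b z v w = b z w v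
  pos : ∀ z ∈ O, ∀ v, v ≠ 0 → 0 < b z v v
  smooth : ∀ v w, ContDiffOn ℝ ∞ (fun z => b z v w) O

theorem contDiffAt_matrix_det {X : Type*} [NormedAddCommGroup X] [NormedSpace ℝ X]
    {r : WithTop ℕ∞} {A : X → Matrix (Fin k) (Fin k) ℝ} {x : X}
    (hA : ∀ i j, ContDiffAt ℝ r (fun x => A x i j) x) :
    ContDiffAt ℝ r (fun x => (A x).det) x := by
  simp_rw [Matrix.det_apply']
  exact ContDiffAt.sum fun σ _ => contDiffAt_const.mul (contDiffAt_prod fun i _ => hA _ _)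

theorem contDiffAt_matrix_inv {X : Type*} [NormedAddCommGroup X] [NormedSpace ℝ X]
    {r : WithTop ℕ∞} {A : X → Matrix (Fin k) (Fin k) ℝ} {x : X}
    (hA : ∀ i j, ContDiffAt ℝ r (fun x => A x i j) x)
    (h0 : (A x).det ≠ 0) (i j : Fin k) : ContDiffAt ℝ r (fun x => (A x)⁻¹ i j) x := by
  have hadj : ContDiffAt ℝ r (fun x => (A x).adjugate i j) x := by
    simp_rw [Matrix.adjugate_apply]
    refine contDiffAt_matrix_det fun a c => ?_
    by_cases h : a = j
    · subst h; simpa using contDiffAt_const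
    · simp only [Matrix.updateRow_ne h]
      exact hA a c
  have : (fun x => (A x)⁻¹ i j) = fun x => ((A x).det)⁻¹ * (A x).adjugate i j := by
    ext x; simp [Matrix.inv_def]
  rw [this]
  exact ((contDiffAt_matrix_det hA).inv h0).mul hadj

theorem contDiffAt_metricTrace {X V : Type*} [NormedAddCommGroup X] [NormedSpace ℝ X]
    [NormedAddCommGroup V] [NormedSpace ℝ V]
    {r : WithTop ℕ∞} {b : X → Eu k → Eu k → ℝ} {Q : X → Eu k → Eu k → V} {x : X}
    (hb : ∀ i j, ContDiffAt ℝ r (fun x => b x (stdVec i) (stdVec j)) x)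
    (h0 : (gram (b x)).det ≠ 0)
    (hQ : ∀ i j, ContDiffAt ℝ r (fun x => Q x (stdVec i) (stdVec j)) x) :
    ContDiffAt ℝ r (fun x => metricTrace (b x) (Q x)) x :=
  ContDiffAt.sum fun i _ => ContDiffAt.sum fun j _ =>
    (contDiffAt_matrix_inv (A := fun x => gram (b x)) hb h0 i j).smul (hQ i j)

/-- The Christoffel symbols of `b`. -/
def localChristoffel (b : Eu k → Eu k → Eu k → ℝ) (z v w : Eu k) : Eu k :=
  metricTrace (b z) fun a c =>
    ((1 / 2 : ℝ) *
      (fderiv ℝ (fun z' => b z' w a) z v + fderiv ℝ (fun z' => b z' v a) z w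
        - fderiv ℝ (fun z' => b z' v w) z a)) • c

namespace LocalMetric

variable {b : Eu k → Eu k → Eu k → ℝ} {O : Set (Eu k)} (H : LocalMetric b O) {z : Eu k}
include H

theorem exists_frame (hz : z ∈ O) : ∃ e, IsON (b z) e :=
  exists_isON (H.bil z hz) (H.symm z hz) (H.pos z hz)

theorem det_pos (hz : z ∈ O) : 0 < (gram (b z)).det :=
  let ⟨_, he⟩ := H.exists_frame hz
  det_gram_pos_of_isON (H.bil z hz) he

theorem contDiffAt (hz : z ∈ O) (v w : Eu k) : ContDiffAt ℝ ∞ (fun z => b z v w) z :=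
  (H.smooth v w).contDiffAt (H.isOpen.mem_nhds hz)

theorem mk_apply (hz : z ∈ O) (v w : Eu k) : mkBilin (b z) v w = b z v w :=
  mkBilin_apply (H.bil z hz) v w

theorem contDiffAt_mk (hz : z ∈ O) : ContDiffAt ℝ ∞ (fun z => mkBilin (b z)) z :=
  contDiffAt_mkBilin fun _ _ => H.contDiffAt hz _ _

theorem eventually_mk (hz : z ∈ O) (v w : Eu k) :
    (fun z => b z v w) =ᶠ[𝓝 z] fun z => mkBilin (b z) v w := by
  filter_upwards [H.isOpen.mem_nhds hz] with y hy using (H.mk_apply hy v w).symm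

theorem fderiv_eq (hz : z ∈ O) (a v w : Eu k) :
    fderiv ℝ (fun z => b z v w) z a = fderiv ℝ (fun z => mkBilin (b z)) z a v w := by
  rw [(H.eventually_mk hz v w).fderiv_eq]
  have h := (H.contDiffAt_mk hz).differentiableAt (by simp)
  have h2 := ((h.hasFDerivAt.clm_apply (hasFDerivAt_const v z)).clm_apply
    (hasFDerivAt_const w z)).fderiv
  rw [h2]
  simp

theorem riesz (hz : z ∈ O) {α : Eu k → ℝ} (hα : IsLinearMap ℝ α) (v : Eu k) :
    b z (metricTrace (b z) fun a c => α a • c) v = α v :=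
  let ⟨_, he⟩ := H.exists_frame hz
  riesz_of_isON (H.bil z hz) he hα v

theorem eq_of_forall (hz : z ∈ O) {v w : Eu k} (h : ∀ a, b z v a = b z w a) : v = w := by
  by_contra hn
  have h1 := H.pos z hz (v - w) (sub_ne_zero.2 hn)
  have h2 := h (v - w)
  have h3 := ((H.bil z hz).left (v - w)).map_sub v w
  rw [h3, h2, sub_self] at h1
  exact lt_irrefl _ h1

/-- Pairing with `a` removes the inverse metric from the definition. Bilinearity, symmetry and
compatibility of the symbols follow from this formula, with nondegeneracy where vectors are to be
compared. -/
theorem koszul (hz : z ∈ O) (v w a : Eu k) : b z (localChristoffel b z v w) a =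
    (1 / 2 : ℝ) * (fderiv ℝ (fun z' => b z' w a) z v + fderiv ℝ (fun z' => b z' v a) z w
        - fderiv ℝ (fun z' => b z' v w) z a) := by
  refine H.riesz hz (α := fun a => (1 / 2 : ℝ) * (fderiv ℝ (fun z' => b z' w a) z v
    + fderiv ℝ (fun z' => b z' v a) z w - fderiv ℝ (fun z' => b z' v w) z a)) ?_ a
  simp_rw [H.fderiv_eq hz]
  refine ⟨fun x y => ?_, fun c x => ?_⟩
  · simp only [map_add, add_apply]; ring
  · simp only [map_smul, smul_apply, smul_eq_mul]; ring

theorem isBil_christoffel (hz : z ∈ O) : IsBil (localChristoffel b z) := by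
  have hb := H.bil z hz
  refine ⟨fun w => ⟨fun x y => H.eq_of_forall hz fun a => ?_, fun c x => H.eq_of_forall hz fun a => ?_⟩,
    fun w => ⟨fun x y => H.eq_of_forall hz fun a => ?_, fun c x => H.eq_of_forall hz fun a => ?_⟩⟩
  all_goals
    first
    | rw [(hb.left a).map_add] | rw [(hb.left a).map_smul]
    simp only [H.koszul hz, H.fderiv_eq hz, map_add, add_apply, map_smul, smul_apply, smul_eq_mul]
    ring

theorem mkChristoffel_apply (hz : z ∈ O) (v w : Eu k) :
    mkBilin (localChristoffel b z) v w = localChristoffel b z v w :=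
  mkBilin_apply (H.isBil_christoffel hz) v w

theorem christoffel_symm (hz : z ∈ O) (v w : Eu k) :
    localChristoffel b z v w = localChristoffel b z w v := by
  refine H.eq_of_forall hz fun a => ?_
  have : (fun z' => b z' v w) =ᶠ[𝓝 z] fun z' => b z' w v := by
    filter_upwards [H.isOpen.mem_nhds hz] with y hy using H.symm y hy v w
  rw [H.koszul hz, H.koszul hz, this.fderiv_eq]
  ring

/-- In the sum of the two Koszul formulas all derivatives of the metric cancel in pairs, except the
one in the direction `v`. -/
theorem isCompat (hz : z ∈ O) :
    IsCompat (fun z => mkBilin (b z)) (fun z => mkBilin (localChristoffel b z)) z := by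
  intro v x y
  have hs : ∀ x y : Eu k, (fun z' => b z' x y) =ᶠ[𝓝 z] fun z' => b z' y x := fun x y => by
    filter_upwards [H.isOpen.mem_nhds hz] with p hp using H.symm p hp x y
  rw [H.mkChristoffel_apply hz, H.mkChristoffel_apply hz, H.mk_apply hz, H.mk_apply hz,
    H.symm z hz x, H.koszul hz, H.koszul hz, ← H.fderiv_eq hz, (hs v x).fderiv_eq,
    (hs v y).fderiv_eq, (hs y x).fderiv_eq]
  ring

theorem contDiffAt_christoffel (hz : z ∈ O) :
    ContDiffAt ℝ ∞ (fun z => mkBilin (localChristoffel b z)) z := by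
  refine contDiffAt_mkBilin fun i j => contDiffAt_metricTrace (X := Eu k) (V := Eu k) (b := b)
    (Q := fun z a c => ((1 / 2 : ℝ) * (fderiv ℝ (fun z' => b z' (stdVec j) a) z (stdVec i)
      + fderiv ℝ (fun z' => b z' (stdVec i) a) z (stdVec j)
      - fderiv ℝ (fun z' => b z' (stdVec i) (stdVec j)) z a)) • c) (fun _ _ => H.contDiffAt hz _ _)
    (H.det_pos hz).ne' fun a c => ?_
  have hf : ∀ p q r : Eu k, ContDiffAt ℝ ∞ (fun z => fderiv ℝ (fun z' => b z' p q) z r) z :=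
    fun p q r => contDiffAt_fderiv_apply (H.contDiffAt hz p q) r
  exact ((contDiffAt_const (c := (1 / 2 : ℝ))).mul (((hf _ _ _).add (hf _ _ _)).sub
    (hf _ _ _))).smul contDiffAt_const

end LocalMetric

/-- The Gauss formula: the tangential part of `∇_v (dU w)` is `dU (γ(v, w))`. -/
theorem gauss_formula {n m : ℕ} {g : Eu m → Eu m → Eu m → ℝ} {O : Set (Eu m)}
    (hg : LocalMetric g O) {h : Eu n → Eu n → Eu n → ℝ} {D : Set (Eu n)} (hh : LocalMetric h D)
    {U : Eu n → Eu m} {x : Eu n} (hx : x ∈ D) (hUx : U x ∈ O) (hU : ContDiffAt ℝ 2 U x)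
    (hpull : ∀ᶠ y in 𝓝 x, ∀ v w, h y v w = g (U y) (fderiv ℝ U y v) (fderiv ℝ U y w))
    (v w a : Eu n) :
    g (U x) (covAlong (fun z => mkBilin (localChristoffel g z)) U (fun z => fderiv ℝ U z w) x v)
      (fderiv ℝ U x a) = h x (localChristoffel h x v w) a := by
  have hd : DifferentiableAt ℝ U x := hU.differentiableAt (by norm_num)
  have hG := (hg.contDiffAt_mk hUx).differentiableAt (by simp)
  have key : ∀ v w a : Eu n, fderiv ℝ (fun y => h y w a) x v
      = g (U x) (covAlong (fun z => mkBilin (localChristoffel g z)) U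
          (fun z => fderiv ℝ U z w) x v) (fderiv ℝ U x a)
        + g (U x) (covAlong (fun z => mkBilin (localChristoffel g z)) U
          (fun z => fderiv ℝ U z a) x v) (fderiv ℝ U x w) := fun v w a => by
    have he : (fun y => h y w a) =ᶠ[𝓝 x]
        fun y => mkBilin (g (U y)) (fderiv ℝ U y w) (fderiv ℝ U y a) := by
      filter_upwards [hpull, hd.continuousAt.preimage_mem_nhds (hg.isOpen.mem_nhds hUx)] with y h1 h2
      rw [h1, hg.mk_apply h2]
    have hm := fderiv_metric (G := fun z => mkBilin (g z)) hG (hg.isCompat hUx) hd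
      (differentiableAt_fderiv_apply hU w)
      (differentiableAt_fderiv_apply hU a) v
    rw [he.fderiv_eq, hm, hg.mk_apply hUx, hg.mk_apply hUx, hg.symm _ hUx (fderiv ℝ U x w)]
  have hc : ∀ v w : Eu n, covAlong (fun z => mkBilin (localChristoffel g z)) U
      (fun z => fderiv ℝ U z w) x v = covAlong (fun z => mkBilin (localChristoffel g z)) U
      (fun z => fderiv ℝ U z v) x w := fun v w =>
    covAlong_fderiv_comm (fun p q => by
      rw [hg.mkChristoffel_apply hUx, hg.mkChristoffel_apply hUx, hg.christoffel_symm hUx]) hU v w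
  -- In the Koszul combination of the three derivatives, the symmetry of `∇dU` leaves twice the
  -- required term.
  rw [hh.koszul hx, key, key, key, hc w v, hc a v, hc a w]
  ring

end LocalMetric

/-! ### First and second derivatives of a weighted volume density. -/

section Density

variable {k : ℕ}

/-- Jacobi's formula with `adj M = det M · M⁻¹`, written so that the logarithmic derivative of the
density appears as a factor. -/
theorem hasDerivAt_sqrt_det_mul_exp {M : ℝ → Matrix (Fin k) (Fin k) ℝ}
    {M' : Matrix (Fin k) (Fin k) ℝ} {φ : ℝ → ℝ} {φ' t : ℝ}
    (hM : ∀ i j, HasDerivAt (fun t => M t i j) (M' i j) t) (hφ : HasDerivAt φ φ' t)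
    (h0 : 0 < (M t).det) :
    HasDerivAt (fun t => Real.sqrt (M t).det * Real.exp (-φ t))
      (Real.sqrt (M t).det * Real.exp (-φ t)
        * ((1 / 2 : ℝ) * (∑ i, ∑ j, (M t)⁻¹ i j * M' j i) - φ')) t := by
  have h1 : HasDerivAt (fun t => Real.sqrt (M t).det * Real.exp (-φ t)) _ t :=
    ((hasDerivAt_det hM).sqrt h0.ne').mul (hφ.fun_neg.exp)
  refine h1.congr_deriv ?_
  have h2 : ∑ i, ∑ j, (M t).adjugate i j * M' j i = (M t).det * ∑ i, ∑ j, (M t)⁻¹ i j * M' j i := by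
    simp_rw [Finset.mul_sum]
    refine Finset.sum_congr rfl fun i _ => Finset.sum_congr rfl fun j _ => ?_
    simp only [Matrix.inv_def, Ring.inverse_eq_inv', Matrix.smul_apply, smul_eq_mul]
    field_simp
  rw [h2]
  have h3 := Real.mul_self_sqrt h0.le
  have h4 := (Real.sqrt_pos.2 h0).ne'
  have h5 : (M t).det * (∑ i, ∑ j, (M t)⁻¹ i j * M' j i) / (2 * Real.sqrt (M t).det)
      = (1 / 2 : ℝ) * (Real.sqrt (M t).det * ∑ i, ∑ j, (M t)⁻¹ i j * M' j i) := by
    field_simp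
    rw [pow_two, h3]
    ring
  rw [h5]
  ring

/-- Differentiate `M M⁻¹ = 1` at a point where `M` and `M⁻¹` are the identity. -/
theorem hasDerivAt_inv_of_eq_one {M : ℝ → Matrix (Fin k) (Fin k) ℝ}
    (hM : ∀ i j, ContDiffAt ℝ ∞ (fun t => M t i j) 0) (h1 : M 0 = 1) (i j : Fin k) :
    HasDerivAt (fun t => (M t)⁻¹ i j) (-deriv (fun t => M t i j) 0) 0 := by
  have hdet : ContDiffAt ℝ ∞ (fun t => (M t).det) 0 := contDiffAt_matrix_det hM
  have h0 : (M 0).det ≠ 0 := by simp [h1]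
  have hinv := fun a c => (contDiffAt_matrix_inv hM h0 a c).differentiableAt (by simp)
  have hMd := fun a c => (hM a c).differentiableAt (by simp)
  have ev : (fun t => ∑ l, M t i l * (M t)⁻¹ l j) =ᶠ[𝓝 0] fun _ => (1 : Matrix _ _ ℝ) i j := by
    filter_upwards [hdet.continuousAt.eventually_ne h0] with t ht
    rw [← Matrix.mul_apply, Matrix.mul_nonsing_inv _ (isUnit_iff_ne_zero.2 ht)]
  have hd := HasDerivAt.fun_sum (u := Finset.univ) fun l (_ : l ∈ Finset.univ) =>
    (hMd i l).hasDerivAt.mul (hinv l j).hasDerivAt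
  have hz := hd.unique ((hasDerivAt_const (0 : ℝ) ((1 : Matrix _ _ ℝ) i j)).congr_of_eventuallyEq ev)
  rw [Finset.sum_add_distrib] at hz
  simp only [h1, inv_one, Matrix.one_apply, mul_ite, mul_one, mul_zero, ite_mul, one_mul, zero_mul,
    Finset.sum_ite_eq, Finset.sum_ite_eq', Finset.mem_univ, if_true] at hz
  refine (hinv i j).hasDerivAt.congr_deriv ?_
  linarith

/-- The density satisfies `w' = w λ`. As `hcrit` says `λ(0) = 0`, the product rule gives `w''(0) =
w(0) λ'(0)` without a `λ²` term. This is where criticality of the volume enters the second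
derivative. -/
theorem deriv_deriv_sqrt_det_mul_exp {M : ℝ → Matrix (Fin k) (Fin k) ℝ} {φ : ℝ → ℝ}
    (hM : ∀ i j, ContDiffAt ℝ ∞ (fun t => M t i j) 0) (hφ : ContDiffAt ℝ ∞ φ 0) (h1 : M 0 = 1)
    (hcrit : (1 / 2 : ℝ) * ∑ i, deriv (fun t => M t i i) 0 - deriv φ 0 = 0) :
    deriv (deriv fun t => Real.sqrt (M t).det * Real.exp (-φ t)) 0
      = Real.exp (-φ 0) * ((1 / 2 : ℝ) * ∑ i, deriv (deriv fun t => M t i i) 0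
        - (1 / 2 : ℝ) * ∑ i, ∑ j, deriv (fun t => M t i j) 0 * deriv (fun t => M t j i) 0
        - deriv (deriv φ) 0) := by
  have hdet : ContDiffAt ℝ ∞ (fun t => (M t).det) 0 := contDiffAt_matrix_det hM
  have hd1 : ∀ {ψ : ℝ → ℝ}, ContDiffAt ℝ ∞ ψ 0 → ∀ᶠ t in 𝓝 0, DifferentiableAt ℝ ψ t := fun h =>
    ((h.of_le (m := 1) (WithTop.coe_le_coe.2 le_top)).eventually (by simp)).mono
      fun t ht => ht.differentiableAt (by norm_num)
  have hd2 : ∀ {ψ : ℝ → ℝ}, ContDiffAt ℝ ∞ ψ 0 → HasDerivAt (deriv ψ) (deriv (deriv ψ) 0) 0 :=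
    fun {ψ} h => by
      have := contDiffAt_fderiv_apply h (1 : ℝ)
      exact (this.differentiableAt (by simp)).hasDerivAt
  have hpos : ∀ᶠ t in 𝓝 (0 : ℝ), 0 < (M t).det :=
    hdet.continuousAt.eventually (lt_mem_nhds (by simp [h1]))
  set lam : ℝ → ℝ := fun t => (1 / 2 : ℝ) * (∑ i, ∑ j, (M t)⁻¹ i j * deriv (fun t => M t j i) t)
    - deriv φ t with hlam
  have hev : deriv (fun t => Real.sqrt (M t).det * Real.exp (-φ t)) =ᶠ[𝓝 0]
      fun t => Real.sqrt (M t).det * Real.exp (-φ t) * lam t := by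
    have hMe : ∀ᶠ t in 𝓝 (0 : ℝ), ∀ i j, DifferentiableAt ℝ (fun t => M t i j) t := by
      simp only [Filter.eventually_all]
      exact fun i j => hd1 (hM i j)
    filter_upwards [hpos, hMe, hd1 hφ] with t h2 h3 h4
    exact (hasDerivAt_sqrt_det_mul_exp (fun i j => (h3 i j).hasDerivAt) h4.hasDerivAt h2).deriv
  have hl0 : lam 0 = 0 := by
    simp only [hlam]
    refine Eq.trans ?_ hcrit
    simp only [h1, inv_one, Matrix.one_apply, ite_mul, one_mul, zero_mul, Finset.sum_ite_eq,
      Finset.mem_univ, if_true]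
  have hl : HasDerivAt lam ((1 / 2 : ℝ) * ∑ i, deriv (deriv fun t => M t i i) 0
        - (1 / 2 : ℝ) * ∑ i, ∑ j, deriv (fun t => M t i j) 0 * deriv (fun t => M t j i) 0
        - deriv (deriv φ) 0) 0 := by
    have := ((HasDerivAt.fun_sum (u := Finset.univ) fun i (_ : i ∈ Finset.univ) =>
      HasDerivAt.fun_sum (u := Finset.univ) fun j (_ : j ∈ Finset.univ) =>
      (hasDerivAt_inv_of_eq_one hM h1 i j).mul (hd2 (hM j i))).const_mul (1 / 2 : ℝ)).sub (hd2 hφ)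
    refine this.congr_deriv ?_
    simp only [h1, inv_one, Matrix.one_apply, ite_mul, one_mul, zero_mul, Finset.sum_ite_eq,
      Finset.mem_univ, if_true, Finset.sum_add_distrib, neg_mul, Finset.sum_neg_distrib]
    ring
  have hw := (hasDerivAt_sqrt_det_mul_exp (fun i j => (hd1 (hM i j)).self_of_nhds.hasDerivAt)
    (hd1 hφ).self_of_nhds.hasDerivAt hpos.self_of_nhds).mul hl
  rw [hev.deriv_eq]
  refine (hw.congr_deriv ?_).deriv
  rw [hl0]
  simp [h1]

end Density

/-! ### The weighted divergence in coordinates. -/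

section Divergence

variable {n : ℕ}

theorem trace_eq_sum_frame {b : Eu n → Eu n → ℝ} (hb : IsBil b) {e : Fin n → Eu n}
    (he : IsON b e) (A : Eu n →L[ℝ] Eu n) :
    ∑ i, A (stdVec i) i = ∑ l, b (e l) (A (e l)) := by
  have h1 : ∀ i, A (stdVec i) i = ∑ l, e l i * b (e l) (A (stdVec i)) := fun i => by
    conv_lhs => rw [he.expand hb (A (stdVec i))]
    simp [mul_comm]
  have h2 : ∀ l, b (e l) (A (e l)) = ∑ i, e l i * b (e l) (A (stdVec i)) := fun l => by
    conv_lhs => rw [eq_sum_stdVec (e l), map_sum]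
    simp_rw [map_smul]
    rw [← eq_sum_stdVec, hb.sum_right]
    simp
  simp_rw [h1, h2]
  exact Finset.sum_comm

/-- Measuring `b'` in a `b`-orthonormal frame splits off the factor `det (gram b)`. When `b'` varies
with time this factor is constant, and the matrix left to differentiate is the identity when `b' =
b`. -/
theorem det_gram_eq_frame {b b' : Eu n → Eu n → ℝ} (hb : IsBil b) (hb' : IsBil b')
    {e : Fin n → Eu n} (he : IsON b e) :
    (gram b').det = (gram b).det * (Matrix.of fun i j => b' (e i) (e j)).det := by
  have h1 := congrArg Matrix.det (he.frame_mul hb)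
  rw [hb'.gram_frame]
  simp only [Matrix.det_mul, Matrix.det_transpose, Matrix.det_one] at h1 ⊢
  linear_combination (-(gram b').det) * h1

/-- Differentiating `√det` along `X` contributes `∑ h(γ(X, eᵢ), eᵢ)`. Expressing the coordinate
derivative of `X` through its dual form `α` contributes the same sum with the opposite sign. What is
left is the trace of `∇α` and the weight. The vectors `eᵢ` are constant in the chart and orthonormal
only at `x`. -/
theorem divergence_formula {h : Eu n → Eu n →L[ℝ] Eu n →L[ℝ] ℝ} {φ : Eu n → ℝ} {X : Eu n → Eu n}
    {α : Eu n → Eu n → ℝ} {x : Eu n} {γ : Eu n → Eu n → Eu n} {e : Fin n → Eu n}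
    (hh1 : ContDiffAt ℝ 1 h x) (hsymm : ∀ v w, h x v w = h x w v) (hγs : ∀ v w, γ v w = γ w v)
    (hc : ∀ v a b, fderiv ℝ h x v a b = h x (γ v a) b + h x a (γ v b))
    (he : IsON (fun v w => h x v w) e) (hφ : DifferentiableAt ℝ φ x) (hX : DifferentiableAt ℝ X x)
    (hα : ∀ᶠ y in 𝓝 x, ∀ v, h y (X y) v = α y v) :
    ∑ i, fderiv ℝ (fun y => (Real.sqrt (gram fun v w => h y v w).det * Real.exp (-φ y)) * X y i) x
        (stdVec i)
      = (Real.sqrt (gram fun v w => h x v w).det * Real.exp (-φ x))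
        * (∑ i, (fderiv ℝ (fun y => α y (e i)) x (e i) - α x (γ (e i) (e i))) - fderiv ℝ φ x (X x)) := by
  have hh := hh1.differentiableAt (by norm_num)
  have hb := fun y => isBil_clm (h y)
  set w : Eu n → ℝ := fun y => Real.sqrt (gram fun v w => h y v w).det * Real.exp (-φ y) with hw
  have hpos := det_gram_pos_of_isON (hb x) he
  have hentry : ∀ a c, DifferentiableAt ℝ (fun y => h y a c) x := fun a c =>
    (hh.clm_apply (differentiableAt_const a)).clm_apply (differentiableAt_const c)
  have hentry' : ∀ a c v, fderiv ℝ (fun y => h y a c) x v = fderiv ℝ h x v a c := fun a c v => by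
    rw [((hh.hasFDerivAt.clm_apply (hasFDerivAt_const a x)).clm_apply
      (hasFDerivAt_const c x)).fderiv]
    simp
  have hdetd : DifferentiableAt ℝ (fun y => (gram fun v w => h y v w).det) x := by
    refine (contDiffAt_matrix_det (r := 1) fun i j => ?_).differentiableAt (by norm_num)
    exact (hh1.clm_apply contDiffAt_const).clm_apply contDiffAt_const
  have hwd : DifferentiableAt ℝ w x :=
    (hdetd.sqrt hpos.ne').mul hφ.neg.exp
  have hwv : ∀ v, fderiv ℝ w x v = w x * ((1 / 2 : ℝ) * ∑ i, fderiv ℝ h x v (e i) (e i)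
      - fderiv ℝ φ x v) := by
    intro v
    have hl : HasDerivAt (fun t : ℝ => x + t • v) v 0 := by
      simpa using ((hasDerivAt_id (0 : ℝ)).smul_const v).const_add x
    have hcomp : ∀ {ψ : Eu n → ℝ}, DifferentiableAt ℝ ψ x →
        HasDerivAt (fun t : ℝ => ψ (x + t • v)) (fderiv ℝ ψ x v) 0 := fun {ψ} hψ => by
      have : HasFDerivAt ψ (fderiv ℝ ψ x) (x + (0 : ℝ) • v) := by simpa using hψ.hasFDerivAt
      exact this.comp_hasDerivAt 0 hl
    have h1 := hasDerivAt_sqrt_det_mul_exp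
      (M := fun t => Matrix.of fun i j => h (x + t • v) (e i) (e j))
      (M' := Matrix.of fun i j => fderiv ℝ h x v (e i) (e j)) (φ := fun t => φ (x + t • v))
      (t := 0) (fun i j => by
        have := hcomp (hentry (e i) (e j))
        rw [hentry'] at this
        exact this) (hcomp hφ) (by
        have : (Matrix.of fun i j => h (x + (0 : ℝ) • v) (e i) (e j)) = 1 := by
          ext i j
          simp [he i j, Matrix.one_apply]
        rw [this]; simp)
    have hM0 : (Matrix.of fun i j => h (x + (0 : ℝ) • v) (e i) (e j)) = 1 := by
      ext i j
      simp [he i j, Matrix.one_apply]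
    have h2 := (hcomp hwd).unique ((h1.const_mul (Real.sqrt (gram fun v w => h x v w).det)).congr_of_eventuallyEq
      (Filter.Eventually.of_forall fun t => by
        simp only [hw]
        rw [det_gram_eq_frame (hb x) (hb _) he, Real.sqrt_mul hpos.le, mul_assoc]))
    rw [h2, hM0]
    simp [hw, Matrix.one_apply]
    ring
  have hXd : ∀ i, DifferentiableAt ℝ (fun y => X y i) x := fun i =>
    (EuclideanSpace.proj i : Eu n →L[ℝ] ℝ).differentiableAt.comp x hX
  have hXv : ∀ i v, fderiv ℝ (fun y => X y i) x v = fderiv ℝ X x v i := fun i v => by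
    have := ((EuclideanSpace.proj i : Eu n →L[ℝ] ℝ).hasFDerivAt.comp x hX.hasFDerivAt).fderiv
    exact congrArg (fun L => L v) this
  have hstep : ∑ i, fderiv ℝ (fun y => w y * X y i) x (stdVec i)
      = fderiv ℝ w x (X x) + w x * ∑ i, fderiv ℝ X x (stdVec i) i := by
    have h1 : fderiv ℝ w x (X x) = ∑ i, X x i * fderiv ℝ w x (stdVec i) := by
      conv_lhs => rw [eq_sum_stdVec (X x), map_sum]
      simp
    rw [h1, Finset.mul_sum, ← Finset.sum_add_distrib]
    refine Finset.sum_congr rfl fun i _ => ?_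
    rw [fderiv_fun_mul hwd (hXd i)]
    simp only [add_apply, smul_apply, smul_eq_mul, hXv]
    ring
  have hcov : ∀ i, h x (e i) (fderiv ℝ X x (e i)) = fderiv ℝ (fun y => α y (e i)) x (e i)
      - h x (γ (X x) (e i)) (e i) - α x (γ (e i) (e i)) := fun i => by
    have hev : (fun y => h y (X y) (e i)) =ᶠ[𝓝 x] fun y => α y (e i) := by
      filter_upwards [hα] with y hy using hy _
    rw [← hev.fderiv_eq, ← hα.self_of_nhds,
      hasFDerivAt_bilin hh.hasFDerivAt hX.hasFDerivAt (hasFDerivAt_const (e i) x), hc,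
      hγs (X x), hsymm (e i)]
    simp only [zero_apply, map_zero, add_zero]
    ring
  rw [hstep, trace_eq_sum_frame (hb x) he, hwv]
  simp_rw [hcov, hc]
  have hsum : ∀ i, h x (γ (X x) (e i)) (e i) + h x (e i) (γ (X x) (e i))
      = 2 * h x (γ (X x) (e i)) (e i) := fun i => by rw [hsymm (e i)]; ring
  simp_rw [hsum, Finset.sum_sub_distrib, ← Finset.mul_sum]
  ring

end Divergence

/-! ### The pointwise second variation identity in coordinates. -/

section LocalIdentity

variable {n : ℕ} {F : Type*} [NormedAddCommGroup F] [NormedSpace ℝ F]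

theorem hasFDerivAt_zero_prodMk (x : Eu n) :
    HasFDerivAt (fun y : Eu n => ((0 : ℝ), y)) (ContinuousLinearMap.inr ℝ ℝ (Eu n)) x :=
  (hasFDerivAt_const (0 : ℝ) x).prodMk (hasFDerivAt_id x)

theorem fderiv_comp_zero_prodMk {F' : Type*} [NormedAddCommGroup F'] [NormedSpace ℝ F']
    {K : ℝ × Eu n → F'} {x : Eu n} (hK : DifferentiableAt ℝ K (0, x)) (v : Eu n) :
    fderiv ℝ (fun y => K (0, y)) x v = fderiv ℝ K (0, x) (0, v) := by
  have := (HasFDerivAt.comp (g := K) x hK.hasFDerivAt (hasFDerivAt_zero_prodMk x)).fderiv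
  exact congrArg (fun L => L v) this

theorem deriv_prodMk_right {F' : Type*} [NormedAddCommGroup F'] [NormedSpace ℝ F']
    {K : ℝ × Eu n → F'} {x : Eu n} {t : ℝ} (hK : DifferentiableAt ℝ K (t, x)) :
    deriv (fun t => K (t, x)) t = fderiv ℝ K (t, x) (1, 0) :=
  (hK.hasFDerivAt.comp_hasDerivAt t ((hasDerivAt_id t).prodMk (hasDerivAt_const t x))).deriv

theorem deriv_deriv_prodMk_right {K : ℝ × Eu n → ℝ} {x : Eu n} (hK : ContDiffAt ℝ ∞ K (0, x)) :
    deriv (deriv fun t => K (t, x)) 0 = fderiv ℝ (fun z => fderiv ℝ K z (1, 0)) (0, x) (1, 0) := by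
  have hc : Filter.Tendsto (fun t : ℝ => (t, x)) (𝓝 0) (𝓝 (0, x)) :=
    (Continuous.prodMk_left x).continuousAt
  have hev : (deriv fun t => K (t, x)) =ᶠ[𝓝 0] fun t => fderiv ℝ K (t, x) (1, 0) := by
    have := hc.eventually ((hK.of_le (m := 1) (WithTop.coe_le_coe.2 le_top)).eventually (by simp))
    filter_upwards [this] with t ht
    exact deriv_prodMk_right (ht.differentiableAt (by norm_num))
  rw [hev.deriv_eq]
  exact deriv_prodMk_right (K := fun z => fderiv ℝ K z (1, 0))
    ((contDiffAt_fderiv_apply hK (1, 0)).differentiableAt (by simp))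

set_option maxHeartbeats 1000000 in
/-- The pointwise form of the second variation formula in coordinates: up to a divergence, the
second derivative of the weighted volume density is given by the stability operator. -/
theorem second_variation_density {G : F → F →L[ℝ] F →L[ℝ] ℝ} {Γ : F → F →L[ℝ] F →L[ℝ] F}
    {Ψ : ℝ × Eu n → F} {f : F → ℝ} {x : Eu n} {h : Eu n → Eu n →L[ℝ] Eu n →L[ℝ] ℝ}
    {γ : Eu n → Eu n → Eu n} {e : Fin n → Eu n} {X : Eu n → Eu n} {Q : Eu n → Eu n → F}
    {ρ : Eu n → Eu n → Eu n}
    (hG : ContDiffAt ℝ ∞ G (Ψ (0, x))) (hΓ : ContDiffAt ℝ ∞ Γ (Ψ (0, x)))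
    (hΨ : ContDiffAt ℝ ∞ Ψ (0, x)) (hf : ContDiffAt ℝ ∞ f (Ψ (0, x)))
    (hsG : ∀ᶠ y in 𝓝 (Ψ (0, x)), ∀ v w, G y v w = G y w v)
    (hsΓ : ∀ᶠ y in 𝓝 (Ψ (0, x)), ∀ v w, Γ y v w = Γ y w v)
    (hc : ∀ᶠ y in 𝓝 (Ψ (0, x)), IsCompat G Γ y)
    (hh : ContDiffAt ℝ 1 h x)
    (hpull : ∀ᶠ y in 𝓝 x, ∀ v w, h y v w
      = G (Ψ (0, y)) (fderiv ℝ Ψ (0, y) (0, v)) (fderiv ℝ Ψ (0, y) (0, w)))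
    (hγs : ∀ v w, γ v w = γ w v)
    (hγc : ∀ v a b, fderiv ℝ h x v a b = h x (γ v a) b + h x a (γ v b))
    (he : IsON (fun v w => h x v w) e)
    (hnormal : ∀ᶠ y in 𝓝 x, ∀ v,
      G (Ψ (0, y)) (fderiv ℝ Ψ (0, y) (1, 0)) (fderiv ℝ Ψ (0, y) (0, v)) = 0)
    (hmin : ∀ V, ∑ i, (G (Ψ (0, x)) (covAlong Γ Ψ (fun z => fderiv ℝ Ψ z (0, e i)) (0, x) (0, e i)) V
        - G (Ψ (0, x)) (fderiv ℝ Ψ (0, x) (0, γ (e i) (e i))) V) + fderiv ℝ f (Ψ (0, x)) V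
        - ∑ i, fderiv ℝ f (Ψ (0, x)) (fderiv ℝ Ψ (0, x) (0, e i))
          * G (Ψ (0, x)) (fderiv ℝ Ψ (0, x) (0, e i)) V = 0)
    (hX : DifferentiableAt ℝ X x)
    (hXα : ∀ᶠ y in 𝓝 x, ∀ v, h y (X y) v = fderiv ℝ (fun z =>
      G (Ψ z) (fderiv ℝ Ψ z (1, 0)) (fderiv ℝ Ψ z (0, v))) (0, y) (1, 0))
    (hQd : ∀ v, DifferentiableAt ℝ (fun y => Q y v) x)
    (hρd : ∀ v, DifferentiableAt ℝ (fun y => ρ y v) x)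
    (hQ : ∀ᶠ y in 𝓝 x, ∀ v, covAlong Γ Ψ (fun z => fderiv ℝ Ψ z (1, 0)) (0, y) (0, v)
      = Q y v + fderiv ℝ Ψ (0, y) (0, ρ y v))
    (hQn : ∀ v w, G (Ψ (0, x)) (Q x v) (fderiv ℝ Ψ (0, x) (0, w)) = 0) :
    deriv (deriv fun t => Real.sqrt (gram fun v w => G (Ψ (t, x)) (fderiv ℝ Ψ (t, x) (0, v))
        (fderiv ℝ Ψ (t, x) (0, w))).det * Real.exp (-f (Ψ (t, x)))) 0
      = ∑ i, fderiv ℝ (fun y => (Real.sqrt (gram fun v w => h y v w).det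
          * Real.exp (-f (Ψ (0, y)))) * X y i) x (stdVec i)
        - (∑ i, (G (Ψ (0, x)) (fderiv ℝ Ψ (0, x) (1, 0)) (fderiv ℝ (fun y => Q y (e i)) x (e i)
              + Γ (Ψ (0, x)) (fderiv ℝ Ψ (0, x) (0, e i)) (Q x (e i)))
            - G (Ψ (0, x)) (fderiv ℝ Ψ (0, x) (1, 0)) (Q x (γ (e i) (e i)))
            - fderiv ℝ f (Ψ (0, x)) (fderiv ℝ Ψ (0, x) (0, e i))
              * G (Ψ (0, x)) (fderiv ℝ Ψ (0, x) (1, 0)) (Q x (e i))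
            - G (Ψ (0, x)) (curv Γ (Ψ (0, x)) (fderiv ℝ Ψ (0, x) (0, e i))
                (fderiv ℝ Ψ (0, x) (1, 0)) (fderiv ℝ Ψ (0, x) (0, e i)))
                (fderiv ℝ Ψ (0, x) (1, 0)))
          + ∑ i, ∑ j, (G (Ψ (0, x)) (covAlong Γ Ψ (fun z => fderiv ℝ Ψ z (0, e j)) (0, x) (0, e i))
                (fderiv ℝ Ψ (0, x) (1, 0))) ^ 2
          + (fderiv ℝ (fun y => fderiv ℝ f y (fderiv ℝ Ψ (0, x) (1, 0))) (Ψ (0, x))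
                (fderiv ℝ Ψ (0, x) (1, 0))
              - fderiv ℝ f (Ψ (0, x)) (Γ (Ψ (0, x)) (fderiv ℝ Ψ (0, x) (1, 0))
                (fderiv ℝ Ψ (0, x) (1, 0)))))
          * (Real.sqrt (gram fun v w => h x v w).det * Real.exp (-f (Ψ (0, x)))) := by
  have le1 : (1 : WithTop ℕ∞) ≤ ∞ := WithTop.coe_le_coe.2 le_top
  have le2 : (2 : WithTop ℕ∞) ≤ ∞ := WithTop.coe_le_coe.2 le_top
  have hGΨ : ContDiffAt ℝ ∞ (fun z => G (Ψ z)) (0, x) := ContDiffAt.comp (g := G) _ hG hΨ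
  have hfΨ : ContDiffAt ℝ ∞ (fun z => f (Ψ z)) (0, x) := ContDiffAt.comp (g := f) _ hf hΨ
  have hD := fun a => contDiffAt_fderiv_apply hΨ a
  have hDd := fun a => (hD a).differentiableAt (by simp)
  have hΨd := hΨ.differentiableAt (by simp)
  have hGd := hG.differentiableAt (by simp)
  have hH : ∀ a b, ContDiffAt ℝ ∞ (fun z => G (Ψ z) (fderiv ℝ Ψ z a) (fderiv ℝ Ψ z b)) (0, x) :=
    fun a b => (hGΨ.clm_apply (hD a)).clm_apply (hD b)
  have hHd := fun a b => (hH a b).differentiableAt (by simp)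
  have hsg := hsG.self_of_nhds
  have hsγ := hsΓ.self_of_nhds
  have hcc := hc.self_of_nhds
  have hcomm : ∀ a b, covAlong Γ Ψ (fun z => fderiv ℝ Ψ z b) (0, x) a
      = covAlong Γ Ψ (fun z => fderiv ℝ Ψ z a) (0, x) b := fun a b =>
    covAlong_fderiv_comm hsγ (hΨ.of_le le2) a b
  have hmet : ∀ a b c, fderiv ℝ (fun z => G (Ψ z) (fderiv ℝ Ψ z a) (fderiv ℝ Ψ z b)) (0, x) c = _ :=
    fun a b c => fderiv_metric hGd hcc hΨd (hDd a) (hDd b) c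
  set z0 : ℝ × Eu n := (0, x) with hz0
  set T := fderiv ℝ Ψ z0 (1, 0) with hT
  set Z := covAlong Γ Ψ (fun z => fderiv ℝ Ψ z (1, 0)) z0 (1, 0) with hZ
  set G0 := G (Ψ z0) with hG0
  have hp0 : ∀ v w, h x v w = G0 (fderiv ℝ Ψ z0 (0, v)) (fderiv ℝ Ψ z0 (0, w)) := hpull.self_of_nhds
  have hQ0 : ∀ v, covAlong Γ Ψ (fun z => fderiv ℝ Ψ z (1, 0)) z0 (0, v)
      = Q x v + fderiv ℝ Ψ z0 (0, ρ x v) := hQ.self_of_nhds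
  have hX0 : ∀ v, h x (X x) v = fderiv ℝ (fun z =>
      G (Ψ z) (fderiv ℝ Ψ z (1, 0)) (fderiv ℝ Ψ z (0, v))) z0 (1, 0) := hXα.self_of_nhds
  have hTn : ∀ v, G0 T (fderiv ℝ Ψ z0 (0, v)) = 0 := hnormal.self_of_nhds
  -- derivative of the normality condition
  have hN : ∀ v w, G0 (covAlong Γ Ψ (fun z => fderiv ℝ Ψ z (1, 0)) z0 (0, v))
      (fderiv ℝ Ψ z0 (0, w)) + G0 T (covAlong Γ Ψ (fun z => fderiv ℝ Ψ z (0, w)) z0 (0, v)) = 0 := by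
    intro v w
    rw [← hmet, ← fderiv_comp_zero_prodMk (hHd (1, 0) (0, w))]
    have : (fun y => G (Ψ (0, y)) (fderiv ℝ Ψ (0, y) (1, 0)) (fderiv ℝ Ψ (0, y) (0, w)))
        =ᶠ[𝓝 x] fun _ => 0 := by
      filter_upwards [hnormal] with y hy using hy w
    rw [this.fderiv_eq]
    simp
  set b : Fin n → Fin n → ℝ := fun i j =>
    G0 (covAlong Γ Ψ (fun z => fderiv ℝ Ψ z (0, e j)) z0 (0, e i)) T with hb
  have hbs : ∀ i j, b i j = b j i := fun i j => by simp only [hb]; rw [hcomm]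
  have hNb : ∀ i j, G0 (covAlong Γ Ψ (fun z => fderiv ℝ Ψ z (1, 0)) z0 (0, e i))
      (fderiv ℝ Ψ z0 (0, e j)) = -b i j := fun i j => by
    have := hN (e i) (e j)
    rw [hsg T] at this
    linarith
  -- first derivative of the metric
  have hM1 : ∀ i j, deriv (fun t => G (Ψ (t, x)) (fderiv ℝ Ψ (t, x) (0, e i))
      (fderiv ℝ Ψ (t, x) (0, e j))) 0 = -2 * b i j := fun i j => by
    rw [deriv_prodMk_right (hHd (0, e i) (0, e j)), hmet, hcomm (1, 0), hcomm (1, 0), hNb,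
      hsg (fderiv ℝ Ψ z0 (0, e i)), hNb, hbs j i]
    ring
  have hφ1 : deriv (fun t => f (Ψ (t, x))) 0 = fderiv ℝ f (Ψ z0) T := by
    rw [deriv_prodMk_right (K := fun z => f (Ψ z)) (hfΨ.differentiableAt (by simp))]
    have := (HasFDerivAt.comp (g := f) z0 (hf.differentiableAt (by simp)).hasFDerivAt
      hΨd.hasFDerivAt).fderiv
    exact congrArg (fun L => L (1, 0)) this
  -- Minimality tested against `T`. Terms that pair `T` with a tangent vector drop out because `T`
  -- is normal.
  have hcrit : ∑ i, b i i + fderiv ℝ f (Ψ z0) T = 0 := by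
    have := hmin T
    have h0 : ∀ v, G0 (fderiv ℝ Ψ z0 (0, v)) T = 0 := fun v => by rw [hsg, hTn]
    simpa [h0, hb] using this
  have hM1' : (Matrix.of fun i j => G (Ψ z0) (fderiv ℝ Ψ z0 (0, e i)) (fderiv ℝ Ψ z0 (0, e j))) = 1 := by
    ext i j
    rw [Matrix.of_apply, ← hG0, ← hp0, Matrix.one_apply]
    exact he i j
  have hline : ContDiffAt ℝ ∞ (fun t : ℝ => (t, x)) 0 := contDiffAt_id.prodMk contDiffAt_const
  have hdd := deriv_deriv_sqrt_det_mul_exp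
    (M := fun t => Matrix.of fun i j => G (Ψ (t, x)) (fderiv ℝ Ψ (t, x) (0, e i))
      (fderiv ℝ Ψ (t, x) (0, e j))) (φ := fun t => f (Ψ (t, x)))
    (fun i j => ContDiffAt.comp (g := fun z => G (Ψ z) (fderiv ℝ Ψ z (0, e i))
      (fderiv ℝ Ψ z (0, e j))) (0 : ℝ) (hH (0, e i) (0, e j)) hline)
    (ContDiffAt.comp (g := fun z => f (Ψ z)) (0 : ℝ) hfΨ hline) hM1' (by
      simp only [Matrix.of_apply, hM1, hφ1, ← Finset.mul_sum]
      linarith)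
  simp only [Matrix.of_apply, hM1] at hdd
  rw [deriv_deriv_prodMk_right (K := fun z => f (Ψ z)) hfΨ] at hdd
  have hM2 : ∀ i, deriv (deriv fun t => G (Ψ (t, x)) (fderiv ℝ Ψ (t, x) (0, e i))
      (fderiv ℝ Ψ (t, x) (0, e i))) 0 = _ := fun i => deriv_deriv_prodMk_right (hH (0, e i) (0, e i))
  simp only [hM2] at hdd
  -- second derivative of the potential
  have hφ2 : fderiv ℝ (fun z => fderiv ℝ (fun z => f (Ψ z)) z (1, 0)) z0 (1, 0)
      = fderiv ℝ (fun y => fderiv ℝ f y T) (Ψ z0) T - fderiv ℝ f (Ψ z0) (Γ (Ψ z0) T T)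
        + fderiv ℝ f (Ψ z0) Z := by
    have hev : (fun z => fderiv ℝ (fun z => f (Ψ z)) z (1, 0)) =ᶠ[𝓝 z0]
        fun z => fderiv ℝ f (Ψ z) (fderiv ℝ Ψ z (1, 0)) := by
      filter_upwards [hΨ.continuousAt.eventually ((hf.of_le le1).eventually (by simp)),
        (hΨ.of_le le1).eventually (by simp)] with z h1 h2
      have := (HasFDerivAt.comp (g := f) z (h1.differentiableAt (by norm_num)).hasFDerivAt
        (h2.differentiableAt (by norm_num)).hasFDerivAt).fderiv
      exact congrArg (fun L => L (1, 0)) this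
    have hf' : DifferentiableAt ℝ (fderiv ℝ f) (Ψ z0) :=
      (hf.fderiv_right (m := 1) (by exact le2)).differentiableAt (by norm_num)
    have h1 := ((HasFDerivAt.comp (g := fderiv ℝ f) z0 hf'.hasFDerivAt hΨd.hasFDerivAt).clm_apply
      (hDd (1, 0)).hasFDerivAt).fderiv
    have h2 := (hf'.hasFDerivAt.clm_apply (hasFDerivAt_const T (Ψ z0))).fderiv
    simp only [Function.comp_def] at h1
    rw [hev.fderiv_eq, h1, h2, hZ, covAlong]
    simp only [add_apply, ContinuousLinearMap.comp_apply, ContinuousLinearMap.flip_apply,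
      zero_apply, map_zero, map_add, ← hT]
    ring
  -- the divergence
  have hα' : ∀ v, fderiv ℝ (fun z => G (Ψ z) (fderiv ℝ Ψ z (1, 0)) (fderiv ℝ Ψ z (0, v))) z0 (1, 0)
      = G0 Z (fderiv ℝ Ψ z0 (0, v)) + G0 T (Q x v) := fun v => by
    rw [hmet, hcomm (1, 0) (0, v), hQ0 v, map_add, hTn, add_zero]
  have hdiv := divergence_formula (φ := fun y => f (Ψ (0, y))) hh (fun v w => by
    rw [hp0, hp0, hsg]) hγs hγc he
    (DifferentiableAt.comp (g := fun z => f (Ψ z)) x (hfΨ.differentiableAt (by simp))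
      (hasFDerivAt_zero_prodMk x).differentiableAt) hX hXα
  have hα2 : ∀ v w, fderiv ℝ (fun y => fderiv ℝ (fun z => G (Ψ z) (fderiv ℝ Ψ z (1, 0))
      (fderiv ℝ Ψ z (0, v))) (0, y) (1, 0)) x w = fderiv ℝ (fun z => fderiv ℝ (fun z =>
        G (Ψ z) (fderiv ℝ Ψ z (1, 0)) (fderiv ℝ Ψ z (0, v))) z (1, 0)) z0 (0, w) := fun v w =>
    fderiv_comp_zero_prodMk (K := fun z => fderiv ℝ (fun z => G (Ψ z) (fderiv ℝ Ψ z (1, 0))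
      (fderiv ℝ Ψ z (0, v))) z (1, 0))
      ((contDiffAt_fderiv_apply (hH (1, 0) (0, v)) (1, 0)).differentiableAt (by simp)) w
  have hφX : fderiv ℝ (fun y => f (Ψ (0, y))) x (X x)
      = ∑ i, (G0 Z (fderiv ℝ Ψ z0 (0, e i)) + G0 T (Q x (e i)))
        * fderiv ℝ f (Ψ z0) (fderiv ℝ Ψ z0 (0, e i)) := by
    rw [fderiv_comp_zero_prodMk (K := fun z => f (Ψ z)) (hfΨ.differentiableAt (by simp))]
    have h1 := (HasFDerivAt.comp (g := f) z0 (hf.differentiableAt (by simp)).hasFDerivAt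
      hΨd.hasFDerivAt).fderiv
    have h2 : fderiv ℝ (fun z => f (Ψ z)) z0 (0, X x)
      = fderiv ℝ f (Ψ z0) (fderiv ℝ Ψ z0 (0, X x)) := congrArg (fun L => L (0, X x)) h1
    rw [h2]
    have h3 : ∀ v : Eu n, ((0 : ℝ), v) = ContinuousLinearMap.inr ℝ ℝ (Eu n) v := fun v => rfl
    conv_lhs => rw [he.expand (isBil_clm _) (X x)]
    rw [h3, map_sum, map_sum, map_sum]
    refine Finset.sum_congr rfl fun i _ => ?_
    rw [map_smul, map_smul, map_smul, smul_eq_mul, ← hα', ← hX0]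
    congr 1
    rw [hp0, hp0, hsg]
  have hα3 : ∀ v, fderiv ℝ (fun z => G (Ψ z) (fderiv ℝ Ψ z (1, 0)) (fderiv ℝ Ψ z (0, v))) (0, x)
      (1, 0) = G0 Z (fderiv ℝ Ψ z0 (0, v)) + G0 T (Q x v) := hα'
  simp only [hα3, hα2, hφX] at hdiv
  -- the second normal derivative of `T`
  have hcov2 : ∀ i, G0 T (covAlong Γ Ψ (fun z => covAlong Γ Ψ (fun z => fderiv ℝ Ψ z (1, 0)) z
      (0, e i)) z0 (0, e i)) = G0 T (fderiv ℝ (fun y => Q y (e i)) x (e i)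
        + Γ (Ψ z0) (fderiv ℝ Ψ z0 (0, e i)) (Q x (e i))) - ∑ j, b i j ^ 2 := by
    intro i
    have hU : DifferentiableAt ℝ (fun y => Ψ (0, y)) x :=
      DifferentiableAt.comp (g := Ψ) x hΨd (hasFDerivAt_zero_prodMk x).differentiableAt
    have hUv : ∀ v, fderiv ℝ (fun y => Ψ (0, y)) x v = fderiv ℝ Ψ z0 (0, v) :=
      fderiv_comp_zero_prodMk hΨd
    have hDΨ : DifferentiableAt ℝ (fun y => fderiv ℝ Ψ (0, y)) x :=
      DifferentiableAt.comp (g := fderiv ℝ Ψ) x ((hΨ.fderiv_right (m := 1)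
        (by exact le2)).differentiableAt (by norm_num)) (hasFDerivAt_zero_prodMk x).differentiableAt
    have hW : DifferentiableAt ℝ (fun y => fderiv ℝ Ψ (0, y) (0, ρ y (e i))) x :=
      hDΨ.clm_apply ((differentiableAt_const (0 : ℝ)).prodMk (hρd (e i)))
    have h1 := covAlong_comp (Γ := Γ) (hasFDerivAt_zero_prodMk x) hΨd
      ((contDiffAt_covAlong hΓ hΨ (hD (1, 0)) (0, e i)).differentiableAt (by simp)) (e i)
    have h2 : (fun y : Eu n => covAlong Γ Ψ (fun z => fderiv ℝ Ψ z (1, 0)) (0, y) (0, e i))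
        =ᶠ[𝓝 x] fun y => Q y (e i) + fderiv ℝ Ψ (0, y) (0, ρ y (e i)) := by
      filter_upwards [hQ] with y hy using hy (e i)
    rw [covAlong_congr h2, covAlong_add (hQd (e i)) hW] at h1
    have h3 : covAlong Γ (fun y => Ψ (0, y)) (fun y => Q y (e i)) x (e i)
        = fderiv ℝ (fun y => Q y (e i)) x (e i)
          + Γ (Ψ z0) (fderiv ℝ Ψ z0 (0, e i)) (Q x (e i)) := by
      rw [covAlong, hUv]
    have hTd : DifferentiableAt ℝ (fun y => fderiv ℝ Ψ (0, y) (1, 0)) x :=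
      hDΨ.clm_apply (differentiableAt_const _)
    -- Differentiating `⟨T, dΨ(ρ)⟩ = 0` moves the derivative from the tangential part of `∇T` to
    -- `T`.
    have h4 := fderiv_metric (Ψ := fun y => Ψ (0, y)) (z := x) hGd hcc hU hTd hW (e i)
    have h5 : (fun y => G (Ψ (0, y)) (fderiv ℝ Ψ (0, y) (1, 0)) (fderiv ℝ Ψ (0, y) (0, ρ y (e i))))
        =ᶠ[𝓝 x] fun _ => 0 := by
      filter_upwards [hnormal] with y hy using hy _
    rw [h5.fderiv_eq, covAlong_comp (Ψ := Ψ) (V := fun z => fderiv ℝ Ψ z (1, 0))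
      (hasFDerivAt_zero_prodMk x) hΨd (hDd (1, 0)) (e i)] at h4
    simp only [ContinuousLinearMap.inr_apply, fderiv_fun_const, Pi.zero_apply, zero_apply] at h1 h4
    have h6 : ∀ w, G0 (covAlong Γ Ψ (fun z => fderiv ℝ Ψ z (1, 0)) z0 (0, e i))
        (fderiv ℝ Ψ z0 (0, w)) = h x (ρ x (e i)) w := fun w => by
      rw [hQ0, map_add, add_apply, hQn, zero_add, hp0]
    -- The tangential part of `∇ᵢT` has components `-bᵢⱼ` in the frame, as for a shape operator.
    have h7 : h x (ρ x (e i)) (ρ x (e i)) = ∑ j, b i j ^ 2 := by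
      conv_lhs => rw [he.expand (isBil_clm _) (ρ x (e i))]
      rw [map_sum, ← he.expand (isBil_clm _) (ρ x (e i))]
      refine Finset.sum_congr rfl fun j _ => ?_
      rw [map_smul, smul_eq_mul, ← neg_sq, pow_two, ← hNb, h6]
      congr 1
      rw [hp0, hp0, hsg]
    have h8 : G0 T (covAlong Γ (fun y => Ψ (0, y)) (fun y => fderiv ℝ Ψ (0, y) (0, ρ y (e i))) x (e i))
        = -∑ j, b i j ^ 2 := by
      rw [← h7, ← h6]
      have h4' : 0 = G0 (covAlong Γ Ψ (fun z => fderiv ℝ Ψ z (1, 0)) z0 (0, e i))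
        (fderiv ℝ Ψ z0 (0, ρ x (e i))) + G0 T (covAlong Γ (fun y => Ψ (0, y))
          (fun y => fderiv ℝ Ψ (0, y) (0, ρ y (e i))) x (e i)) := h4
      linarith
    rw [← h1, map_add, h3, h8]
    ring
  have hsv := fun i => second_variation_metric (z := z0) hG hΓ hΨ hsG hsΓ hc (1, 0) (0, e i)
  -- The acceleration `Z` has no prescribed direction. Its contributions from the metric, the
  -- potential and the divergence will combine to minimality tested against `Z`.
  have hminZ := hmin Z
  -- the density in the frame
  have hpos := det_gram_pos_of_isON (isBil_clm (h x)) he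
  have hw : (fun t => Real.sqrt (gram fun v w => G (Ψ (t, x)) (fderiv ℝ Ψ (t, x) (0, v))
        (fderiv ℝ Ψ (t, x) (0, w))).det * Real.exp (-f (Ψ (t, x))))
      = fun t => Real.sqrt (gram fun v w => h x v w).det *
        (Real.sqrt (Matrix.of fun i j => G (Ψ (t, x)) (fderiv ℝ Ψ (t, x) (0, e i))
          (fderiv ℝ Ψ (t, x) (0, e j))).det * Real.exp (-f (Ψ (t, x)))) := by
    ext t
    have hbil : IsBil fun v w : Eu n => G (Ψ (t, x)) (fderiv ℝ Ψ (t, x) (0, v))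
        (fderiv ℝ Ψ (t, x) (0, w)) :=
      (isBil_clm (G (Ψ (t, x)))).comp
        ((fderiv ℝ Ψ (t, x)).comp (ContinuousLinearMap.inr ℝ ℝ (Eu n))).toLinearMap LinearMap.id
    rw [det_gram_eq_frame (isBil_clm (h x)) hbil he, Real.sqrt_mul hpos.le, mul_assoc]
  -- The square `(M')²` contributes `-2 ∑ⱼ bᵢⱼ²` and the tangential part of `∇T` contributes `+∑ⱼ
  -- bᵢⱼ²`. The balance `-∑ⱼ bᵢⱼ²` is the share of `-⟨B(T), T⟩`.
  have key : ∀ i, (1 / 2 : ℝ) * fderiv ℝ (fun z => fderiv ℝ (fun z => G (Ψ z)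
      (fderiv ℝ Ψ z (0, e i)) (fderiv ℝ Ψ z (0, e i))) z (1, 0)) z0 (1, 0)
        - (1 / 2 : ℝ) * ∑ j, -2 * b i j * (-2 * b j i)
      = (fderiv ℝ (fun z => fderiv ℝ (fun z => G (Ψ z) (fderiv ℝ Ψ z (1, 0))
            (fderiv ℝ Ψ z (0, e i))) z (1, 0)) z0 (0, e i)
          - (G0 Z (fderiv ℝ Ψ z0 (0, γ (e i) (e i))) + G0 T (Q x (γ (e i) (e i)))))
        - (G0 Z (fderiv ℝ Ψ z0 (0, e i)) + G0 T (Q x (e i)))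
            * fderiv ℝ f (Ψ z0) (fderiv ℝ Ψ z0 (0, e i))
        - (G0 T (fderiv ℝ (fun y => Q y (e i)) x (e i)
              + Γ (Ψ z0) (fderiv ℝ Ψ z0 (0, e i)) (Q x (e i)))
            - G0 T (Q x (γ (e i) (e i)))
            - fderiv ℝ f (Ψ z0) (fderiv ℝ Ψ z0 (0, e i)) * G0 T (Q x (e i))
            - G0 (curv Γ (Ψ z0) (fderiv ℝ Ψ z0 (0, e i)) T (fderiv ℝ Ψ z0 (0, e i))) T)
        - ∑ j, b i j ^ 2
        - (G0 (covAlong Γ Ψ (fun z => fderiv ℝ Ψ z (0, e i)) z0 (0, e i)) Z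
            - G0 (fderiv ℝ Ψ z0 (0, γ (e i) (e i))) Z)
        + fderiv ℝ f (Ψ z0) (fderiv ℝ Ψ z0 (0, e i)) * G0 (fderiv ℝ Ψ z0 (0, e i)) Z := by
    intro i
    have h1 : ∑ j, -2 * b i j * (-2 * b j i) = 4 * ∑ j, b i j ^ 2 := by
      rw [Finset.mul_sum]
      exact Finset.sum_congr rfl fun j _ => by rw [hbs j i]; ring
    have h2 := hcov2 i
    rw [hsg T] at h2
    rw [hsv i, h1, hsg Z, hsg Z, ← hT, ← hZ, ← hG0]
    linear_combination -h2
  have hsum := Finset.sum_congr (rfl : (Finset.univ : Finset (Fin n)) = Finset.univ) fun i _ => key i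
  simp only [Finset.sum_sub_distrib, Finset.sum_add_distrib, ← Finset.mul_sum] at hsum hminZ
  rw [hw, hdiv]
  have hcm : ∀ (c : ℝ) (ψ : ℝ → ℝ), deriv (deriv fun t => c * ψ t) 0 = c * deriv (deriv ψ) 0 :=
    fun c ψ => by
      have : (deriv fun t => c * ψ t) = fun t => c * deriv ψ t :=
        funext fun t => deriv_const_mul_field c
      rw [this, deriv_const_mul_field]
  rw [hcm, hdd, hφ2]
  simp only [Finset.sum_sub_distrib, Finset.sum_add_distrib]
  linear_combination (Real.sqrt (gram fun v w => h x v w).det * Real.exp (-f (Ψ z0)))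
    * (hsum - hminZ)

end LocalIdentity

/-! ### Charts, form fields and Riemannian metrics on manifolds. -/

section Charts

variable {k : ℕ} {N : Type*} [TopologicalSpace N] [ChartedSpace (Eu k) N]

/-- The derivative at `x` of the chart around `c`. -/
def dchart (c x : N) : Eu k →L[ℝ] Eu k := mfderiv (𝓡 k) 𝓘(ℝ, Eu k) (extChartAt (𝓡 k) c) x

/-- The derivative at `z` of the inverse of the chart around `c`. -/
def dsymm (c : N) (z : Eu k) : Eu k →L[ℝ] Eu k :=
  mfderiv 𝓘(ℝ, Eu k) (𝓡 k) (extChartAt (𝓡 k) c).symm z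

/-- A form field as a function on `ℝᵏ × ℝᵏ` for every point. -/
def rawForm (h : FormField k N) (x : N) (v w : Eu k) : ℝ := h x v w

theorem chartMetric_eq (h : FormField k N) (c : N) (z v w : Eu k) :
    chartMetric h c z v w
      = rawForm h ((extChartAt (𝓡 k) c).symm z) (dsymm c z v) (dsymm c z w) := rfl

theorem isOpen_chart_target (c : N) : IsOpen (extChartAt (𝓡 k) c).target :=
  isOpen_extChartAt_target c

variable [IsManifold (𝓡 k) ∞ N]

theorem dchart_dsymm {c : N} {z : Eu k} (hz : z ∈ (extChartAt (𝓡 k) c).target) (v : Eu k) :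
    dchart c ((extChartAt (𝓡 k) c).symm z) (dsymm c z v) = v := by
  have := mfderiv_extChartAt_comp_mfderivWithin_extChartAt_symm (I := 𝓡 k) hz
  rw [ModelWithCorners.range_eq_univ, mfderivWithin_univ] at this
  exact congrArg (fun L : Eu k →L[ℝ] Eu k => L v) this

theorem dsymm_dchart {c x : N} (hx : x ∈ (extChartAt (𝓡 k) c).source) (v : Eu k) :
    dsymm c (extChartAt (𝓡 k) c x) (dchart c x v) = v := by
  have := mfderivWithin_extChartAt_symm_comp_mfderiv_extChartAt' (I := 𝓡 k) hx
  rw [ModelWithCorners.range_eq_univ, mfderivWithin_univ] at this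
  exact congrArg (fun L : Eu k →L[ℝ] Eu k => L v) this

theorem dchart_dsymm' {c x : N} (hx : x ∈ (extChartAt (𝓡 k) c).source) (v : Eu k) :
    dchart c x (dsymm c (extChartAt (𝓡 k) c x) v) = v := by
  have := dchart_dsymm ((extChartAt (𝓡 k) c).map_source hx) v
  rwa [(extChartAt (𝓡 k) c).left_inv hx] at this

theorem dsymm_dchart' {c : N} {z : Eu k} (hz : z ∈ (extChartAt (𝓡 k) c).target) (v : Eu k) :
    dsymm c z (dchart c ((extChartAt (𝓡 k) c).symm z) v) = v := by
  have := dsymm_dchart ((extChartAt (𝓡 k) c).map_target hz) v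
  rwa [(extChartAt (𝓡 k) c).right_inv hz] at this

/-- The tangent space at `x` is identified with `ℝᵏ` by the chart around `x` itself. Definitions
that use this preferred chart can therefore be read off without any chart derivative. -/
theorem dchart_self (x : N) : dchart x x = ContinuousLinearMap.id ℝ (Eu k) :=
  mfderiv_extChartAt_self (I := 𝓡 k)

theorem rawForm_eq_chartMetric (h : FormField k N) {c x : N}
    (hx : x ∈ (extChartAt (𝓡 k) c).source) (v w : Eu k) :
    rawForm h x v w
      = chartMetric h c (extChartAt (𝓡 k) c x) (dchart c x v) (dchart c x w) := by
  rw [chartMetric_eq, (extChartAt (𝓡 k) c).left_inv hx, dsymm_dchart hx, dsymm_dchart hx]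

variable {E : Type*} [NormedAddCommGroup E] [NormedSpace ℝ E]

/-- The derivative of a map from a vector space to a manifold. -/
def dmap (Θ : E → N) (z : E) : E →L[ℝ] Eu k := mfderiv 𝓘(ℝ, E) (𝓡 k) Θ z

/-- The pullback `Θ^* h`, as a function on the vector space `E`. -/
def formAlong (h : FormField k N) (Θ : E → N) (z a b : E) : ℝ :=
  rawForm h (Θ z) (dmap Θ z a) (dmap Θ z b)

theorem contMDiffAt_chart {c x : N} (hx : x ∈ (extChartAt (𝓡 k) c).source) :
    ContMDiffAt (𝓡 k) 𝓘(ℝ, Eu k) ∞ (extChartAt (𝓡 k) c) x :=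
  contMDiffAt_extChartAt' (by rwa [extChartAt_source] at hx)

theorem mdifferentiableAt_chart {c x : N} (hx : x ∈ (extChartAt (𝓡 k) c).source) :
    MDifferentiableAt (𝓡 k) 𝓘(ℝ, Eu k) (extChartAt (𝓡 k) c) x :=
  (contMDiffAt_chart hx).mdifferentiableAt (by simp)

theorem contMDiffAt_symm {c : N} {z : Eu k} (hz : z ∈ (extChartAt (𝓡 k) c).target) :
    ContMDiffAt 𝓘(ℝ, Eu k) (𝓡 k) ∞ (extChartAt (𝓡 k) c).symm z :=
  (contMDiffOn_extChartAt_symm c).contMDiffAt ((isOpen_chart_target c).mem_nhds hz)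

theorem mdifferentiableAt_symm {c : N} {z : Eu k} (hz : z ∈ (extChartAt (𝓡 k) c).target) :
    MDifferentiableAt 𝓘(ℝ, Eu k) (𝓡 k) (extChartAt (𝓡 k) c).symm z :=
  (contMDiffAt_symm hz).mdifferentiableAt (by simp)

theorem dmap_symm (c : N) (z : Eu k) : dmap (extChartAt (𝓡 k) c).symm z = dsymm c z := rfl

theorem fderiv_chart_comp {Θ : E → N} {z : E} {c : N} (hΘ : MDifferentiableAt 𝓘(ℝ, E) (𝓡 k) Θ z)
    (hz : Θ z ∈ (extChartAt (𝓡 k) c).source) (v : E) :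
    fderiv ℝ (fun z => extChartAt (𝓡 k) c (Θ z)) z v = dchart c (Θ z) (dmap Θ z v) := by
  rw [← mfderiv_eq_fderiv]
  exact mfderiv_comp_apply z (mdifferentiableAt_chart hz) hΘ v

theorem contDiffAt_chart_comp {Θ : E → N} {z : E} {c : N} (hΘ : ContMDiffAt 𝓘(ℝ, E) (𝓡 k) ∞ Θ z)
    (hz : Θ z ∈ (extChartAt (𝓡 k) c).source) :
    ContDiffAt ℝ ∞ (fun z => extChartAt (𝓡 k) c (Θ z)) z :=
  contMDiffAt_iff_contDiffAt.1 ((contMDiffAt_chart hz).comp z hΘ)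

/-- The pullback is defined without a chart of `N`, so any chart whose domain contains `Θ z`
computes it. With `Θ` an inverse chart this gives the transformation law of the metric coefficients.
-/
theorem formAlong_eq (h : FormField k N) {Θ : E → N} {z : E} {c : N}
    (hΘ : MDifferentiableAt 𝓘(ℝ, E) (𝓡 k) Θ z) (hz : Θ z ∈ (extChartAt (𝓡 k) c).source) (a b : E) :
    formAlong h Θ z a b = chartMetric h c (extChartAt (𝓡 k) c (Θ z))
      (fderiv ℝ (fun z => extChartAt (𝓡 k) c (Θ z)) z a)
      (fderiv ℝ (fun z => extChartAt (𝓡 k) c (Θ z)) z b) := by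
  rw [fderiv_chart_comp hΘ hz, fderiv_chart_comp hΘ hz, formAlong, rawForm_eq_chartMetric h hz]

/-- The form field is a Riemannian metric in every chart. -/
def IsMetric (h : FormField k N) : Prop :=
  ∀ c, LocalMetric (chartMetric h c) (extChartAt (𝓡 k) c).target

theorem eventually_contMDiffAt {Θ : E → N} {z : E} (hΘ : ContMDiffAt 𝓘(ℝ, E) (𝓡 k) ∞ Θ z) :
    ∀ᶠ y in 𝓝 z, ContMDiffAt 𝓘(ℝ, E) (𝓡 k) 1 Θ y := by
  have : IsManifold (𝓡 k) 1 N := inferInstance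
  have h0 : ContMDiffAt 𝓘(ℝ, E) (𝓡 k) 1 Θ z := hΘ.of_le (by norm_cast)
  exact (contMDiffAt_iff_contMDiffAt_nhds (by simp)).1 h0

theorem contDiffAt_formAlong {h : FormField k N} (hh : IsMetric h) {Θ : E → N} {z : E}
    (hΘ : ContMDiffAt 𝓘(ℝ, E) (𝓡 k) ∞ Θ z) (a b : E) :
    ContDiffAt ℝ ∞ (fun z => formAlong h Θ z a b) z := by
  have hz := mem_extChartAt_source (I := 𝓡 k) (Θ z)
  set c := Θ z
  have hzt := (extChartAt (𝓡 k) c).map_source hz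
  have hev : (fun z => formAlong h Θ z a b) =ᶠ[𝓝 z] fun z =>
      mkBilin (chartMetric h c (extChartAt (𝓡 k) c (Θ z)))
      (fderiv ℝ (fun z => extChartAt (𝓡 k) c (Θ z)) z a)
      (fderiv ℝ (fun z => extChartAt (𝓡 k) c (Θ z)) z b) := by
    have h1 := eventually_contMDiffAt hΘ
    filter_upwards [h1, hΘ.continuousAt.preimage_mem_nhds (extChartAt_source_mem_nhds (I := 𝓡 k) c)]
      with y h1 h2
    rw [formAlong_eq h (h1.mdifferentiableAt (by simp)) h2,
      (hh c).mk_apply ((extChartAt (𝓡 k) c).map_source h2)]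
  refine ContDiffAt.congr_of_eventuallyEq ?_ hev
  have hc := contDiffAt_chart_comp (c := c) hΘ hz
  exact ((ContDiffAt.comp (g := fun y => mkBilin (chartMetric h c y)) z ((hh c).contDiffAt_mk hzt)
    hc).clm_apply (contDiffAt_fderiv_apply hc a)).clm_apply (contDiffAt_fderiv_apply hc b)

theorem IsMetric.isBil {h : FormField k N} (hh : IsMetric h) (x : N) : IsBil (rawForm h x) := by
  have h1 := ((hh x).bil _ ((extChartAt (𝓡 k) x).map_source (mem_extChartAt_source x))).comp
    (dchart x x).toLinearMap (LinearMap.id (R := ℝ))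
  have h2 : rawForm h x = fun v w => chartMetric h x (extChartAt (𝓡 k) x x) (dchart x x v)
      (dchart x x w) :=
    funext fun v => funext fun w => rawForm_eq_chartMetric h (mem_extChartAt_source x) v w
  rw [h2]
  exact h1

theorem IsMetric.symm {h : FormField k N} (hh : IsMetric h) (x : N) (v w : Eu k) :
    rawForm h x v w = rawForm h x w v := by
  have hx := mem_extChartAt_source (I := 𝓡 k) x
  rw [rawForm_eq_chartMetric h hx, rawForm_eq_chartMetric h hx,
    (hh x).symm _ ((extChartAt (𝓡 k) x).map_source hx)]

theorem IsMetric.pos {h : FormField k N} (hh : IsMetric h) (x : N) (v : Eu k) (hv : v ≠ 0) :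
    0 < rawForm h x v v := by
  have hx := mem_extChartAt_source (I := 𝓡 k) x
  rw [rawForm_eq_chartMetric h hx, dchart_self]
  exact (hh x).pos _ ((extChartAt (𝓡 k) x).map_source hx) v hv

/-- Positivity of a form field passes to the charts. -/
theorem isMetric_of {h : FormField k N} (hb : ∀ x, IsBil (rawForm h x))
    (hs : ∀ x v w, rawForm h x v w = rawForm h x w v)
    (hp : ∀ x v, v ≠ 0 → 0 < rawForm h x v v)
    (hd : ∀ c v w, ContDiffOn ℝ ∞ (fun z => chartMetric h c z v w) (extChartAt (𝓡 k) c).target) :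
    IsMetric h := fun c =>
  { isOpen := isOpen_chart_target c
    bil := fun z _ => (hb _).comp (dsymm c z).toLinearMap (LinearMap.id (R := ℝ))
    symm := fun z _ v w => hs _ _ _
    pos := fun z hz v hv => hp _ _ fun h0 => hv (by
      rw [← dchart_dsymm hz v, show dsymm c z v = 0 from h0, map_zero])
    smooth := hd c }

theorem isMetric_metricForm
    (G : Bundle.ContMDiffRiemannianMetric (𝓡 k) ∞ (Eu k) (fun x : N => TangentSpace (𝓡 k) x)) :
    IsMetric (metricForm G) := by
  refine isMetric_of (fun x => ?_) (fun x v w => G.symm x v w) (fun x v hv => G.pos x v hv) ?_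
  · exact ⟨fun w => ⟨fun a b => congrArg (fun L => L w) ((G.inner x).map_add a b),
      fun a b => congrArg (fun L => L w) ((G.inner x).map_smul a b)⟩,
      fun v => ⟨(G.inner x v).map_add, (G.inner x v).map_smul⟩⟩
  · intro c v w z hz
    refine ContDiffAt.contDiffWithinAt ?_
    rw [← contMDiffAt_iff_contDiffAt]
    -- The coordinate vector fields are smooth sections along the inverse chart. Evaluating the
    -- smooth bundle section `G.inner` on two of them gives a metric coefficient.
    have hs : ∀ v : Eu k, ContMDiffAt 𝓘(ℝ, Eu k) ((𝓡 k).prod 𝓘(ℝ, Eu k)) ∞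
        (fun z => Bundle.TotalSpace.mk' (Eu k) (E := fun x : N => TangentSpace (𝓡 k) x)
          ((extChartAt (𝓡 k) c).symm z) (dsymm c z v)) z := fun v => by
      have h1 := (contMDiffOn_extChartAt_symm (I := 𝓡 k) (n := ∞) c).contMDiffOn_tangentMapWithin
        (m := ∞) (by simp) (isOpen_chart_target c).uniqueMDiffOn
      have h2 : ContMDiffAt 𝓘(ℝ, Eu k) 𝓘(ℝ, Eu k).tangent ∞
          (fun z : Eu k => (⟨z, v⟩ : TangentBundle 𝓘(ℝ, Eu k) (Eu k))) z :=
        contMDiffAt_vectorSpace_iff_contDiffAt.2 contDiffAt_const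
      have h3 := (h1.contMDiffAt (x := (⟨z, v⟩ : TangentBundle 𝓘(ℝ, Eu k) (Eu k)))
        (((isOpen_chart_target c).preimage (FiberBundle.continuous_proj _ _)).mem_nhds hz)).comp z h2
      refine h3.congr_of_eventuallyEq ?_
      filter_upwards [(isOpen_chart_target c).mem_nhds hz] with y hy
      have := mfderivWithin_of_isOpen (I := 𝓘(ℝ, Eu k)) (I' := 𝓡 k)
        (f := (extChartAt (𝓡 k) c).symm) (isOpen_chart_target c) hy
      simp only [Function.comp, tangentMapWithin, this]
      rfl
    have : ContMDiffAt 𝓘(ℝ, Eu k) ((𝓡 k).prod 𝓘(ℝ)) ∞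
        (fun z => Bundle.TotalSpace.mk' ℝ (E := Bundle.Trivial N ℝ) ((extChartAt (𝓡 k) c).symm z)
          (G.inner ((extChartAt (𝓡 k) c).symm z) (dsymm c z v) (dsymm c z w))) z := by
      apply ContMDiffAt.clm_bundle_apply₂ (F₁ := Eu k) (F₂ := Eu k)
      · exact G.contMDiff.contMDiffAt.comp z (contMDiffAt_symm hz)
      · exact hs v
      · exact hs w
    simp only [Bundle.contMDiffAt_totalSpace] at this
    exact this.2

end Charts

/-- The map `u` read in the chart of `S` around `c`. -/
def inChart {n : ℕ} {S : Type*} [TopologicalSpace S] [ChartedSpace (Eu n) S] {M : Type*}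
    (c : S) (u : S → M) (z : Eu n) : M := u ((extChartAt (𝓡 n) c).symm z)

/-! ### Maps between manifolds, and chart independence of the covariant derivative. -/

section Maps

variable {n m : ℕ} {S : Type*} [TopologicalSpace S] [ChartedSpace (Eu n) S]
  {M : Type*} [TopologicalSpace M] [ChartedSpace (Eu m) M]

/-- The derivative of a map between manifolds. -/
def tmap (u : S → M) (q : S) : Eu n →L[ℝ] Eu m := mfderiv (𝓡 n) (𝓡 m) u q

/-- The map `u` read in the charts around `c` and `d`. -/
def inCharts (c : S) (d : M) (u : S → M) (z : Eu n) : Eu m :=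
  extChartAt (𝓡 m) d (inChart c u z)

/-- The vector field `W` along `u` read in the charts around `c` and `d`. -/
def fieldInCharts (c : S) (d : M) (u : S → M) (W : S → Eu m) (z : Eu n) : Eu m :=
  dchart d (inChart c u z) (W ((extChartAt (𝓡 n) c).symm z))

/-- The Christoffel symbols of `g` in the chart around `d`. -/
def chr (g : FormField m M) (d : M) (y : Eu m) : Eu m →L[ℝ] Eu m →L[ℝ] Eu m :=
  mkBilin (localChristoffel (chartMetric g d) y)

/-- The derivative of a vector-valued function on a manifold. -/
def dfun (F : S → Eu m) (q : S) : Eu n →L[ℝ] Eu m := mfderiv (𝓡 n) 𝓘(ℝ, Eu m) F q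

theorem rawForm_pullback (g : FormField m M) (u : S → M) (q : S) (v w : Eu n) :
    rawForm (pullbackForm n g u) q v w = rawForm g (u q) (tmap u q v) (tmap u q w) := rfl

variable [IsManifold (𝓡 n) ∞ S] [IsManifold (𝓡 m) ∞ M]

theorem dmap_inChart {c : S} {u : S → M} {z : Eu n} (hz : z ∈ (extChartAt (𝓡 n) c).target)
    (hu : MDifferentiableAt (𝓡 n) (𝓡 m) u ((extChartAt (𝓡 n) c).symm z)) (v : Eu n) :
    dmap (k := m) (inChart c u) z v = tmap u ((extChartAt (𝓡 n) c).symm z) (dsymm c z v) :=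
  mfderiv_comp_apply z hu (mdifferentiableAt_symm hz) v

theorem contMDiffAt_inChart {c : S} {u : S → M} {z : Eu n}
    (hz : z ∈ (extChartAt (𝓡 n) c).target)
    (hu : ContMDiffAt (𝓡 n) (𝓡 m) ∞ u ((extChartAt (𝓡 n) c).symm z)) :
    ContMDiffAt 𝓘(ℝ, Eu n) (𝓡 m) ∞ (inChart c u) z :=
  hu.comp z (contMDiffAt_symm hz)

theorem chartMetric_pullback (g : FormField m M) {c : S} {u : S → M} {z : Eu n}
    (hz : z ∈ (extChartAt (𝓡 n) c).target)
    (hu : MDifferentiableAt (𝓡 n) (𝓡 m) u ((extChartAt (𝓡 n) c).symm z)) (v w : Eu n) :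
    chartMetric (pullbackForm n g u) c z v w = formAlong g (inChart c u) z v w := by
  rw [chartMetric_eq, rawForm_pullback, formAlong, dmap_inChart hz hu, dmap_inChart hz hu]
  rfl

theorem contDiffAt_chartMetric_pullback {g : FormField m M} (hg : IsMetric g) {u : S → M}
    (hu : ContMDiff (𝓡 n) (𝓡 m) ∞ u) {c : S} {z : Eu n}
    (hz : z ∈ (extChartAt (𝓡 n) c).target) (v w : Eu n) :
    ContDiffAt ℝ ∞ (fun z => chartMetric (pullbackForm n g u) c z v w) z := by
  refine (contDiffAt_formAlong hg (contMDiffAt_inChart hz hu.contMDiffAt) v w).congr_of_eventuallyEq ?_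
  filter_upwards [(isOpen_chart_target c).mem_nhds hz] with y hy
  exact chartMetric_pullback g hy (hu.mdifferentiableAt (by simp)) v w

theorem isBil_pullback {g : FormField m M} (hg : IsMetric g) (u : S → M) (q : S) :
    IsBil (rawForm (pullbackForm n g u) q) :=
  (hg.isBil (u q)).comp (tmap u q).toLinearMap (LinearMap.id (R := ℝ))

theorem isMetric_pullback {g : FormField m M} (hg : IsMetric g) {u : S → M}
    (hu : IsSmoothImmersion n m u) : IsMetric (pullbackForm n g u) := by
  refine isMetric_of (isBil_pullback hg u) (fun x v w => hg.symm _ _ _) (fun x v hv => ?_)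
    fun c v w z hz => (contDiffAt_chartMetric_pullback hg hu.1 hz v w).contDiffWithinAt
  refine hg.pos _ _ fun h0 => hv (hu.2 x ?_)
  exact h0.trans (map_zero (tmap u x)).symm

theorem tangentTrace_eq {V : Type*} [AddCommGroup V] [Module ℝ V] {h : FormField n S}
    (hh : IsMetric h) {c p : S} (hp : p ∈ (extChartAt (𝓡 n) c).source) {e : Fin n → Eu n}
    (he : IsON (chartMetric h c (extChartAt (𝓡 n) c p)) e) {Q : Eu n → Eu n → V} (hQ : IsBil Q) :
    tangentTrace h p Q = ∑ i, Q (dsymm c (extChartAt (𝓡 n) c p) (e i))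
      (dsymm c (extChartAt (𝓡 n) c p) (e i)) := by
  refine metricTrace_eq_sum (b := rawForm h p) (hh.isBil p) (fun i j => ?_) hQ
  rw [← he i j, chartMetric_eq, (extChartAt (𝓡 n) c).left_inv hp]

/-- Differentiating `dτ(V)` produces a second derivative of `τ`. The hypothesis `ht`, that is `∇dτ =
dτ ∘ Γ`, is exactly what converts it into the difference of the Christoffel terms. -/
theorem covAlong_transform {E F : Type*} [NormedAddCommGroup E] [NormedSpace ℝ E]
    [NormedAddCommGroup F] [NormedSpace ℝ F] {Γ Γ' : F → F →L[ℝ] F →L[ℝ] F} {τ : F → F}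
    {U V : E → F} {z : E} (hτ : ContDiffAt ℝ 2 τ (U z)) (hU : DifferentiableAt ℝ U z)
    (hV : DifferentiableAt ℝ V z)
    (ht : ∀ v w, covAlong Γ' τ (fun y => fderiv ℝ τ y w) (U z) v
      = fderiv ℝ τ (U z) (Γ (U z) v w)) (a : E) :
    covAlong Γ' (fun z => τ (U z)) (fun z => fderiv ℝ τ (U z) (V z)) z a
      = fderiv ℝ τ (U z) (covAlong Γ U V z a) := by
  have hτ' : DifferentiableAt ℝ (fderiv ℝ τ) (U z) :=
    (hτ.fderiv_right (m := 1) (by norm_num)).differentiableAt (by norm_num)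
  have h1 := ((HasFDerivAt.comp (g := fderiv ℝ τ) z hτ'.hasFDerivAt hU.hasFDerivAt).clm_apply
    hV.hasFDerivAt).fderiv
  have h2 := (HasFDerivAt.comp (g := τ) z (hτ.differentiableAt (by norm_num)).hasFDerivAt
    hU.hasFDerivAt).fderiv
  simp only [Function.comp_def] at h1 h2
  have h3 := ht (fderiv ℝ U z a) (V z)
  rw [covAlong, fderiv_clm_apply hτ' (differentiableAt_const _)] at h3
  rw [covAlong, h1, h2, covAlong, map_add, ← h3]
  simp
  abel

theorem covDeriv_eq (g : FormField m M) (u : S → M) (W : S → Eu m) (p : S) (X : Eu n) :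
    (covDeriv n g u W p X : Eu m)
      = dfun (fun q => dchart (u p) (u q) (W q)) p X
        + localChristoffel (chartMetric g (u p)) (extChartAt (𝓡 m) (u p) (u p)) (tmap u p X)
          (W p) := by
  have h1 := dchart_self (k := m) (u p)
  have h2 : (covDeriv n g u W p X : Eu m) = (dchart (u p) (u p)).inverse
      (dfun (fun q => dchart (u p) (u q) (W q)) p X
        + localChristoffel (chartMetric g (u p)) (extChartAt (𝓡 m) (u p) (u p))
          (dchart (u p) (u p) (tmap u p X)) (dchart (u p) (u p) (W p))) := rfl
  rw [h2, h1, ContinuousLinearMap.inverse_id]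
  rfl

/-- The Christoffel symbols in two charts: `∇ dτ = dτ ∘ Γ` for the transition map `τ`. -/
theorem christoffel_transform {m : ℕ} {M : Type*} [TopologicalSpace M] [ChartedSpace (Eu m) M]
    [IsManifold (𝓡 m) ∞ M] {g : FormField m M} (hg : IsMetric g) {d d' : M} {y : Eu m}
    (hy : y ∈ (extChartAt (𝓡 m) d).target)
    (hy' : (extChartAt (𝓡 m) d).symm y ∈ (extChartAt (𝓡 m) d').source) (v w : Eu m) :
    covAlong (chr g d') (fun z => extChartAt (𝓡 m) d' ((extChartAt (𝓡 m) d).symm z))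
      (fun z => fderiv ℝ (fun z => extChartAt (𝓡 m) d' ((extChartAt (𝓡 m) d).symm z)) z w) y v
      = fderiv ℝ (fun z => extChartAt (𝓡 m) d' ((extChartAt (𝓡 m) d).symm z)) y (chr g d y v w) := by
  have hs := contMDiffAt_symm hy
  have hτ := contDiffAt_chart_comp (c := d') hs hy'
  have ht' := (extChartAt (𝓡 m) d').map_source hy'
  have hpull : ∀ᶠ z in 𝓝 y, ∀ v w, chartMetric g d z v w
      = chartMetric g d' (extChartAt (𝓡 m) d' ((extChartAt (𝓡 m) d).symm z))
        (fderiv ℝ (fun z => extChartAt (𝓡 m) d' ((extChartAt (𝓡 m) d).symm z)) z v)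
        (fderiv ℝ (fun z => extChartAt (𝓡 m) d' ((extChartAt (𝓡 m) d).symm z)) z w) := by
    filter_upwards [(isOpen_chart_target d).mem_nhds hy,
      hs.continuousAt.preimage_mem_nhds ((isOpen_extChartAt_source d').mem_nhds hy')] with z h1 h2 v w
    exact formAlong_eq g (mdifferentiableAt_symm h1) h2 v w
  refine (hg d').eq_of_forall ht' fun a => ?_
  -- The derivative of the transition map is onto, so it is enough to test against its values. Since
  -- the transition map is isometric for the two chart metrics, the Gauss formula evaluates these
  -- pairings.
  have hsurj : fderiv ℝ (fun z => extChartAt (𝓡 m) d' ((extChartAt (𝓡 m) d).symm z)) y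
      (dchart d ((extChartAt (𝓡 m) d).symm y) (dsymm d'
        (extChartAt (𝓡 m) d' ((extChartAt (𝓡 m) d).symm y)) a)) = a := by
    rw [fderiv_chart_comp (mdifferentiableAt_symm hy) hy', dmap_symm, dsymm_dchart' hy,
      dchart_dsymm' hy']
  rw [← hsurj]
  have := gauss_formula (hg d') (hg d) hy ht' (hτ.of_le (by norm_cast)) hpull v w
    (dchart d ((extChartAt (𝓡 m) d).symm y) (dsymm d'
        (extChartAt (𝓡 m) d' ((extChartAt (𝓡 m) d).symm y)) a))
  refine this.trans ?_
  rw [hpull.self_of_nhds, chr, (hg d).mkChristoffel_apply hy]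

/-- The Levi-Civita derivative along a map, computed in arbitrary charts. -/
theorem covDeriv_inCharts {g : FormField m M} (hg : IsMetric g) {u : S → M} {W : S → Eu m}
    {p c : S} {d : M} (hp : p ∈ (extChartAt (𝓡 n) c).source)
    (hd : u p ∈ (extChartAt (𝓡 m) d).source) (hu : ContMDiffAt (𝓡 n) (𝓡 m) ∞ u p)
    (hW : DifferentiableAt ℝ (fieldInCharts c d u W) (extChartAt (𝓡 n) c p)) (X : Eu n) :
    dchart d (u p) (covDeriv n g u W p X) = covAlong (chr g d) (inCharts c d u)
      (fieldInCharts c d u W) (extChartAt (𝓡 n) c p) (dchart c p X) := by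
  set z := extChartAt (𝓡 n) c p with hz
  have hzt : z ∈ (extChartAt (𝓡 n) c).target := (extChartAt (𝓡 n) c).map_source hp
  have hzp : (extChartAt (𝓡 n) c).symm z = p := (extChartAt (𝓡 n) c).left_inv hp
  set d' := u p with hd'
  have hdd : d' ∈ (extChartAt (𝓡 m) d').source := mem_extChartAt_source d'
  -- The definition of `covDeriv` uses the chart around `u p`. The transition map `τ` relates it to
  -- the chart around `d`.
  set τ : Eu m → Eu m := fun y => extChartAt (𝓡 m) d' ((extChartAt (𝓡 m) d).symm y) with hτd
  have hΘ : ContMDiffAt 𝓘(ℝ, Eu n) (𝓡 m) ∞ (inChart c u) z :=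
    contMDiffAt_inChart hzt (by rw [hzp]; exact hu)
  have hΘz : inChart c u z = d' := congrArg u hzp
  have hUz : inCharts c d u z = extChartAt (𝓡 m) d d' := congrArg _ hΘz
  have hyt : extChartAt (𝓡 m) d d' ∈ (extChartAt (𝓡 m) d).target :=
    (extChartAt (𝓡 m) d).map_source hd
  have hyd : (extChartAt (𝓡 m) d).symm (extChartAt (𝓡 m) d d') = d' :=
    (extChartAt (𝓡 m) d).left_inv hd
  have hτ : ContDiffAt ℝ ∞ τ (extChartAt (𝓡 m) d d') :=
    contDiffAt_chart_comp (contMDiffAt_symm hyt) (by rw [hyd]; exact hdd)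
  have hev : ∀ᶠ y in 𝓝 z, inChart c u y ∈ (extChartAt (𝓡 m) d).source ∧
      inChart c u y ∈ (extChartAt (𝓡 m) d').source := by
    have h0 : Filter.Tendsto (inChart c u) (𝓝 z) (𝓝 d') := hΘz ▸ hΘ.continuousAt.tendsto
    exact h0 (Filter.inter_mem ((isOpen_extChartAt_source (I := 𝓡 m) d).mem_nhds hd)
      ((isOpen_extChartAt_source (I := 𝓡 m) d').mem_nhds hdd))
  have hU : inCharts c d' u =ᶠ[𝓝 z] fun y => τ (inCharts c d u y) := by
    filter_upwards [hev] with y hy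
    simp only [hτd, inCharts, (extChartAt (𝓡 m) d).left_inv hy.1]
  have hF : fieldInCharts c d' u W =ᶠ[𝓝 z]
      fun y => fderiv ℝ τ (inCharts c d u y) (fieldInCharts c d u W y) := by
    filter_upwards [hev] with y hy
    have h1 := (extChartAt (𝓡 m) d).map_source hy.1
    have h2 := (extChartAt (𝓡 m) d).left_inv hy.1
    have h3 := fderiv_chart_comp (c := d') (mdifferentiableAt_symm h1) (by rw [h2]; exact hy.2)
      (fieldInCharts c d u W y)
    rw [dmap_symm, h2, fieldInCharts, dsymm_dchart hy.1] at h3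
    exact h3.symm
  have hτz : ∀ v, fderiv ℝ τ (extChartAt (𝓡 m) d d') v = dsymm d (extChartAt (𝓡 m) d d') v := by
    intro v
    have h3 := fderiv_chart_comp (c := d') (mdifferentiableAt_symm hyt) (by rw [hyd]; exact hdd) v
    rwa [dmap_symm, hyd, dchart_self] at h3
  have hUd : DifferentiableAt ℝ (inCharts c d u) z :=
    (contDiffAt_chart_comp hΘ (by rw [hΘz]; exact hd)).differentiableAt (by simp)
  have hcov : covAlong (chr g d') (inCharts c d' u) (fieldInCharts c d' u W) z (dchart c p X)
      = dsymm d (extChartAt (𝓡 m) d d') (covAlong (chr g d) (inCharts c d u)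
        (fieldInCharts c d u W) z (dchart c p X)) := by
    rw [← hτz, ← hUz, ← covAlong_transform (Γ := chr g d) (Γ' := chr g d') (τ := τ) (V := fieldInCharts c d u W)
      (by rw [hUz]; exact hτ.of_le (by norm_cast))
      hUd hW
      (fun v w => by
        rw [hUz]; exact christoffel_transform hg hyt (by rw [hyd]; exact hdd) v w)]
    rw [covAlong, covAlong, hU.fderiv_eq, hF.fderiv_eq, hU.eq_of_nhds, hF.eq_of_nhds]
  have hFz : dfun (fun q => dchart d' (u q) (W q)) p X
      = fderiv ℝ (fieldInCharts c d' u W) z (dchart c p X) := by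
    have hdF : DifferentiableAt ℝ (fieldInCharts c d' u W) z := by
      refine DifferentiableAt.congr_of_eventuallyEq ?_ hF
      have h1 : DifferentiableAt ℝ (fderiv ℝ τ) (inCharts c d u z) := by
        rw [hUz]
        exact (hτ.fderiv_right (m := 1) (by norm_cast)).differentiableAt (by norm_num)
      exact (DifferentiableAt.comp (g := fderiv ℝ τ) z h1 hUd).clm_apply hW
    have h1 : (fun q => dchart d' (u q) (W q)) =ᶠ[𝓝 p]
        fun q => fieldInCharts c d' u W (extChartAt (𝓡 n) c q) := by
      filter_upwards [(isOpen_extChartAt_source c).mem_nhds hp] with q hq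
      simp only [fieldInCharts, inChart, (extChartAt (𝓡 n) c).left_inv hq]
    rw [dfun, h1.mfderiv_eq, ← mfderiv_eq_fderiv]
    exact mfderiv_comp_apply p (g := fieldInCharts c d' u W) (hdF.mdifferentiableAt)
      (mdifferentiableAt_chart hp) X
  have hXz : fderiv ℝ (inCharts (m := m) c d' u) z (dchart c p X) = tmap u p X := by
    have h3 := fderiv_chart_comp (c := d') (hΘ.mdifferentiableAt (by simp)) (by rw [hΘz]; exact hdd)
      (dchart c p X)
    rw [dmap_inChart hzt (by rw [hzp]; exact hu.mdifferentiableAt (by simp)), hzp,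
      dsymm_dchart hp, hΘz, dchart_self] at h3
    exact h3
  have hWz : fieldInCharts c d' u W z = W p := by
    rw [fieldInCharts, hΘz, dchart_self, hzp]
    rfl
  rw [covDeriv_eq, hFz]
  have h5 : covAlong (chr g d') (inCharts c d' u) (fieldInCharts c d' u W) z (dchart c p X)
      = fderiv ℝ (fieldInCharts c d' u W) z (dchart c p X)
        + localChristoffel (chartMetric g d') (extChartAt (𝓡 m) d' d') (tmap u p X) (W p) := by
    rw [covAlong, hXz, hWz, show inCharts c d' u z = extChartAt (𝓡 m) d' d' from congrArg _ hΘz, chr,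
      (hg d').mkChristoffel_apply ((extChartAt (𝓡 m) d').map_source hdd)]
  rw [← h5, hcov, dchart_dsymm' hd]

end Maps

/-! ### Tangential and normal projections. -/

section Projection

variable {n : ℕ} {F : Type*} [NormedAddCommGroup F] [NormedSpace ℝ F]

/-- The component of `V` tangent to the range of `A`, with respect to the form `B`. -/
def tanPart (B : F →L[ℝ] F →L[ℝ] ℝ) (A : Eu n →L[ℝ] F) (V : F) : Eu n :=
  metricTrace (fun v w => B (A v) (A w)) fun a b => B V (A a) • b

/-- The component of `V` normal to the range of `A`, with respect to the form `B`. -/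
def norPart (B : F →L[ℝ] F →L[ℝ] ℝ) (A : Eu n →L[ℝ] F) (V : F) : F := V - A (tanPart B A V)

variable {B : F →L[ℝ] F →L[ℝ] ℝ} {A : Eu n →L[ℝ] F}

theorem isBil_pull (B : F →L[ℝ] F →L[ℝ] ℝ) (A : Eu n →L[ℝ] F) :
    IsBil fun v w => B (A v) (A w) :=
  (isBil_clm B).comp A.toLinearMap (LinearMap.id (R := ℝ))

theorem isBil_smul_right {V : Type*} [AddCommGroup V] [Module ℝ V] {E : Type*} [AddCommGroup E]
    [Module ℝ E] (α : E →ₗ[ℝ] ℝ) (L : E →ₗ[ℝ] V) : IsBil fun a b : E => α a • L b :=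
  ⟨fun w => ⟨fun a b => by simp [add_smul], fun a b => by simp [mul_smul]⟩,
    fun v => ⟨fun a b => by simp, fun a b => by rw [map_smul, smul_comm]⟩⟩

variable {e : Fin n → Eu n}

theorem tanPart_eq (he : IsON (fun v w => B (A v) (A w)) e) (V : F) :
    tanPart B A V = ∑ i, B V (A (e i)) • e i :=
  metricTrace_eq_sum (isBil_pull B A) he
    (isBil_smul_right ((B V).comp A).toLinearMap LinearMap.id)

theorem norPart_eq (he : IsON (fun v w => B (A v) (A w)) e) (V : F) :
    norPart B A V = V - ∑ i, B V (A (e i)) • A (e i) := by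
  rw [norPart, tanPart_eq he]
  simp

theorem tanPart_add (V W : F) (he : IsON (fun v w => B (A v) (A w)) e) :
    tanPart B A (V + W) = tanPart B A V + tanPart B A W := by
  simp only [tanPart_eq he, map_add, add_apply, add_smul, Finset.sum_add_distrib]

theorem tanPart_smul (he : IsON (fun v w => B (A v) (A w)) e) (a : ℝ) (V : F) :
    tanPart B A (a • V) = a • tanPart B A V := by
  simp only [tanPart_eq he, map_smul, smul_apply, smul_assoc, Finset.smul_sum]

theorem norPart_add (he : IsON (fun v w => B (A v) (A w)) e) (V W : F) :
    norPart B A (V + W) = norPart B A V + norPart B A W := by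
  rw [norPart, tanPart_add _ _ he, map_add, norPart, norPart]
  abel

theorem norPart_smul (he : IsON (fun v w => B (A v) (A w)) e) (a : ℝ) (V : F) :
    norPart B A (a • V) = a • norPart B A V := by
  rw [norPart, tanPart_smul he, map_smul, norPart, smul_sub]

theorem tanPart_map (he : IsON (fun v w => B (A v) (A w)) e)
    (hs : ∀ v w, B v w = B w v) (v : Eu n) : tanPart B A (A v) = v := by
  rw [tanPart_eq he]
  conv_rhs => rw [he.expand (isBil_pull B A) v]
  exact Finset.sum_congr rfl fun i _ => by rw [hs]

theorem norPart_map (he : IsON (fun v w => B (A v) (A w)) e)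
    (hs : ∀ v w, B v w = B w v) (v : Eu n) : norPart B A (A v) = 0 := by
  rw [norPart, tanPart_map he hs, sub_self]

theorem norPart_normal (he : IsON (fun v w => B (A v) (A w)) e) (V : F) (w : Eu n) :
    B (norPart B A V) (A w) = 0 := by
  rw [norPart, map_sub, sub_apply, sub_eq_zero]
  exact (riesz_of_isON (isBil_pull B A) he ((B V).comp A).toLinearMap.isLinear w).symm

theorem norPart_of_normal (he : IsON (fun v w => B (A v) (A w)) e) {V : F}
    (hV : ∀ w, B V (A w) = 0) : norPart B A V = V := by
  simp [norPart_eq he, hV]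

theorem norPart_inner (hs : ∀ v w, B v w = B w v) (V : F)
    {T : F} (hT : ∀ w, B T (A w) = 0) : B (norPart B A V) T = B V T := by
  rw [norPart, map_sub, sub_apply, hs (A _), hT, sub_zero]

/-- The normal projection as a linear map. -/
def norMap (he : IsON (fun v w => B (A v) (A w)) e) : F →ₗ[ℝ] F where
  toFun := norPart B A
  map_add' := norPart_add he
  map_smul' := norPart_smul he

theorem contDiffAt_tanPart {X : Type*} [NormedAddCommGroup X] [NormedSpace ℝ X] {x : X}
    {B : X → F →L[ℝ] F →L[ℝ] ℝ} {A : X → Eu n →L[ℝ] F} {V : X → F} {r : WithTop ℕ∞}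
    (hB : ContDiffAt ℝ r B x) (hA : ContDiffAt ℝ r A x) (hV : ContDiffAt ℝ r V x)
    {e : Fin n → Eu n} (he : IsON (fun v w => B x (A x v) (A x w)) e) :
    ContDiffAt ℝ r (fun x => tanPart (B x) (A x) (V x)) x := by
  refine contDiffAt_metricTrace (fun i j => ?_) (det_gram_pos_of_isON (isBil_pull _ _) he).ne'
    fun i j => ?_
  · exact (hB.clm_apply (hA.clm_apply contDiffAt_const)).clm_apply (hA.clm_apply contDiffAt_const)
  · exact ((hB.clm_apply hV).clm_apply (hA.clm_apply contDiffAt_const)).smul contDiffAt_const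

theorem contDiffAt_norPart {X : Type*} [NormedAddCommGroup X] [NormedSpace ℝ X] {x : X}
    {B : X → F →L[ℝ] F →L[ℝ] ℝ} {A : X → Eu n →L[ℝ] F} {V : X → F} {r : WithTop ℕ∞}
    (hB : ContDiffAt ℝ r B x) (hA : ContDiffAt ℝ r A x) (hV : ContDiffAt ℝ r V x)
    {e : Fin n → Eu n} (he : IsON (fun v w => B x (A x v) (A x w)) e) :
    ContDiffAt ℝ r (fun x => norPart (B x) (A x) (V x)) x :=
  hV.sub (hA.clm_apply (contDiffAt_tanPart hB hA hV he))

end Projection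

/-! ### Smoothness of vector fields along a map, read in charts. -/

section Fields

variable {n m : ℕ} {S : Type*} [TopologicalSpace S] [ChartedSpace (Eu n) S]
  {M : Type*} [TopologicalSpace M] [ChartedSpace (Eu m) M]
  [IsManifold (𝓡 n) ∞ S] [IsManifold (𝓡 m) ∞ M]

/-- The coordinate expression is the fibre component of the tangent map of the chart applied to the
field. The condition `r + 1 ≤ ∞` pays for the derivative taken by the tangent map. -/
theorem contDiffAt_fieldInCharts {u : S → M} {W : ∀ q, TangentSpace (𝓡 m) (u q)} {p c : S} {d : M}
    {r : WithTop ℕ∞} (hr : r + 1 ≤ ∞) (hr1 : r ≤ ∞)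
    (hp : p ∈ (extChartAt (𝓡 n) c).source) (hd : u p ∈ (extChartAt (𝓡 m) d).source)
    (hW : ContMDiffAt (𝓡 n) (𝓡 m).tangent r (fun q => (⟨u q, W q⟩ : TangentBundle (𝓡 m) M)) p) :
    ContDiffAt ℝ r (fieldInCharts c d u W) (extChartAt (𝓡 n) c p) := by
  have : IsManifold (𝓡 m) 1 M := inferInstance
  have hO : IsOpen (extChartAt (𝓡 m) d).source := isOpen_extChartAt_source d
  have hsrc : (chartAt (Eu m) d).source = (extChartAt (𝓡 m) d).source := by simp
  have h1 := (contMDiffOn_extChartAt (I := 𝓡 m) (n := ∞) (x := d)).contMDiffOn_tangentMapWithin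
    (m := r) hr (by rw [hsrc]; exact hO.uniqueMDiffOn)
  rw [hsrc] at h1
  have h2 := h1.contMDiffAt (x := (⟨u p, W p⟩ : TangentBundle (𝓡 m) M))
    ((hO.preimage (FiberBundle.continuous_proj _ _)).mem_nhds hd)
  have hzp : (extChartAt (𝓡 n) c).symm (extChartAt (𝓡 n) c p) = p := (extChartAt (𝓡 n) c).left_inv hp
  have hs := (contMDiffAt_symm ((extChartAt (𝓡 n) c).map_source hp)).of_le (m := r) hr1
  have h3 := (ContMDiffAt.comp (g := fun q => (⟨u q, W q⟩ : TangentBundle (𝓡 m) M))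
    (extChartAt (𝓡 n) c p) (by rw [hzp]; exact hW) hs)
  have h4 := ContMDiffAt.comp (extChartAt (𝓡 n) c p)
    (g := tangentMapWithin (𝓡 m) 𝓘(ℝ, Eu m) (extChartAt (𝓡 m) d) (extChartAt (𝓡 m) d).source)
    (by simp only [Function.comp_apply]; rw [hzp]; exact h2) h3
  have h5 := ((contMDiff_snd_tangentBundle_modelSpace (n := r) (Eu m) 𝓘(ℝ, Eu m)).contMDiffAt).comp
    (extChartAt (𝓡 n) c p) h4
  refine (contMDiffAt_iff_contDiffAt.1 h5).congr_of_eventuallyEq ?_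
  have h6 : Filter.Tendsto (fun z => u ((extChartAt (𝓡 n) c).symm z)) (𝓝 (extChartAt (𝓡 n) c p))
      (𝓝 (u p)) := by
    have h7 : ContinuousAt u p := by
      have := (FiberBundle.continuous_proj (Eu m) (TangentSpace (𝓡 m) : M → Type _)).continuousAt.comp
        hW.continuousAt
      exact this
    have h8 := ContinuousAt.comp (g := u) (by rw [hzp]; exact h7) hs.continuousAt
    have h9 : (u ∘ (extChartAt (𝓡 n) c).symm) (extChartAt (𝓡 n) c p) = u p := congrArg u hzp
    exact h9 ▸ h8.tendsto
  filter_upwards [h6 (hO.mem_nhds hd)] with z hz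
  have := mfderivWithin_of_isOpen (I := 𝓡 m) (I' := 𝓘(ℝ, Eu m))
        (f := extChartAt (𝓡 m) d) hO hz
  simp only [Function.comp, tangentMapWithin, this]
  rfl

end Fields

/-! ### Normal parts, normal derivatives and traces in charts. -/

section Frames

variable {n m : ℕ} {S : Type*} [TopologicalSpace S] [ChartedSpace (Eu n) S]
  {M : Type*} [TopologicalSpace M] [ChartedSpace (Eu m) M]

/-- The metric in the chart around `d`. -/
def met (g : FormField m M) (d : M) (y : Eu m) : Eu m →L[ℝ] Eu m →L[ℝ] ℝ :=
  mkBilin (chartMetric g d y)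

/-- The normal derivative of the field `W` along `u`, in charts. -/
def normalCov (g : FormField m M) (c : S) (d : M) (u : S → M) (W : S → Eu m) (z v : Eu n) : Eu m :=
  norPart (met g d (inCharts c d u z)) (fderiv ℝ (inCharts (m := m) c d u) z)
    (covAlong (chr g d) (inCharts c d u) (fieldInCharts c d u W) z v)

variable [IsManifold (𝓡 n) ∞ S] [IsManifold (𝓡 m) ∞ M]

theorem eventually_charts {c p : S} {d : M} {u : S → M} (hu : ContinuousAt u p)
    (hp : p ∈ (extChartAt (𝓡 n) c).source) (hd : u p ∈ (extChartAt (𝓡 m) d).source) :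
    ∀ᶠ q in 𝓝 p, q ∈ (extChartAt (𝓡 n) c).source ∧ u q ∈ (extChartAt (𝓡 m) d).source :=
  Filter.inter_mem ((isOpen_extChartAt_source (I := 𝓡 n) c).mem_nhds hp)
    (hu ((isOpen_extChartAt_source (I := 𝓡 m) d).mem_nhds hd))

/-- Properties that hold at all nearby points, read in a chart. -/
theorem eventually_chart {c p : S} (hp : p ∈ (extChartAt (𝓡 n) c).source) {P : S → Prop}
    (hP : ∀ᶠ q in 𝓝 p, P q) : ∀ᶠ z in 𝓝 (extChartAt (𝓡 n) c p),
      (z ∈ (extChartAt (𝓡 n) c).target) ∧ P ((extChartAt (𝓡 n) c).symm z) := by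
  have ht := (extChartAt (𝓡 n) c).map_source hp
  have hs := (contMDiffAt_symm ht).continuousAt.tendsto
  rw [(extChartAt (𝓡 n) c).left_inv hp] at hs
  exact Filter.inter_mem ((isOpen_chart_target c).mem_nhds ht) (hs hP)

variable {g : FormField m M} (hg : IsMetric g) {u : S → M} {p c : S} {d : M}
  (hp : p ∈ (extChartAt (𝓡 n) c).source) (hd : u p ∈ (extChartAt (𝓡 m) d).source)

include hg hd in
theorem rawForm_eq_met (V W : Eu m) : rawForm g (u p) V W
    = met g d (extChartAt (𝓡 m) d (u p)) (dchart d (u p) V) (dchart d (u p) W) := by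
  rw [rawForm_eq_chartMetric g hd, met, (hg d).mk_apply ((extChartAt (𝓡 m) d).map_source hd)]

include hg hd in
theorem met_symm (V W : Eu m) : met g d (extChartAt (𝓡 m) d (u p)) V W
    = met g d (extChartAt (𝓡 m) d (u p)) W V := by
  have ht := (extChartAt (𝓡 m) d).map_source hd
  rw [met, (hg d).mk_apply ht, (hg d).mk_apply ht, (hg d).symm _ ht]

include hp in
theorem inCharts_self : inCharts c d u (extChartAt (𝓡 n) c p) = extChartAt (𝓡 m) d (u p) := by
  rw [inCharts, inChart, (extChartAt (𝓡 n) c).left_inv hp]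

include hp in
theorem fieldInCharts_self (W : S → Eu m) :
    fieldInCharts c d u W (extChartAt (𝓡 n) c p) = dchart d (u p) (W p) := by
  rw [fieldInCharts, inChart, (extChartAt (𝓡 n) c).left_inv hp]

variable (hu : ContMDiff (𝓡 n) (𝓡 m) ∞ u)

include hu hp hd in
theorem contDiffAt_inCharts : ContDiffAt ℝ ∞ (inCharts (m := m) c d u) (extChartAt (𝓡 n) c p) := by
  refine contDiffAt_chart_comp (contMDiffAt_inChart ((extChartAt (𝓡 n) c).map_source hp)
    hu.contMDiffAt) ?_
  rwa [inChart, (extChartAt (𝓡 n) c).left_inv hp]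

include hu hp hd in
theorem fderiv_inCharts (X : Eu n) : fderiv ℝ (inCharts (m := m) c d u) (extChartAt (𝓡 n) c p)
    (dchart c p X) = dchart d (u p) (tmap u p X) := by
  have ht := (extChartAt (𝓡 n) c).map_source hp
  have h1 : inChart c u (extChartAt (𝓡 n) c p) = u p :=
    congrArg u ((extChartAt (𝓡 n) c).left_inv hp)
  have h := fderiv_chart_comp (c := d) ((contMDiffAt_inChart (u := u) ht
    hu.contMDiffAt).mdifferentiableAt (by simp)) (by rw [h1]; exact hd) (dchart c p X)
  rw [dmap_inChart ht (hu.mdifferentiableAt (by simp)), (extChartAt (𝓡 n) c).left_inv hp,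
    dsymm_dchart hp, h1] at h
  exact h

include hg hu hp hd in
theorem chartMetric_pullback_eq (v w : Eu n) :
    chartMetric (pullbackForm n g u) c (extChartAt (𝓡 n) c p) v w
      = met g d (extChartAt (𝓡 m) d (u p))
        (fderiv ℝ (inCharts (m := m) c d u) (extChartAt (𝓡 n) c p) v)
        (fderiv ℝ (inCharts (m := m) c d u) (extChartAt (𝓡 n) c p) w) := by
  rw [← dchart_dsymm' hp v, ← dchart_dsymm' hp w, fderiv_inCharts hp hd hu,
    fderiv_inCharts hp hd hu, ← rawForm_eq_met hg hd, ← rawForm_pullback,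
    rawForm_eq_chartMetric _ hp]

variable {e : Fin n → Eu n}
  (he : IsON (chartMetric (pullbackForm n g u) c (extChartAt (𝓡 n) c p)) e)

include hg hu hp hd he in
theorem isON_met : IsON (fun v w => met g d (extChartAt (𝓡 m) d (u p))
    (fderiv ℝ (inCharts (m := m) c d u) (extChartAt (𝓡 n) c p) v)
    (fderiv ℝ (inCharts (m := m) c d u) (extChartAt (𝓡 n) c p) w)) e := fun i j => by
  rw [← he i j, chartMetric_pullback_eq hg hp hd hu]

/-- This is the passage from intrinsic traces to frame sums in a chart. Bilinearity has to be known
only for the coordinate expression `Q'`; it passes to `Q` because `L` is injective. -/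
theorem tangentTrace_inCharts {V V' : Type*} [AddCommGroup V] [Module ℝ V] [AddCommGroup V']
    [Module ℝ V'] {h : FormField n S} (hh : IsMetric h) (hp : p ∈ (extChartAt (𝓡 n) c).source)
    (he : IsON (chartMetric h c (extChartAt (𝓡 n) c p)) e) {L : V →ₗ[ℝ] V'}
    (hL : Function.Injective L) {Q : Eu n → Eu n → V} {Q' : Eu n → Eu n → V'} (hQ' : IsBil Q')
    (hQ : ∀ X Y, L (Q X Y) = Q' (dchart c p X) (dchart c p Y)) :
    L (tangentTrace h p Q) = ∑ i, Q' (e i) (e i) := by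
  have hb : IsBil fun X Y => Q' (dchart c p X) (dchart c p Y) :=
    hQ'.comp (dchart c p).toLinearMap (LinearMap.id (R := ℝ))
  have hQb : IsBil Q := by
    constructor
    · refine fun Y => ⟨fun a b => hL ?_, fun a b => hL ?_⟩
      · simp only [map_add, hQ, hQ'.left _ |>.map_add]
      · simp only [map_smul, hQ, hQ'.left _ |>.map_smul]
    · refine fun Y => ⟨fun a b => hL ?_, fun a b => hL ?_⟩
      · simp only [map_add, hQ, hQ'.right _ |>.map_add]
      · simp only [map_smul, hQ, hQ'.right _ |>.map_smul]
  rw [tangentTrace_eq hh hp he hQb, map_sum]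
  exact Finset.sum_congr rfl fun i _ => by rw [hQ, dchart_dsymm' hp]

theorem dchart_injective {d x : M} (hx : x ∈ (extChartAt (𝓡 m) d).source) :
    Function.Injective (dchart (k := m) d x) :=
  Function.LeftInverse.injective (g := dsymm (k := m) d (extChartAt (𝓡 m) d x)) fun v => dsymm_dchart hx v

variable (hu' : IsSmoothImmersion n m u)

include hg hp hd hu' in
theorem normalPart_inCharts (W : Eu m) : dchart d (u p) (normalPart n g u p W)
    = norPart (met g d (extChartAt (𝓡 m) d (u p)))
      (fderiv ℝ (inCharts (m := m) c d u) (extChartAt (𝓡 n) c p)) (dchart d (u p) W) := by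
  have hh := isMetric_pullback hg hu'
  obtain ⟨e, he⟩ := (hh c).exists_frame ((extChartAt (𝓡 n) c).map_source hp)
  have hon := isON_met hg hp hd hu'.1 he
  rw [norPart_eq hon]
  set B := met g d (extChartAt (𝓡 m) d (u p))
  set A := fderiv ℝ (inCharts (m := m) c d u) (extChartAt (𝓡 n) c p)
  have h1 := tangentTrace_inCharts (V := Eu m) (V' := Eu m) hh hp he
    (L := (dchart d (u p)).toLinearMap) (dchart_injective hd)
    (Q := fun X Y => rawForm g (u p) W (tmap u p X) • tmap u p Y)
    (Q' := fun v w => B (dchart d (u p) W) (A v) • A w)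
    (isBil_smul_right ((B (dchart d (u p) W)).comp A).toLinearMap A.toLinearMap)
    (fun X Y => by
      rw [rawForm_eq_met hg hd, fderiv_inCharts hp hd hu'.1, fderiv_inCharts hp hd hu'.1]
      exact map_smul _ _ _)
  rw [← h1]
  exact map_sub (dchart d (u p)) _ _

include hg hp hd hu' in
theorem normalDeriv_inCharts {W : S → Eu m}
    (hW : DifferentiableAt ℝ (fieldInCharts c d u W) (extChartAt (𝓡 n) c p)) (X : Eu n) :
    dchart d (u p) (normalDeriv n g u W p X)
      = normalCov g c d u W (extChartAt (𝓡 n) c p) (dchart c p X) := by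
  rw [normalCov, ← covDeriv_inCharts hg hp hd hu'.1.contMDiffAt hW, inCharts_self hp]
  exact normalPart_inCharts hg hp hd hu' _

include hg hp hd hu' in
theorem contDiffAt_normalCov {W : S → Eu m}
    (hW : ContDiffAt ℝ ∞ (fieldInCharts c d u W) (extChartAt (𝓡 n) c p)) (v : Eu n) :
    ContDiffAt ℝ ∞ (fun z => normalCov g c d u W z v) (extChartAt (𝓡 n) c p) := by
  obtain ⟨e, he⟩ := (isMetric_pullback hg hu' c).exists_frame ((extChartAt (𝓡 n) c).map_source hp)
  have hon := isON_met hg hp hd hu'.1 he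
  have hU := contDiffAt_inCharts hp hd hu'.1
  have ht := (extChartAt (𝓡 m) d).map_source hd
  have hUz := inCharts_self (d := d) (u := u) hp (m := m)
  rw [← hUz] at hon ht
  refine contDiffAt_norPart ?_ ((hU.fderiv_right (m := ∞) (by simp))) ?_ hon
  · exact ContDiffAt.comp (g := met g d) _ ((hg d).contDiffAt_mk ht) hU
  · exact contDiffAt_covAlong ((hg d).contDiffAt_christoffel ht) hU hW v

include hg hp hd hu' in
theorem isLinearMap_normalCov (W : S → Eu m) :
    IsLinearMap ℝ (normalCov g c d u W (extChartAt (𝓡 n) c p)) := by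
  obtain ⟨e, he⟩ := (isMetric_pullback hg hu' c).exists_frame ((extChartAt (𝓡 n) c).map_source hp)
  have hon := isON_met hg hp hd hu'.1 he
  rw [← inCharts_self (d := d) (u := u) hp] at hon
  constructor
  · intro a b
    rw [normalCov, covAlong_map_add, norPart_add hon]; rfl
  · intro a b
    rw [normalCov, covAlong_map_smul, norPart_smul hon]; rfl

include hg hp hd hu' in
theorem normalCov_normal (W : S → Eu m) (v w : Eu n) :
    met g d (extChartAt (𝓡 m) d (u p)) (normalCov g c d u W (extChartAt (𝓡 n) c p) v)
      (fderiv ℝ (inCharts (m := m) c d u) (extChartAt (𝓡 n) c p) w) = 0 := by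
  obtain ⟨e, he⟩ := (isMetric_pullback hg hu' c).exists_frame ((extChartAt (𝓡 n) c).map_source hp)
  have hon := isON_met hg hp hd hu'.1 he
  rw [← inCharts_self (d := d) (u := u) hp] at hon ⊢
  exact norPart_normal hon _ _

end Frames

/-! ### Derivatives of linear families evaluated on a vector field. -/

section Family

variable {n : ℕ} {E F : Type*} [NormedAddCommGroup E] [NormedSpace ℝ E]
  [NormedAddCommGroup F] [NormedSpace ℝ F]
  {Γ : F → F →L[ℝ] F →L[ℝ] F} {U : E → F} {x : E}

theorem isBil_covAlong {Q : E → E → F} (hQ : ∀ᶠ z in 𝓝 x, IsLinearMap ℝ (Q z))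
    (hd : ∀ v, DifferentiableAt ℝ (fun z => Q z v) x) :
    IsBil fun v w : E => covAlong Γ U (fun z => Q z w) x v := by
  refine ⟨fun w => ⟨fun a b => covAlong_map_add a b, fun a b => covAlong_map_smul a b⟩,
    fun v => ⟨fun a b => ?_, fun a b => ?_⟩⟩
  · rw [← covAlong_add (hd a) (hd b)]
    exact covAlong_congr (by filter_upwards [hQ] with z hz using hz.map_add a b) v
  · have h1 := covAlong_smul (Γ := Γ) (Ψ := U) (φ := fun _ : E => a) (differentiableAt_const a)
      (hd b) v
    rw [fderiv_fun_const] at h1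
    simp only [Pi.zero_apply, zero_apply, zero_smul, zero_add] at h1
    rw [← h1]
    exact covAlong_congr (by filter_upwards [hQ] with z hz using hz.map_smul a b) v

/-- Differentiability is assumed only for `Q z v` with `v` fixed. Expanding `Y` in the standard
basis turns the claim into finitely many ordinary product rules. -/
theorem hasFDerivAt_family {Q : E → Eu n → F} {Y : E → Eu n}
    (hQ : ∀ᶠ z in 𝓝 x, IsLinearMap ℝ (Q z))
    (hd : ∀ v, DifferentiableAt ℝ (fun z => Q z v) x) (hY : DifferentiableAt ℝ Y x) :
    DifferentiableAt ℝ (fun z => Q z (Y z)) x ∧ ∀ a, fderiv ℝ (fun z => Q z (Y z)) x a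
      = fderiv ℝ (fun z => Q z (Y x)) x a + Q x (fderiv ℝ Y x a) := by
  have hsum : ∀ z, IsLinearMap ℝ (Q z) → ∀ v, Q z v = ∑ i, v i • Q z (stdVec i) := by
    intro z hz v
    conv_lhs => rw [eq_sum_stdVec v]
    exact (map_sum (IsLinearMap.mk' _ hz) _ _).trans
      (Finset.sum_congr rfl fun i _ => hz.map_smul _ _)
  have hYi : ∀ i, HasFDerivAt (fun z => Y z i)
      ((EuclideanSpace.proj i : Eu n →L[ℝ] ℝ).comp (fderiv ℝ Y x)) x := fun i =>
    (EuclideanSpace.proj i : Eu n →L[ℝ] ℝ).hasFDerivAt.comp x hY.hasFDerivAt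
  have h1 := HasFDerivAt.fun_sum (u := Finset.univ) fun i _ =>
    (hYi i).smul (hd (stdVec i)).hasFDerivAt
  have h2 := h1.congr_of_eventuallyEq (f₁ := fun z => Q z (Y z))
    (by filter_upwards [hQ] with z hz using hsum z hz _)
  have h3 := (HasFDerivAt.fun_sum (u := Finset.univ) fun i _ =>
    (hasFDerivAt_const (Y x i) x).smul (hd (stdVec i)).hasFDerivAt).congr_of_eventuallyEq
    (f₁ := fun z => Q z (Y x)) (by filter_upwards [hQ] with z hz using hsum z hz _)
  refine ⟨h2.differentiableAt, fun a => ?_⟩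
  rw [h2.fderiv, h3.fderiv, hsum x hQ.self_of_nhds (fderiv ℝ Y x a)]
  simp [sum_apply, Finset.sum_add_distrib]

theorem covAlong_family {Q : E → Eu n → F} {Y : E → Eu n}
    (hQ : ∀ᶠ z in 𝓝 x, IsLinearMap ℝ (Q z))
    (hd : ∀ v, DifferentiableAt ℝ (fun z => Q z v) x) (hY : DifferentiableAt ℝ Y x) (a : E) :
    covAlong Γ U (fun z => Q z (Y z)) x a
      = covAlong Γ U (fun z => Q z (Y x)) x a + Q x (fderiv ℝ Y x a) := by
  rw [covAlong, covAlong, (hasFDerivAt_family hQ hd hY).2]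
  abel

end Family

/-! ### Gradient and Hessian in a chart. -/

section Gradient

variable {k : ℕ} {N : Type*} [TopologicalSpace N] [ChartedSpace (Eu k) N] [IsManifold (𝓡 k) ∞ N]

theorem contDiffAt_inChart_fun {f : N → ℝ} {c x : N} (hx : x ∈ (extChartAt (𝓡 k) c).source)
    (hf : ContMDiffAt (𝓡 k) 𝓘(ℝ, ℝ) ∞ f x) :
    ContDiffAt ℝ ∞ (inChart c f) (extChartAt (𝓡 k) c x) := by
  refine contMDiffAt_iff_contDiffAt.1 (ContMDiffAt.comp _ ?_
    (contMDiffAt_symm ((extChartAt (𝓡 k) c).map_source hx)))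
  rwa [(extChartAt (𝓡 k) c).left_inv hx]

theorem fderiv_inChart_fun {f : N → ℝ} {c x : N} (hx : x ∈ (extChartAt (𝓡 k) c).source)
    (hf : MDifferentiableAt (𝓡 k) 𝓘(ℝ, ℝ) f x) (X : Eu k) :
    fderiv ℝ (inChart c f) (extChartAt (𝓡 k) c x) (dchart c x X) = dirDeriv (k := k) f x X := by
  have hz := (extChartAt (𝓡 k) c).left_inv hx
  rw [← mfderiv_eq_fderiv]
  have h := mfderiv_comp_apply (extChartAt (𝓡 k) c x) (g := f) (I' := 𝓡 k)
    (by rw [hz]; exact hf)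
    (mdifferentiableAt_symm ((extChartAt (𝓡 k) c).map_source hx)) (dchart c x X)
  refine h.trans ?_
  have h2 := dsymm_dchart hx X
  rw [hz]
  exact congrArg (fun Y : Eu k => dirDeriv (k := k) f x Y) h2

variable {h : FormField k N} (hh : IsMetric h) {f : N → ℝ} {c x : N}

/-- The gradient as a vector-valued function. -/
def rawGradient (h : FormField k N) (f : N → ℝ) : N → Eu k := fun x => gradient h f x

include hh in
theorem gradient_spec (x : N) (V : Eu k) :
    rawForm h x (rawGradient h f x) V = dirDeriv (k := k) f x V := by
  obtain ⟨e, he⟩ := exists_isON (hh.isBil x) (hh.symm x) (hh.pos x)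
  exact riesz_of_isON (hh.isBil x) he (mfderiv (𝓡 k) 𝓘(ℝ, ℝ) f x).toLinearMap.isLinear V

include hh in
theorem gradient_inCharts (hf : ContMDiff (𝓡 k) 𝓘(ℝ, ℝ) ∞ f)
    (hx : x ∈ (extChartAt (𝓡 k) c).source) :
    fieldInCharts c c id (rawGradient h f) (extChartAt (𝓡 k) c x)
      = metricTrace (chartMetric h c (extChartAt (𝓡 k) c x))
        fun a b => fderiv ℝ (inChart c f) (extChartAt (𝓡 k) c x) a • b := by
  have ht := (extChartAt (𝓡 k) c).map_source hx
  refine (hh c).eq_of_forall ht fun a => ?_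
  refine Eq.trans ?_ ((hh c).riesz ht
    (fderiv ℝ (inChart c f) (extChartAt (𝓡 k) c x)).toLinearMap.isLinear a).symm
  rw [fieldInCharts_self hx]
  conv_lhs => rw [← dchart_dsymm' hx a]
  refine (rawForm_eq_chartMetric h hx _ _).symm.trans ?_
  rw [gradient_spec hh, ← fderiv_inChart_fun hx (hf.mdifferentiableAt (by simp)),
    dchart_dsymm' hx]
  rfl

include hh in
theorem met_gradient (hf : ContMDiff (𝓡 k) 𝓘(ℝ, ℝ) ∞ f)
    (hx : x ∈ (extChartAt (𝓡 k) c).source) (W : Eu k) :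
    met h c (extChartAt (𝓡 k) c x)
      (fieldInCharts c c id (rawGradient h f) (extChartAt (𝓡 k) c x)) W
      = fderiv ℝ (inChart c f) (extChartAt (𝓡 k) c x) W := by
  have ht := (extChartAt (𝓡 k) c).map_source hx
  rw [met, (hh c).mk_apply ht, gradient_inCharts hh hf hx]
  exact (hh c).riesz ht (fderiv ℝ (inChart c f) (extChartAt (𝓡 k) c x)).toLinearMap.isLinear W

theorem eventually_chart_eq (hx : x ∈ (extChartAt (𝓡 k) c).source) :
    ∀ᶠ z in 𝓝 (extChartAt (𝓡 k) c x), ∃ y ∈ (extChartAt (𝓡 k) c).source,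
      extChartAt (𝓡 k) c y = z := by
  filter_upwards [(isOpen_chart_target c).mem_nhds ((extChartAt (𝓡 k) c).map_source hx)] with z hz
  exact ⟨_, (extChartAt (𝓡 k) c).map_target hz, (extChartAt (𝓡 k) c).right_inv hz⟩

include hh in
theorem contDiffAt_gradient (hf : ContMDiff (𝓡 k) 𝓘(ℝ, ℝ) ∞ f)
    (hx : x ∈ (extChartAt (𝓡 k) c).source) :
    ContDiffAt ℝ ∞ (fieldInCharts c c id (rawGradient h f)) (extChartAt (𝓡 k) c x) := by
  have ht := (extChartAt (𝓡 k) c).map_source hx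
  have h1 : fieldInCharts c c id (rawGradient h f) =ᶠ[𝓝 (extChartAt (𝓡 k) c x)] fun z =>
      metricTrace (chartMetric h c z) fun a b => fderiv ℝ (inChart c f) z a • b := by
    filter_upwards [eventually_chart_eq hx] with z ⟨y, hy, hz⟩
    rw [← hz, gradient_inCharts hh hf hy]
  refine (contDiffAt_metricTrace (fun i j => (hh c).contDiffAt ht _ _) ((hh c).det_pos ht).ne'
    fun i j => ?_).congr_of_eventuallyEq h1
  exact (contDiffAt_fderiv_apply (contDiffAt_inChart_fun hx hf.contMDiffAt) _).smul contDiffAt_const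

theorem inCharts_id (hx : x ∈ (extChartAt (𝓡 k) c).source) :
    inCharts c c (id : N → N) =ᶠ[𝓝 (extChartAt (𝓡 k) c x)] id := by
  filter_upwards [eventually_chart_eq hx] with z ⟨y, hy, hz⟩
  rw [← hz, inCharts_self hy]
  rfl

include hh in
/-- The Levi-Civita connection in a chart. -/
theorem covDeriv_id_inCharts (hx : x ∈ (extChartAt (𝓡 k) c).source) {W : N → Eu k}
    (hW : DifferentiableAt ℝ (fieldInCharts c c id W) (extChartAt (𝓡 k) c x)) (X : Eu k) :
    dchart c x (covDeriv k h (id : N → N) W x X)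
      = covAlong (chr h c) id (fieldInCharts c c id W) (extChartAt (𝓡 k) c x) (dchart c x X) := by
  have h1 := covDeriv_inCharts (u := (id : N → N)) hh hx (show id x ∈ _ from hx)
    contMDiff_id.contMDiffAt hW X
  refine h1.trans ?_
  rw [covAlong, covAlong, (inCharts_id hx).eq_of_nhds, (inCharts_id hx).fderiv_eq]

include hh in
-- Differentiate `⟨∇f, W⟩ = df(W)` for a field `W` with constant coordinates. By compatibility the
-- Christoffel term comes from `∇W`.
theorem hessian_inCharts (hf : ContMDiff (𝓡 k) 𝓘(ℝ, ℝ) ∞ f)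
    (hx : x ∈ (extChartAt (𝓡 k) c).source) (V W : Eu k) :
    met h c (extChartAt (𝓡 k) c x) (dchart c x (hessian h f x V)) W
      = fderiv ℝ (fun y => fderiv ℝ (inChart c f) y W) (extChartAt (𝓡 k) c x) (dchart c x V)
        - fderiv ℝ (inChart c f) (extChartAt (𝓡 k) c x)
          (chr h c (extChartAt (𝓡 k) c x) (dchart c x V) W) := by
  have ht := (extChartAt (𝓡 k) c).map_source hx
  have hgr := (contDiffAt_gradient hh hf hx).differentiableAt (by simp)
  have h1 := fderiv_metric (Ψ := id) (z := extChartAt (𝓡 k) c x)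
    (((hh c).contDiffAt_mk ht).differentiableAt (by simp))
    ((hh c).isCompat ht) differentiableAt_id hgr (differentiableAt_const W) (dchart c x V)
  have h2 : (fun z => met h c z (fieldInCharts c c id (rawGradient h f) z) W)
      =ᶠ[𝓝 (extChartAt (𝓡 k) c x)] fun z => fderiv ℝ (inChart c f) z W := by
    filter_upwards [eventually_chart_eq hx] with z ⟨y, hy, hz⟩
    rw [← hz, met_gradient hh hf hy]
  have h3 : covAlong (chr h c) id (fun _ : Eu k => W) (extChartAt (𝓡 k) c x) (dchart c x V)
      = chr h c (extChartAt (𝓡 k) c x) (dchart c x V) W := by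
    simp [covAlong]
  change met h c _ (dchart c x (covDeriv k h (id : N → N) (rawGradient h f) x V)) W = _
  rw [covDeriv_id_inCharts hh hx hgr, ← h2.fderiv_eq, ← h3,
    ← met_gradient hh hf hx, eq_sub_iff_add_eq]
  exact h1.symm

end Gradient

/-! ### Second fundamental form and second normal derivatives in charts. -/

section Operators

variable {n m : ℕ} {S : Type*} [TopologicalSpace S] [ChartedSpace (Eu n) S]
  {M : Type*} [TopologicalSpace M] [ChartedSpace (Eu m) M]
  [IsManifold (𝓡 n) ∞ S] [IsManifold (𝓡 m) ∞ M]

/-- The local extension of a tangent vector to a vector field. -/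
def extField (p : S) (Y : Eu n) : S → Eu n := fun q =>
  FiberBundle.extend (Eu n) (E := fun x : S => TangentSpace (𝓡 n) x) (x := p) Y q

theorem extField_self (p : S) (Y : Eu n) : extField p Y p = Y :=
  FiberBundle.extend_apply_self (F := Eu n) (E := fun x : S => TangentSpace (𝓡 n) x) (x := p) Y

theorem differentiableAt_extField {p c : S} (hp : p ∈ (extChartAt (𝓡 n) c).source) (Y : Eu n) :
    DifferentiableAt ℝ (fieldInCharts c c id (extField p Y)) (extChartAt (𝓡 n) c p) := by
  have : IsManifold (𝓡 n) 2 S := inferInstance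
  have h := FiberBundle.contMDiffAt_extend (k := 1) (V := fun x : S => TangentSpace (𝓡 n) x)
    (𝓡 n) (Eu n) (x := p) Y
  exact (contDiffAt_fieldInCharts (u := id) (r := 1) (by norm_cast) (by norm_cast) hp hp
    h).differentiableAt (by norm_num)

variable {g : FormField m M} (hg : IsMetric g) {u : S → M} (hu : IsSmoothImmersion n m u)
  {p c : S} {d : M}
  (hp : p ∈ (extChartAt (𝓡 n) c).source) (hd : u p ∈ (extChartAt (𝓡 m) d).source)

include hu hp hd in
theorem eventually_inCharts : ∀ᶠ z in 𝓝 (extChartAt (𝓡 n) c p),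
    ∃ q ∈ (extChartAt (𝓡 n) c).source, u q ∈ (extChartAt (𝓡 m) d).source ∧
      extChartAt (𝓡 n) c q = z := by
  filter_upwards [eventually_chart hp (eventually_charts hu.1.continuous.continuousAt hp hd)]
    with z hz
  exact ⟨_, hz.2.1, hz.2.2, (extChartAt (𝓡 n) c).right_inv hz.1⟩

include hg hu hp hd in
theorem eventually_isLinearMap_normalCov (W : S → Eu m) :
    ∀ᶠ z in 𝓝 (extChartAt (𝓡 n) c p), IsLinearMap ℝ (normalCov g c d u W z) := by
  filter_upwards [eventually_inCharts hu hp hd] with z ⟨q, hq, hdq, hz⟩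
  rw [← hz]
  exact isLinearMap_normalCov hg hq hdq hu W

include hg hu hp hd in
-- The left side is defined with a chart that moves with the base point, while the right side uses
-- one pair of charts on a whole neighbourhood. This is what allows the normal derivative to be
-- differentiated again.
theorem fieldInCharts_normalDeriv {W : S → Eu m}
    (hW : ContDiffAt ℝ ∞ (fieldInCharts c d u W) (extChartAt (𝓡 n) c p)) (Y : S → Eu n) :
    fieldInCharts c d u (fun q => normalDeriv n g u W q (Y q)) =ᶠ[𝓝 (extChartAt (𝓡 n) c p)]
      fun z => normalCov g c d u W z (fieldInCharts c c id Y z) := by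
  filter_upwards [eventually_inCharts hu hp hd, (hW.of_le (m := 1) (by norm_cast)).eventually
    (by simp)] with z ⟨q, hq, hdq, hz⟩ hWz
  rw [← hz] at hWz ⊢
  refine (fieldInCharts_self hq _).trans ?_
  rw [fieldInCharts_self hq]
  exact normalDeriv_inCharts hg hq hdq hu (hWz.differentiableAt (by norm_num)) _

/-- The second fundamental form in charts. -/
def secondForm (g : FormField m M) (c : S) (d : M) (u : S → M) (z v w : Eu n) : Eu m :=
  norPart (met g d (inCharts c d u z)) (fderiv ℝ (inCharts (m := m) c d u) z)
    (covAlong (chr g d) (inCharts c d u) (fun z => fderiv ℝ (inCharts (m := m) c d u) z w) z v)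

/-- The integrand of the normal Laplacian in charts. -/
def normalHess (g : FormField m M) (c : S) (d : M) (u : S → M) (W : S → Eu m) (z v w : Eu n) :
    Eu m :=
  norPart (met g d (inCharts c d u z)) (fderiv ℝ (inCharts (m := m) c d u) z)
      (covAlong (chr g d) (inCharts c d u) (fun z => normalCov g c d u W z w) z v)
    - normalCov g c d u W z (chr (pullbackForm n g u) c z v w)

include hg hu hp hd in
theorem exists_isON_met : ∃ e, IsON (chartMetric (pullbackForm n g u) c (extChartAt (𝓡 n) c p)) e ∧
    IsON (fun v w => met g d (inCharts c d u (extChartAt (𝓡 n) c p))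
      (fderiv ℝ (inCharts (m := m) c d u) (extChartAt (𝓡 n) c p) v)
      (fderiv ℝ (inCharts (m := m) c d u) (extChartAt (𝓡 n) c p) w)) e := by
  obtain ⟨e, he⟩ := (isMetric_pullback hg hu c).exists_frame ((extChartAt (𝓡 n) c).map_source hp)
  refine ⟨e, he, ?_⟩
  rw [inCharts_self (d := d) (u := u) hp]
  exact isON_met hg hp hd hu.1 he

include hg hp hd in
theorem met_symm' (V W : Eu m) : met g d (inCharts c d u (extChartAt (𝓡 n) c p)) V W
    = met g d (inCharts c d u (extChartAt (𝓡 n) c p)) W V := by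
  rw [inCharts_self (d := d) (u := u) hp]
  exact met_symm hg hd V W

include hg hu hp hd in
theorem isBil_secondForm : IsBil (secondForm g c d u (extChartAt (𝓡 n) c p)) := by
  obtain ⟨e, -, hon⟩ := exists_isON_met hg hu hp hd
  have hU := contDiffAt_inCharts hp hd hu.1
  exact (isBil_covAlong (Γ := chr g d) (U := inCharts (m := m) c d u)
    (Q := fun z w => fderiv ℝ (inCharts (m := m) c d u) z w)
    (Filter.Eventually.of_forall fun z => (fderiv ℝ (inCharts (m := m) c d u) z).toLinearMap.isLinear)
    fun v => (contDiffAt_fderiv_apply hU v).differentiableAt (by simp)).comp LinearMap.id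
    (norMap hon)

include hg hu hp hd in
theorem isBil_normalHess {W : S → Eu m}
    (hW : ContDiffAt ℝ ∞ (fieldInCharts c d u W) (extChartAt (𝓡 n) c p)) :
    IsBil (normalHess g c d u W (extChartAt (𝓡 n) c p)) := by
  obtain ⟨e, -, hon⟩ := exists_isON_met hg hu hp hd
  have h1 := (isBil_covAlong (Γ := chr g d) (U := inCharts (m := m) c d u)
    (eventually_isLinearMap_normalCov hg hu hp hd W)
    fun v => (contDiffAt_normalCov hg hp hd hu hW v).differentiableAt (by simp)).comp LinearMap.id
    (norMap hon)
  have h2 := (isBil_clm (chr (pullbackForm n g u) c (extChartAt (𝓡 n) c p))).comp LinearMap.id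
    (IsLinearMap.mk' _ (isLinearMap_normalCov hg hp hd hu W))
  exact ⟨fun w => ((h1.left w).mk' _ - (h2.left w).mk' _).isLinear,
    fun v => ((h1.right v).mk' _ - (h2.right v).mk' _).isLinear⟩

include hg hu hp hd in
-- The derivative of the chosen extension of `Y` contributes a vector in the range of `dU`, which
-- the normal projection annihilates.
theorem secondFundamentalForm_inCharts (X Y : Eu n) :
    dchart d (u p) (secondFundamentalForm n g u p X Y)
      = secondForm g c d u (extChartAt (𝓡 n) c p) (dchart c p X) (dchart c p Y) := by
  obtain ⟨e, -, hon⟩ := exists_isON_met hg hu hp hd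
  have hU := contDiffAt_inCharts hp hd hu.1
  have hY := differentiableAt_extField hp Y
  have hlin : ∀ᶠ z in 𝓝 (extChartAt (𝓡 n) c p),
      IsLinearMap ℝ fun w => fderiv ℝ (inCharts (m := m) c d u) z w :=
    Filter.Eventually.of_forall fun z => (fderiv ℝ (inCharts (m := m) c d u) z).toLinearMap.isLinear
  have hdif : ∀ v, DifferentiableAt ℝ (fun z => fderiv ℝ (inCharts (m := m) c d u) z v)
      (extChartAt (𝓡 n) c p) :=
    fun v => (contDiffAt_fderiv_apply hU v).differentiableAt (by simp)
  have hF : fieldInCharts c d u (fun q => tmap u q (extField p Y q)) =ᶠ[𝓝 (extChartAt (𝓡 n) c p)]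
      fun z => fderiv ℝ (inCharts (m := m) c d u) z (fieldInCharts c c id (extField p Y) z) := by
    filter_upwards [eventually_inCharts hu hp hd] with z ⟨q, hq, hdq, hz⟩
    rw [← hz, fieldInCharts_self hq, fieldInCharts_self hq]
    exact (fderiv_inCharts hq hdq hu.1 _).symm
  have h0 : fieldInCharts c c id (extField p Y) (extChartAt (𝓡 n) c p) = dchart c p Y := by
    rw [fieldInCharts_self hp, extField_self]; rfl
  refine (normalDeriv_inCharts hg hp hd hu
    (((hasFDerivAt_family hlin hdif hY).1).congr_of_eventuallyEq hF) X).trans ?_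
  rw [normalCov, covAlong_congr hF, covAlong_family hlin hdif hY, norPart_add hon,
    norPart_map hon (met_symm' hg hp hd), add_zero, h0]
  rfl

include hg hu hp hd in
-- The derivative of the extension of `Y` enters both terms, the second one through `∇_X Y = ∂_X Y +
-- Γ(X, Y)`. The two contributions cancel, so only the tensorial expression remains.
theorem normalHess_inCharts {W : S → Eu m}
    (hW : ContDiffAt ℝ ∞ (fieldInCharts c d u W) (extChartAt (𝓡 n) c p)) (X Y : Eu n) :
    dchart d (u p)
      (normalDeriv n g u (fun q => normalDeriv n g u W q (extField p Y q)) p X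
      - normalDeriv n g u W p (covDeriv n (pullbackForm n g u) (id : S → S) (extField p Y) p X) : Eu m)
      = normalHess g c d u W (extChartAt (𝓡 n) c p) (dchart c p X) (dchart c p Y) := by
  obtain ⟨e, -, hon⟩ := exists_isON_met hg hu hp hd
  have hY := differentiableAt_extField hp Y
  have hlin := eventually_isLinearMap_normalCov hg hu hp hd W
  have hdif : ∀ v, DifferentiableAt ℝ (fun z => normalCov g c d u W z v) (extChartAt (𝓡 n) c p) :=
    fun v => (contDiffAt_normalCov hg hp hd hu hW v).differentiableAt (by simp)
  have hF := fieldInCharts_normalDeriv hg hu hp hd hW (extField p Y)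
  have h0 : fieldInCharts c c id (extField p Y) (extChartAt (𝓡 n) c p) = dchart c p Y := by
    rw [fieldInCharts_self hp, extField_self]; rfl
  refine (map_sub (dchart d (u p)) _ _).trans ?_
  refine (congrArg₂ (· - ·) (normalDeriv_inCharts hg hp hd hu
    (((hasFDerivAt_family hlin hdif hY).1).congr_of_eventuallyEq hF) X)
    (normalDeriv_inCharts hg hp hd hu (hW.differentiableAt (by simp)) _)).trans ?_
  have h1 : dchart c p (covDeriv n (pullbackForm n g u) (id : S → S) (extField p Y) p X)
      = fderiv ℝ (fieldInCharts c c id (extField p Y)) (extChartAt (𝓡 n) c p) (dchart c p X)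
        + chr (pullbackForm n g u) c (extChartAt (𝓡 n) c p) (dchart c p X) (dchart c p Y) := by
    refine (covDeriv_id_inCharts (isMetric_pullback hg hu) hp hY X).trans ?_
    rw [covAlong, h0]
    simp
  have h2 : ∀ V : S → Eu m, fieldInCharts c d u V =ᶠ[𝓝 (extChartAt (𝓡 n) c p)]
      (fun z => normalCov g c d u W z (fieldInCharts c c id (extField p Y) z)) →
      normalCov g c d u V (extChartAt (𝓡 n) c p) (dchart c p X)
        = norPart (met g d (inCharts c d u (extChartAt (𝓡 n) c p)))
          (fderiv ℝ (inCharts (m := m) c d u) (extChartAt (𝓡 n) c p))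
          (covAlong (chr g d) (inCharts c d u) (fun z => normalCov g c d u W z (dchart c p Y))
            (extChartAt (𝓡 n) c p) (dchart c p X))
        + normalCov g c d u W (extChartAt (𝓡 n) c p)
          (fderiv ℝ (fieldInCharts c c id (extField p Y)) (extChartAt (𝓡 n) c p) (dchart c p X)) := by
    intro V hV
    rw [normalCov, covAlong_congr hV, covAlong_family hlin hdif hY, norPart_add hon,
      norPart_of_normal hon (V := normalCov g c d u W _ _) (fun w => by
        rw [inCharts_self (d := d) (u := u) hp]; exact normalCov_normal hg hp hd hu W _ w), h0]
  rw [h1, (isLinearMap_normalCov hg hp hd hu W).map_add, normalHess]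
  refine (congrArg (fun a => a - _) (h2 _ hF)).trans ?_
  abel

end Operators

/-! ### The curvature tensor in the preferred chart. -/

section Curvature

variable {k : ℕ} {N : Type*} [TopologicalSpace N] [ChartedSpace (Eu k) N] [IsManifold (𝓡 k) ∞ N]
  {h : FormField k N} (hh : IsMetric h)

include hh in
theorem fderiv_christoffel (x : N) (v w a : Eu k) :
    fderiv ℝ (fun z => localChristoffel (chartMetric h x) z v w) (extChartAt (𝓡 k) x x) a
      = fderiv ℝ (chr h x) (extChartAt (𝓡 k) x x) a v w := by
  have ht := (extChartAt (𝓡 k) x).map_source (mem_extChartAt_source (I := 𝓡 k) x)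
  have h1 : (fun z => localChristoffel (chartMetric h x) z v w)
      =ᶠ[𝓝 (extChartAt (𝓡 k) x x)] fun z => chr h x z v w := by
    filter_upwards [(isOpen_chart_target x).mem_nhds ht] with z hz
    rw [chr, (hh x).mkChristoffel_apply hz]
  have hd : DifferentiableAt ℝ (chr h x) (extChartAt (𝓡 k) x x) :=
    ((hh x).contDiffAt_christoffel ht).differentiableAt (by simp)
  have hd1 : DifferentiableAt ℝ (fun z => chr h x z v) (extChartAt (𝓡 k) x x) :=
    hd.clm_apply (differentiableAt_const v)
  rw [h1.fderiv_eq, fderiv_clm_apply hd1 (differentiableAt_const w),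
    fderiv_clm_apply hd (differentiableAt_const v)]
  simp

include hh in
-- The sign reflects two conventions: `curvature` makes `⟨Rm(X, Y)X, Y⟩` a sectional curvature,
-- while `curv` is the commutator `∇_X∇_Y - ∇_Y∇_X - ∇_[X,Y]`.
theorem curvature_eq (x : N) (X Y Z : Eu k) :
    (curvature h x X Y Z : Eu k) = -curv (chr h x) (extChartAt (𝓡 k) x x) X Y Z := by
  have ht := (extChartAt (𝓡 k) x).map_source (mem_extChartAt_source (I := 𝓡 k) x)
  have h2 : ∀ L : Eu k →L[ℝ] Eu k, L = ContinuousLinearMap.id ℝ (Eu k) →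
      L.inverse (-(fderiv ℝ (fun z => localChristoffel (chartMetric h x) z (L Y) (L Z))
          (extChartAt (𝓡 k) x x) (L X)
        - fderiv ℝ (fun z => localChristoffel (chartMetric h x) z (L X) (L Z))
          (extChartAt (𝓡 k) x x) (L Y)
        + localChristoffel (chartMetric h x) (extChartAt (𝓡 k) x x) (L X)
          (localChristoffel (chartMetric h x) (extChartAt (𝓡 k) x x) (L Y) (L Z))
        - localChristoffel (chartMetric h x) (extChartAt (𝓡 k) x x) (L Y)
          (localChristoffel (chartMetric h x) (extChartAt (𝓡 k) x x) (L X) (L Z))))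
      = -curv (chr h x) (extChartAt (𝓡 k) x x) X Y Z := by
    rintro _ rfl
    rw [ContinuousLinearMap.inverse_id, curv, ← fderiv_christoffel hh, ← fderiv_christoffel hh]
    simp only [chr, (hh x).mkChristoffel_apply ht]
    rfl
  exact h2 (dchart x x) (dchart_self x)

end Curvature

/-! ### The stability operator in charts. -/

section Stability

variable {n m : ℕ} {S : Type*} [TopologicalSpace S] [ChartedSpace (Eu n) S]
  {M : Type*} [TopologicalSpace M] [ChartedSpace (Eu m) M]
  [IsManifold (𝓡 n) ∞ S] [IsManifold (𝓡 m) ∞ M]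
  {g : FormField m M} (hg : IsMetric g) {u : S → M} (hu : IsSmoothImmersion n m u)
  {f : M → ℝ} (hf : ContMDiff (𝓡 m) 𝓘(ℝ, ℝ) ∞ f)
  {p c : S} {d : M}
  (hp : p ∈ (extChartAt (𝓡 n) c).source) (hd : u p ∈ (extChartAt (𝓡 m) d).source)
  {e : Fin n → Eu n}
  (he : IsON (chartMetric (pullbackForm n g u) c (extChartAt (𝓡 n) c p)) e)

include hu hf hp hd in
theorem dirDeriv_comp (X : Eu n) : dirDeriv (k := n) (fun q => f (u q)) p X
    = fderiv ℝ (inChart d f) (extChartAt (𝓡 m) d (u p))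
      (fderiv ℝ (inCharts (m := m) c d u) (extChartAt (𝓡 n) c p) (dchart c p X)) := by
  rw [fderiv_inCharts hp hd hu.1, fderiv_inChart_fun hd (hf.mdifferentiableAt (by simp))]
  exact mfderiv_comp_apply p (hf.mdifferentiableAt (by simp)) (hu.1.mdifferentiableAt (by simp)) X

include hg hu hp hd he in
theorem meanCurvature_inCharts : dchart d (u p) (meanCurvature n g u p)
    = ∑ i, secondForm g c d u (extChartAt (𝓡 n) c p) (e i) (e i) :=
  tangentTrace_inCharts (V := Eu m) (V' := Eu m) (isMetric_pullback hg hu) hp he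
    (L := (dchart d (u p)).toLinearMap) (dchart_injective hd)
    (Q := fun X Y => secondFundamentalForm n g u p X Y)
    (isBil_secondForm hg hu hp hd) (secondFundamentalForm_inCharts hg hu hp hd)

include hg hu hf hp hd he in
theorem weightedNormalLaplacian_inCharts {T : S → Eu m}
    (hT : ContDiffAt ℝ ∞ (fieldInCharts c d u T) (extChartAt (𝓡 n) c p)) :
    dchart d (u p) (weightedNormalLaplacian n g f u T p)
      = ∑ i, normalHess g c d u T (extChartAt (𝓡 n) c p) (e i) (e i)
        - ∑ i, fderiv ℝ (inChart d f) (extChartAt (𝓡 m) d (u p))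
          (fderiv ℝ (inCharts (m := m) c d u) (extChartAt (𝓡 n) c p) (e i))
          • normalCov g c d u T (extChartAt (𝓡 n) c p) (e i) := by
  have h1 := tangentTrace_inCharts (V := Eu m) (V' := Eu m) (isMetric_pullback hg hu) hp he
    (L := (dchart d (u p)).toLinearMap) (dchart_injective hd)
    (Q := fun X Y => (normalDeriv n g u (fun q => normalDeriv n g u T q (extField p Y q)) p X
      - normalDeriv n g u T p (covDeriv n (pullbackForm n g u) (id : S → S) (extField p Y) p X)
      : Eu m))
    (isBil_normalHess hg hu hp hd hT) (normalHess_inCharts hg hu hp hd hT)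
  have h2 := tangentTrace_inCharts (V := Eu m) (V' := Eu m) (isMetric_pullback hg hu) hp he
    (L := (dchart d (u p)).toLinearMap) (dchart_injective hd)
    (Q := fun X Y => dirDeriv (k := n) (fun q => f (u q)) p X • normalDeriv n g u T p Y)
    (Q' := fun v w => fderiv ℝ (inChart d f) (extChartAt (𝓡 m) d (u p))
          (fderiv ℝ (inCharts (m := m) c d u) (extChartAt (𝓡 n) c p) v)
          • normalCov g c d u T (extChartAt (𝓡 n) c p) w)
    (isBil_smul_right ((fderiv ℝ (inChart d f) (extChartAt (𝓡 m) d (u p))).comp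
          (fderiv ℝ (inCharts (m := m) c d u) (extChartAt (𝓡 n) c p))).toLinearMap
      ((isLinearMap_normalCov hg hp hd hu T).mk' _)) (fun X Y => by
        rw [dirDeriv_comp hu hf hp hd, ← normalDeriv_inCharts hg hp hd hu
          (hT.differentiableAt (by simp))]
        exact map_smul _ _ _)
  rw [← h1, ← h2]
  exact map_sub (dchart d (u p)) _ _

include hg hu hp hd he in
theorem secondFundamentalTerm_inCharts (T : Eu m) :
    dchart d (u p) (secondFundamentalTerm n g u p T)
      = ∑ i, ∑ j, met g d (extChartAt (𝓡 m) d (u p))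
          (secondForm g c d u (extChartAt (𝓡 n) c p) (e i) (e j)) (dchart d (u p) T)
        • secondForm g c d u (extChartAt (𝓡 n) c p) (e i) (e j) := by
  have hb := isBil_secondForm hg hu hp hd
  set B := met g d (extChartAt (𝓡 m) d (u p))
  set A := secondForm g c d u (extChartAt (𝓡 n) c p)
  have h0 : ∀ X X', dchart d (u p) (tangentTrace (pullbackForm n g u) p fun Y Y' =>
      g (u p) (secondFundamentalForm n g u p X Y) T • secondFundamentalForm n g u p X' Y')
      = ∑ j, B (A (dchart c p X) (e j)) (dchart d (u p) T) • A (dchart c p X') (e j) := fun X X' =>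
    tangentTrace_inCharts (V := Eu m) (V' := Eu m) (isMetric_pullback hg hu) hp he
      (L := (dchart d (u p)).toLinearMap) (dchart_injective hd)
      (Q := fun Y Y' => rawForm g (u p) (secondFundamentalForm n g u p X Y) T
        • secondFundamentalForm n g u p X' Y')
      (Q' := fun v w => B (A (dchart c p X) v) (dchart d (u p) T) • A (dchart c p X') w)
      (isBil_smul_right (((B.flip (dchart d (u p) T)).toLinearMap).comp ((hb.right _).mk' _))
        ((hb.right _).mk' _)) (fun Y Y' => (map_smul (dchart d (u p)) _ _).trans
          (congrArg₂ (fun (a : ℝ) (b : Eu m) => a • b) ((rawForm_eq_met hg hd _ _).trans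
            (congrArg (fun V => B V _) (secondFundamentalForm_inCharts hg hu hp hd X Y)))
            (secondFundamentalForm_inCharts hg hu hp hd X' Y')))
  refine tangentTrace_inCharts (V := Eu m) (V' := Eu m) (isMetric_pullback hg hu) hp he
      (L := (dchart d (u p)).toLinearMap) (dchart_injective hd)
      (Q := fun X X' => tangentTrace (pullbackForm n g u) p fun Y Y' =>
        g (u p) (secondFundamentalForm n g u p X Y) T • secondFundamentalForm n g u p X' Y')
      (Q' := fun v w => ∑ j, B (A v (e j)) (dchart d (u p) T) • A w (e j)) ?_ h0
  have hj := fun j => isBil_smul_right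
    (((B.flip (dchart d (u p) T)).toLinearMap).comp ((hb.left (e j)).mk' _)) ((hb.left (e j)).mk' _)
  exact ⟨fun w => (∑ j, ((hj j).left w).mk' _).isLinear |> fun h => by
      convert h using 2; simp [LinearMap.sum_apply],
    fun v => (∑ j, ((hj j).right v).mk' _).isLinear |> fun h => by
      convert h using 2; simp [LinearMap.sum_apply]⟩

include hg hu hp he in
theorem curvatureTerm_inCharts (T : Eu m) :
    dchart (u p) (u p) (curvatureTerm n g u p T)
      = ∑ i, norPart (met g (u p) (extChartAt (𝓡 m) (u p) (u p)))
          (fderiv ℝ (inCharts (m := m) c (u p) u) (extChartAt (𝓡 n) c p))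
          (-curv (chr g (u p)) (extChartAt (𝓡 m) (u p) (u p))
            (fderiv ℝ (inCharts (m := m) c (u p) u) (extChartAt (𝓡 n) c p) (e i)) T
            (fderiv ℝ (inCharts (m := m) c (u p) u) (extChartAt (𝓡 n) c p) (e i))) := by
  have hd : u p ∈ (extChartAt (𝓡 m) (u p)).source := mem_extChartAt_source (u p)
  have hon := isON_met hg hp hd hu.1 he
  set B := met g (u p) (extChartAt (𝓡 m) (u p) (u p))
  set y := extChartAt (𝓡 m) (u p) (u p)
  have hA : ∀ X, tmap u p X = fderiv ℝ (inCharts (m := m) c (u p) u) (extChartAt (𝓡 n) c p)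
      (dchart c p X) := fun X => by
    rw [fderiv_inCharts hp hd hu.1, dchart_self]; rfl
  set A := fderiv ℝ (inCharts (m := m) c (u p) u) (extChartAt (𝓡 n) c p)
  have hb : IsBil fun X Z : Eu m => -curv (chr g (u p)) y X T Z := by
    constructor
    · exact fun w => ⟨fun a b => by simp [curv]; abel, fun a b => by
        simp only [curv, map_smul, smul_apply, ← smul_add, ← smul_sub, ← smul_neg]⟩
    · exact fun w => ⟨fun a b => by simp [curv]; abel, fun a b => by
        simp only [curv, map_smul, smul_apply, ← smul_add, ← smul_sub, ← smul_neg]⟩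
  refine tangentTrace_inCharts (V := Eu m) (V' := Eu m) (isMetric_pullback hg hu) hp he
    (L := (dchart (u p) (u p)).toLinearMap) (dchart_injective hd)
    (Q := fun X Y => normalPart n g u p (curvature g (u p) (tmap u p X) T (tmap u p Y)))
    (Q' := fun v w => norPart B A (-curv (chr g (u p)) y (A v) T (A w)))
    (hb.comp A.toLinearMap (norMap hon)) fun X Y => ?_
  refine (normalPart_inCharts hg hp hd hu _).trans ?_
  rw [dchart_self, ← hA, ← hA]
  exact congrArg (norPart B A) (curvature_eq hg (u p) _ _ _)

include hg hu hf hp he in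
/-- The stability operator tested against a normal vector, in charts. -/
theorem inner_stabilityOperator {T : S → Eu m}
    (hT : ContDiffAt ℝ ∞ (fieldInCharts c (u p) u T) (extChartAt (𝓡 n) c p))
    {B : Eu m →L[ℝ] Eu m →L[ℝ] ℝ} {A : Eu n →L[ℝ] Eu m} {Φ : Eu m →L[ℝ] ℝ} {U : Eu n → Eu m}
    {z : Eu n} {y : Eu m}
    (hz : extChartAt (𝓡 n) c p = z) (hy : extChartAt (𝓡 m) (u p) (u p) = y)
    (hU : inCharts c (u p) u = U)
    (hB : met g (u p) y = B) (hA : fderiv ℝ U z = A) (hΦ : fderiv ℝ (inChart (u p) f) y = Φ)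
    (hTn : ∀ w, B (T p) (A w) = 0) {ξ : Eu m} (hξ : ∀ w, B ξ (A w) = 0) :
    rawForm g (u p) (stabilityOperator n g f u T p) ξ
      = ∑ i, (B (covAlong (chr g (u p)) U (fun z => normalCov g c (u p) u T z (e i)) z (e i)) ξ
          - B (normalCov g c (u p) u T z (chr (pullbackForm n g u) c z (e i) (e i))) ξ
          - Φ (A (e i)) * B (normalCov g c (u p) u T z (e i)) ξ
          - B (curv (chr g (u p)) y (A (e i)) (T p) (A (e i))) ξ)
        + ∑ i, ∑ j, B (covAlong (chr g (u p)) U (fun z => fderiv ℝ U z (e j)) z (e i)) (T p)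
          * B (covAlong (chr g (u p)) U (fun z => fderiv ℝ U z (e j)) z (e i)) ξ
        + (fderiv ℝ (fun y => fderiv ℝ (inChart (u p) f) y ξ) y (T p)
          - Φ (chr g (u p) y (T p) ξ)) := by
  subst hz hy hU hB hA hΦ
  have hd : u p ∈ (extChartAt (𝓡 m) (u p)).source := mem_extChartAt_source (u p)
  have hUz := inCharts_self (m := m) (d := u p) (u := u) hp
  have hs := met_symm hg hd
  have hid : ∀ V : Eu m, dchart (k := m) (u p) (u p) V = V := fun V => by
    rw [dchart_self (k := m)]; rfl
  -- Pairing with a normal vector does not see the normal projections inside `L_f`, so they can be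
  -- dropped; `hnorT` does the same for the inner product with `T` in `B(T)`.
  have hnor : ∀ V, met g (u p) (extChartAt (𝓡 m) (u p) (u p))
      (norPart (met g (u p) (inCharts c (u p) u (extChartAt (𝓡 n) c p)))
        (fderiv ℝ (inCharts (m := m) c (u p) u) (extChartAt (𝓡 n) c p)) V) ξ
      = met g (u p) (extChartAt (𝓡 m) (u p) (u p)) V ξ := fun V => by
    rw [hUz]; exact norPart_inner hs V hξ
  have hnorT : ∀ V, met g (u p) (extChartAt (𝓡 m) (u p) (u p))
      (norPart (met g (u p) (inCharts c (u p) u (extChartAt (𝓡 n) c p)))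
        (fderiv ℝ (inCharts (m := m) c (u p) u) (extChartAt (𝓡 n) c p)) V) (T p)
      = met g (u p) (extChartAt (𝓡 m) (u p) (u p)) V (T p) := fun V => by
    rw [hUz]; exact norPart_inner hs V hTn
  have h1 := (hid _).symm.trans (weightedNormalLaplacian_inCharts hg hu hf hp hd he hT)
  have h2 := (hid _).symm.trans (curvatureTerm_inCharts hg hu hp he (T p))
  have h3 := (hid _).symm.trans (secondFundamentalTerm_inCharts hg hu hp hd he (T p))
  have h4 := ((hid _).symm.trans (normalPart_inCharts hg hp hd hu (hessian g f (u p) (T p)))).trans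
    (congrArg (norPart _ _) (hid _))
  have h5 := (congrArg (fun V => met g (u p) (extChartAt (𝓡 m) (u p) (u p)) V ξ) (hid _)).symm.trans
    (hessian_inCharts hg hf hd (T p) ξ)
  simp only [hid (T p)] at h3 h5
  refine (rawForm_eq_met hg hd _ _).trans ((congrArg₂ (fun V W =>
    met g (u p) (extChartAt (𝓡 m) (u p) (u p)) V W) (hid _) (hid _)).trans ?_)
  have key : ∀ a b c' e' : Eu m, met g (u p) (extChartAt (𝓡 m) (u p) (u p)) (a + b + c' + e') ξ
      = met g (u p) (extChartAt (𝓡 m) (u p) (u p)) a ξ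
        + met g (u p) (extChartAt (𝓡 m) (u p) (u p)) b ξ
        + met g (u p) (extChartAt (𝓡 m) (u p) (u p)) c' ξ
        + met g (u p) (extChartAt (𝓡 m) (u p) (u p)) e' ξ := fun a b c' e' => by
    simp only [map_add, add_apply]
  have hmap := fun {a b : Eu m} (h : a = b) =>
    congrArg (fun V => met g (u p) (extChartAt (𝓡 m) (u p) (u p)) V ξ) h
  rw [← hUz] at h2 h4
  refine (key _ _ _ _).trans ((congrArg₂ (· + ·) (congrArg₂ (· + ·) (congrArg₂ (· + ·) (hmap h1)
    (hmap h2)) (hmap h3)) (((hmap h4).trans (hnor _)).trans h5)).trans ?_)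
  simp only [map_sub, map_sum, sub_apply, sum_apply,
    map_smul, smul_apply, smul_eq_mul, normalHess, secondForm, hnor, hnorT, map_neg, neg_apply,
    Finset.sum_sub_distrib, Finset.sum_neg_distrib]
  rw [hUz]
  ring

end Stability

/-! ### The variation as a map of time and space, and its acceleration form. -/

section Flow

variable {n m : ℕ} {S : Type*} [TopologicalSpace S] [ChartedSpace (Eu n) S]
  {M : Type*} [TopologicalSpace M] [ChartedSpace (Eu m) M]

/-- The family of maps `ψ t` read in the chart around `c`, as a function of time and space. -/
def flow {n : ℕ} {S : Type*} [TopologicalSpace S] [ChartedSpace (Eu n) S] {M : Type*}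
    (ψ : ℝ → S → M) (c : S) (q : ℝ × Eu n) : M := ψ q.1 ((extChartAt (𝓡 n) c).symm q.2)

/-- The derivative `α(X) = ∂ₜ ⟨∂ₜψ, dψ(X)⟩` at `t = 0`. -/
def accelForm (g : FormField m M) (ψ : ℝ → S → M) (q : S) (X : Eu n) : ℝ :=
  deriv (fun t => rawForm g (ψ t q) (dmap (fun t => ψ t q) t (1 : ℝ)) (tmap (ψ t) q X)) 0

/-- The vector field dual to `accelForm` for the metric induced by `ψ 0`. -/
def accelField (g : FormField m M) (ψ : ℝ → S → M) (q : S) : Eu n :=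
  metricTrace (rawForm (pullbackForm n g (ψ 0)) q) fun a b => accelForm g ψ q a • b

/-- The density of the weighted volume of `ψ t` in the chart around `c`. -/
def density (g : FormField m M) (f : M → ℝ) (ψ : ℝ → S → M) (c : S) (t : ℝ) (z : Eu n) : ℝ :=
  Real.sqrt (gram (chartMetric (pullbackForm n g (ψ t)) c z)).det
    * Real.exp (-f (ψ t ((extChartAt (𝓡 n) c).symm z)))

variable [IsManifold (𝓡 n) ∞ S] [IsManifold (𝓡 m) ∞ M]
  {u : S → M} {T : ∀ p : S, TangentSpace (𝓡 m) (u p)} {ψ : ℝ → S → M} {ε : ℝ} {K : Set S}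
  (hψ : IsVariation n u T ψ ε K) {c : S} {t : ℝ} (ht : t ∈ Set.Ioo (-ε) ε) {z : Eu n}
  (hz : z ∈ (extChartAt (𝓡 n) c).target)

include hψ ht in
theorem IsVariation.contMDiffAt (q : S) :
    ContMDiffAt (𝓘(ℝ, ℝ).prod (𝓡 n)) (𝓡 m) ∞ (fun z : ℝ × S => ψ z.1 z.2) (t, q) :=
  hψ.smooth.contMDiffAt ((isOpen_Ioo.prod isOpen_univ).mem_nhds ⟨ht, Set.mem_univ _⟩)

include hψ ht in
theorem IsVariation.contMDiff : ContMDiff (𝓡 n) (𝓡 m) ∞ (ψ t) := fun q =>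
  ContMDiffAt.comp (g := fun z : ℝ × S => ψ z.1 z.2) q (hψ.contMDiffAt ht q)
    (contMDiffAt_const.prodMk contMDiffAt_id)

include hψ ht hz in
theorem contMDiffAt_flow : ContMDiffAt 𝓘(ℝ, ℝ × Eu n) (𝓡 m) ∞ (flow ψ c) (t, z) := by
  refine ContMDiffAt.comp (g := fun z : ℝ × S => ψ z.1 z.2)
    (f := fun q : ℝ × Eu n => (q.1, (extChartAt (𝓡 n) c).symm q.2)) (t, z) (hψ.contMDiffAt ht _) ?_
  refine ContMDiffAt.prodMk ?_ ?_
  · exact contDiff_fst.contMDiff.contMDiffAt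
  · exact ContMDiffAt.comp (g := (extChartAt (𝓡 n) c).symm) (t, z) (contMDiffAt_symm hz)
      contDiff_snd.contMDiff.contMDiffAt

theorem hasFDerivAt_prodMk_const {E E' : Type*} [NormedAddCommGroup E] [NormedSpace ℝ E]
    [NormedAddCommGroup E'] [NormedSpace ℝ E'] (t : E') (z : E) :
    HasFDerivAt (fun y : E => (t, y)) (ContinuousLinearMap.inr ℝ E' E) z :=
  (hasFDerivAt_const t z).prodMk (hasFDerivAt_id z)

include hψ ht hz in
theorem dmap_flow_space (v : Eu n) : dmap (k := m) (flow ψ c) (t, z) (0, v)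
    = tmap (ψ t) ((extChartAt (𝓡 n) c).symm z) (dsymm c z v) := by
  rw [← dmap_inChart hz ((hψ.contMDiff ht).mdifferentiableAt (by simp))]
  have h1 := hasFDerivAt_prodMk_const t z
  have h := mfderiv_comp_apply (I := 𝓘(ℝ, Eu n)) (I' := 𝓘(ℝ, ℝ × Eu n)) (I'' := 𝓡 m) z
    (g := flow ψ c) (f := fun y : Eu n => (t, y))
    ((contMDiffAt_flow hψ ht hz).mdifferentiableAt (by simp)) h1.differentiableAt.mdifferentiableAt v
  rw [mfderiv_eq_fderiv, h1.fderiv] at h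
  exact h.symm

include hψ ht hz in
theorem dmap_flow_time : dmap (k := m) (flow ψ c) (t, z) (1, 0)
    = dmap (fun t => ψ t ((extChartAt (𝓡 n) c).symm z)) t (1 : ℝ) := by
  have h1 : HasFDerivAt (fun s : ℝ => (s, z)) (ContinuousLinearMap.inl ℝ ℝ (Eu n)) t :=
    (hasFDerivAt_id t).prodMk (hasFDerivAt_const z t)
  have h := mfderiv_comp_apply (I := 𝓘(ℝ, ℝ)) (I' := 𝓘(ℝ, ℝ × Eu n)) (I'' := 𝓡 m) t
    (g := flow ψ c) (f := fun s : ℝ => (s, z))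
    ((contMDiffAt_flow hψ ht hz).mdifferentiableAt (by simp)) h1.differentiableAt.mdifferentiableAt
    (1 : ℝ)
  rw [mfderiv_eq_fderiv, h1.fderiv] at h
  exact h.symm

include hψ in
theorem IsVariation.dmap_zero (q : S) : dmap (k := m) (fun t => ψ t q) 0 (1 : ℝ) = T q :=
  congrArg (fun z : TangentBundle (𝓡 m) M => (z.2 : Eu m)) (hψ.velocity q)

include hψ ht hz in
theorem chartMetric_flow (g : FormField m M) (v w : Eu n) :
    chartMetric (pullbackForm n g (ψ t)) c z v w = formAlong g (flow ψ c) (t, z) (0, v) (0, w) := by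
  rw [chartMetric_eq, rawForm_pullback, formAlong, dmap_flow_space hψ ht hz,
    dmap_flow_space hψ ht hz]
  rfl

variable {g : FormField m M} (hg : IsMetric g)

include hψ ht hz hg in
theorem contDiffAt_formAlong_flow (a b : ℝ × Eu n) :
    ContDiffAt ℝ ∞ (fun q => formAlong g (flow ψ c) q a b) (t, z) :=
  contDiffAt_formAlong hg (contMDiffAt_flow hψ ht hz) a b

include hψ in
theorem IsVariation.zero_mem : (0 : ℝ) ∈ Set.Ioo (-ε) ε := ⟨neg_lt_zero.2 hψ.pos, hψ.pos⟩

include hψ hg hz in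
-- The form is defined without charts because the divergence theorem with a partition of unity needs
-- one vector field on all of `Σ`. This is its expression in coordinates.
theorem accelForm_eq (v : Eu n) :
    accelForm g ψ ((extChartAt (𝓡 n) c).symm z) (dsymm c z v)
      = fderiv ℝ (fun q => formAlong g (flow ψ c) q (1, 0) (0, v)) (0, z) (1, 0) := by
  have h0 := (contDiffAt_formAlong_flow hψ hψ.zero_mem hz hg (1, 0) (0, v)).differentiableAt (by simp)
  have h1 : HasDerivAt (fun s : ℝ => (s, z)) ((1 : ℝ), (0 : Eu n)) 0 :=
    (hasDerivAt_id 0).prodMk (hasDerivAt_const 0 z)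
  have h2 := (h0.hasFDerivAt.comp_hasDerivAt (0 : ℝ) h1).deriv
  rw [← h2, accelForm]
  refine Filter.EventuallyEq.deriv_eq ?_
  filter_upwards [isOpen_Ioo.mem_nhds hψ.zero_mem] with t ht
  rw [← dmap_flow_time hψ ht hz, ← dmap_flow_space hψ ht hz]
  rfl

include hψ hg hz in
-- Linearity is not formal, since the form is a time derivative: additivity uses that the functions
-- being differentiated are differentiable.
theorem isLinearMap_accelForm :
    IsLinearMap ℝ (accelForm (n := n) g ψ ((extChartAt (𝓡 n) c).symm z)) := by
  have hb : ∀ q, IsBil (rawForm g q) := hg.isBil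
  have key : IsLinearMap ℝ fun v : Eu n =>
      fderiv ℝ (fun q => formAlong g (flow ψ c) q (1, 0) (0, v)) (0, z) (1, 0) := by
    have hd := fun v : Eu n => (contDiffAt_formAlong_flow hψ hψ.zero_mem hz hg (1, 0)
      (0, v)).differentiableAt (by simp)
    constructor
    · intro v w
      have : (fun q => formAlong g (flow ψ c) q (1, 0) (0, v + w)) = fun q =>
          formAlong g (flow ψ c) q (1, 0) (0, v) + formAlong g (flow ψ c) q (1, 0) (0, w) := by
        funext q
        rw [formAlong, ← (add_zero (0 : ℝ)), ← Prod.mk_add_mk, map_add, ((hb _).right _).map_add]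
        rw [add_zero]; rfl
      rw [this, fderiv_fun_add (hd v) (hd w)]; rfl
    · intro a v
      have : (fun q => formAlong g (flow ψ c) q (1, 0) (0, a • v)) = fun q =>
          a • formAlong g (flow ψ c) q (1, 0) (0, v) := by
        funext q
        have : ((0 : ℝ), a • v) = a • ((0 : ℝ), v) := by simp
        rw [formAlong, this, map_smul, ((hb _).right _).map_smul]; rfl
      rw [this, fderiv_fun_const_smul (hd v)]; rfl
  have h2 : accelForm (n := n) g ψ ((extChartAt (𝓡 n) c).symm z) = fun X =>
      fderiv ℝ (fun q => formAlong g (flow ψ c) q (1, 0)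
        (0, dchart c ((extChartAt (𝓡 n) c).symm z) X)) (0, z) (1, 0) := by
    funext X
    rw [← accelForm_eq hψ hz hg, dsymm_dchart' hz]
  rw [h2]
  exact ⟨fun a b => by rw [map_add, key.map_add], fun a b => by rw [map_smul, key.map_smul]⟩

variable (hu : IsSmoothImmersion n m u)

include hψ hg hu hz in
theorem accelField_spec (v : Eu n) : chartMetric (pullbackForm n g u) c z
    (fieldInCharts c c id (accelField g ψ) z) v
      = fderiv ℝ (fun q => formAlong g (flow ψ c) q (1, 0) (0, v)) (0, z) (1, 0) := by
  set q := (extChartAt (𝓡 n) c).symm z with hq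
  have hqs : q ∈ (extChartAt (𝓡 n) c).source := (extChartAt (𝓡 n) c).map_target hz
  have hqz : extChartAt (𝓡 n) c q = z := (extChartAt (𝓡 n) c).right_inv hz
  have hm := isMetric_pullback hg hu
  obtain ⟨e, he⟩ := exists_isON (hm.isBil q) (hm.symm q) (hm.pos q)
  have h1 := riesz_of_isON (hm.isBil q) he (isLinearMap_accelForm hψ hz hg) (dsymm c z v)
  rw [accelForm_eq hψ hz hg] at h1
  rw [← h1, ← hq, ← hqz, fieldInCharts_self hqs, id]
  have h2 := rawForm_eq_chartMetric (pullbackForm n g u) hqs (accelField g ψ q) (dsymm c z v)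
  rw [hqz, dchart_dsymm hz] at h2
  rw [hqz, ← h2, accelField, hψ.initial]

end Flow

/-! ### Minimality, velocity and acceleration in charts. -/

section Pointwise

variable {n m : ℕ} {S : Type*} [TopologicalSpace S] [ChartedSpace (Eu n) S]
  {M : Type*} [TopologicalSpace M] [ChartedSpace (Eu m) M]
  [IsManifold (𝓡 n) ∞ S] [IsManifold (𝓡 m) ∞ M]
  {g : FormField m M} (hg : IsMetric g) {f : M → ℝ} (hf : ContMDiff (𝓡 m) 𝓘(ℝ, ℝ) ∞ f)
  {u : S → M} (hu : IsSmoothImmersion n m u)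
  {T : ∀ p : S, TangentSpace (𝓡 m) (u p)} {ψ : ℝ → S → M} {ε : ℝ} {K : Set S}
  (hψ : IsVariation n u T ψ ε K) {p c : S} (hp : p ∈ (extChartAt (𝓡 n) c).source)

include hg hf hu hp in
/-- `f`-minimality in charts. -/
theorem minimal_inCharts {d : M} (hd : u p ∈ (extChartAt (𝓡 m) d).source)
    (hmin : weightedMeanCurvature n g f u p = 0)
    {e : Fin n → Eu n} (he : IsON (chartMetric (pullbackForm n g u) c (extChartAt (𝓡 n) c p)) e)
    {B : Eu m →L[ℝ] Eu m →L[ℝ] ℝ} {A : Eu n →L[ℝ] Eu m} {Φ : Eu m →L[ℝ] ℝ} {U : Eu n → Eu m}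
    {z : Eu n} {y : Eu m}
    (hz : extChartAt (𝓡 n) c p = z) (hy : extChartAt (𝓡 m) d (u p) = y)
    (hU : inCharts c d u = U)
    (hB : met g d y = B) (hA : fderiv ℝ U z = A) (hΦ : fderiv ℝ (inChart d f) y = Φ) (V : Eu m) :
    ∑ i, (B (covAlong (chr g d) U (fun z => fderiv ℝ U z (e i)) z (e i)) V
      - B (A (chr (pullbackForm n g u) c z (e i) (e i))) V) + Φ V
      - ∑ i, Φ (A (e i)) * B (A (e i)) V = 0 := by
  subst hz hy hU hB hA hΦ
  have hm := isMetric_pullback hg hu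
  have ht := (extChartAt (𝓡 n) c).map_source hp
  have htd := (extChartAt (𝓡 m) d).map_source hd
  have hUz := inCharts_self (m := m) (d := d) (u := u) hp
  have hon := isON_met hg hp hd hu.1 he
  have hs := met_symm hg hd
  -- By the Gauss formula the tangential part that the projection removes is `dU` of the Christoffel
  -- symbol of the induced metric.
  have hgauss : ∀ v w, secondForm g c d u (extChartAt (𝓡 n) c p) v w
      = covAlong (chr g d) (inCharts c d u) (fun z => fderiv ℝ (inCharts (m := m) c d u) z w)
        (extChartAt (𝓡 n) c p) v - fderiv ℝ (inCharts (m := m) c d u) (extChartAt (𝓡 n) c p)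
          (chr (pullbackForm n g u) c (extChartAt (𝓡 n) c p) v w) := fun v w => by
    rw [secondForm, norPart]
    congr 2
    refine (hm c).eq_of_forall ht fun a => ?_
    have h1 := riesz_of_isON (isBil_pull (met g d (inCharts c d u (extChartAt (𝓡 n) c p)))
      (fderiv ℝ (inCharts (m := m) c d u) (extChartAt (𝓡 n) c p))) (by rw [hUz]; exact hon)
      (((met g d (inCharts c d u (extChartAt (𝓡 n) c p))) (covAlong (chr g d) (inCharts c d u)
        (fun z => fderiv ℝ (inCharts (m := m) c d u) z w) (extChartAt (𝓡 n) c p) v)).comp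
        (fderiv ℝ (inCharts (m := m) c d u) (extChartAt (𝓡 n) c p))).toLinearMap.isLinear a
    rw [chartMetric_pullback_eq hg hp hd hu.1, ← hUz]
    refine h1.trans ?_
    have hpull : ∀ᶠ y in 𝓝 (extChartAt (𝓡 n) c p), ∀ v w, chartMetric (pullbackForm n g u) c y v w
        = chartMetric g d (inCharts c d u y) (fderiv ℝ (inCharts (m := m) c d u) y v)
          (fderiv ℝ (inCharts (m := m) c d u) y w) := by
      filter_upwards [eventually_inCharts hu hp hd] with z ⟨q, hq, hdq, hz⟩ v w
      rw [← hz, chartMetric_pullback_eq hg hq hdq hu.1, met,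
        (hg d).mk_apply ((extChartAt (𝓡 m) d).map_source hdq), inCharts_self hq]
    have h2 := gauss_formula (hg d) (hm c) ht (by rw [hUz]; exact htd)
      ((contDiffAt_inCharts hp hd hu.1).of_le (by norm_cast)) hpull v w a
    rw [chr, (hm c).mkChristoffel_apply ht, ← h2, hUz, met]
    exact (hg d).mk_apply htd _ _
  have hgr : ∀ V, met g d (extChartAt (𝓡 m) d (u p)) (dchart d (u p) (rawGradient g f (u p))) V
      = fderiv ℝ (inChart d f) (extChartAt (𝓡 m) d (u p)) V := fun V => by
    rw [← met_gradient hg hf hd, fieldInCharts_self hd]; rfl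
  have h1 := meanCurvature_inCharts hg hu hp hd he
  have h2 := normalPart_inCharts hg hp hd hu (rawGradient g f (u p))
  rw [norPart_eq hon] at h2
  have h3 : (meanCurvature n g u p : Eu m) + normalPart n g u p (rawGradient g f (u p)) = 0 := hmin
  have h4 := congrArg (fun W => met g d (extChartAt (𝓡 m) d (u p)) (dchart d (u p) W) V) h3
  have h5 := (map_add (dchart d (u p)) (meanCurvature n g u p : Eu m)
    (normalPart n g u p (rawGradient g f (u p)) : Eu m)).trans (congrArg₂ (· + ·) h1 h2)
  have h6 := (congrArg (fun W => met g d (extChartAt (𝓡 m) d (u p)) W V) h5).symm.trans h4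
  simp only [hgauss, map_zero, zero_apply, map_add, map_sub, map_sum, add_apply, sub_apply,
    sum_apply, map_smul, smul_apply, smul_eq_mul, hgr] at h6
  have h7 : met g d (extChartAt (𝓡 m) d (u p)) (dchart d (u p) (0 : Eu m)) V = 0 := by
    simp
  refine Eq.trans ?_ (h6.trans h7)
  ring

include hψ hp in
theorem contDiffAt_flow_chart {d : M} (hd : u p ∈ (extChartAt (𝓡 m) d).source) :
    ContDiffAt ℝ ∞ (fun q => extChartAt (𝓡 m) d (flow ψ c q)) (0, extChartAt (𝓡 n) c p) := by
  refine contDiffAt_chart_comp (contMDiffAt_flow hψ hψ.zero_mem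
    ((extChartAt (𝓡 n) c).map_source hp)) ?_
  rwa [flow, (extChartAt (𝓡 n) c).left_inv hp, hψ.initial]

include hψ in
theorem flow_zero (c : S) (y : Eu n) : flow (n := n) ψ c (0, y) = inChart c u y := by
  rw [flow, hψ.initial]; rfl

include hψ hp in
theorem velocity_inCharts {d : M} (hd : u p ∈ (extChartAt (𝓡 m) d).source) :
    fderiv ℝ (fun q => extChartAt (𝓡 m) d (flow ψ c q)) (0, extChartAt (𝓡 n) c p) (1, 0)
      = fieldInCharts c d u T (extChartAt (𝓡 n) c p) := by
  have ht := (extChartAt (𝓡 n) c).map_source hp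
  have h1 : flow (n := n) ψ c (0, extChartAt (𝓡 n) c p) = u p := by
    rw [flow, (extChartAt (𝓡 n) c).left_inv hp, hψ.initial]
  rw [fderiv_chart_comp ((contMDiffAt_flow hψ hψ.zero_mem ht).mdifferentiableAt (by simp))
    (by rw [h1]; exact hd), dmap_flow_time hψ hψ.zero_mem ht, (extChartAt (𝓡 n) c).left_inv hp,
    hψ.dmap_zero, h1]
  exact (fieldInCharts_self (u := u) hp _).symm

include hψ hu hp in
theorem velocity_eventuallyEq {d : M} (hd : u p ∈ (extChartAt (𝓡 m) d).source) :
    fieldInCharts c d u T =ᶠ[𝓝 (extChartAt (𝓡 n) c p)]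
      fun y => fderiv ℝ (fun q => extChartAt (𝓡 m) d (flow ψ c q)) (0, y) (1, 0) := by
  filter_upwards [eventually_inCharts hu hp hd] with z ⟨q, hq, hdq, hz⟩
  rw [← hz, velocity_inCharts hψ hq hdq]

include hψ hu hp in
theorem contDiffAt_velocity {d : M} (hd : u p ∈ (extChartAt (𝓡 m) d).source) :
    ContDiffAt ℝ ∞ (fieldInCharts c d u T) (extChartAt (𝓡 n) c p) := by
  refine ContDiffAt.congr_of_eventuallyEq ?_ (velocity_eventuallyEq hu hψ hp hd)
  exact ContDiffAt.comp (g := fun q => fderiv ℝ (fun q => extChartAt (𝓡 m) d (flow ψ c q)) q (1, 0))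
    _ (contDiffAt_fderiv_apply (contDiffAt_flow_chart hψ hp hd) (1, 0))
    (contDiffAt_const.prodMk contDiffAt_id)

include hψ hg hu hp in
theorem contDiffAt_accelField :
    ContDiffAt ℝ ∞ (fieldInCharts c c id (accelField (n := n) g ψ)) (extChartAt (𝓡 n) c p) := by
  have ht := (extChartAt (𝓡 n) c).map_source hp
  have hm := isMetric_pullback hg hu
  have h1 : fieldInCharts c c id (accelField (n := n) g ψ) =ᶠ[𝓝 (extChartAt (𝓡 n) c p)] fun y =>
      metricTrace (chartMetric (pullbackForm n g u) c y) fun a b =>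
        fderiv ℝ (fun q => formAlong g (flow ψ c) q (1, 0) (0, a)) (0, y) (1, 0) • b := by
    filter_upwards [(isOpen_chart_target c).mem_nhds ht] with y hy
    refine (hm c).eq_of_forall hy fun a => ?_
    rw [accelField_spec hψ hy hg hu, (hm c).riesz hy]
    have hl : IsBil (chartMetric (pullbackForm n g u) c y) := (hm c).bil y hy
    have hfun : chartMetric (pullbackForm n g u) c y
        (fieldInCharts c c id (accelField (n := n) g ψ) y)
        = fun v => fderiv ℝ (fun q => formAlong g (flow ψ c) q (1, 0) (0, v)) (0, y) (1, 0) :=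
      funext fun v => accelField_spec hψ hy hg hu v
    exact hfun ▸ hl.right _
  refine ContDiffAt.congr_of_eventuallyEq ?_ h1
  have h2 : ∀ v, ContDiffAt ℝ ∞ (fun y : Eu n =>
      fderiv ℝ (fun q => formAlong g (flow ψ c) q (1, 0) (0, v)) (0, y) (1, 0))
      (extChartAt (𝓡 n) c p) := fun v => ContDiffAt.comp
    (g := fun q => fderiv ℝ (fun q => formAlong g (flow ψ c) q (1, 0) (0, v)) q (1, 0))
    _ (contDiffAt_fderiv_apply (contDiffAt_formAlong_flow hψ hψ.zero_mem ht hg _ _) (1, 0))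
    (contDiffAt_const.prodMk contDiffAt_id)
  exact contDiffAt_metricTrace (fun i j => (hm c).contDiffAt ht _ _) ((hm c).det_pos ht).ne'
    fun i j => (h2 _).smul contDiffAt_const

end Pointwise

/-! ### The pointwise identity on the manifold. -/

section Pointwise

variable {n m : ℕ} {S : Type*} [TopologicalSpace S] [ChartedSpace (Eu n) S]
  {M : Type*} [TopologicalSpace M] [ChartedSpace (Eu m) M]
  [IsManifold (𝓡 n) ∞ S] [IsManifold (𝓡 m) ∞ M]
  {g : FormField m M} (hg : IsMetric g) {f : M → ℝ} (hf : ContMDiff (𝓡 m) 𝓘(ℝ, ℝ) ∞ f)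
  {u : S → M} (hu : IsSmoothImmersion n m u)
  {T : ∀ p : S, TangentSpace (𝓡 m) (u p)} {ψ : ℝ → S → M} {ε : ℝ} {K : Set S}
  (hψ : IsVariation n u T ψ ε K) {p c : S} (hp : p ∈ (extChartAt (𝓡 n) c).source)

include hg hf hu hψ hp in
/-- The second variation of the density, up to a divergence. -/
theorem deriv_deriv_density (hTn : IsNormal n g u T) (hmin : weightedMeanCurvature n g f u p = 0) :
    deriv (deriv fun t => density g f ψ c t (extChartAt (𝓡 n) c p)) 0
      = ∑ i, fderiv ℝ (fun y => density g f ψ c 0 y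
          * fieldInCharts c c id (accelField (n := n) g ψ) y i) (extChartAt (𝓡 n) c p) (stdVec i)
        - rawForm g (u p) (stabilityOperator n g f u T p) (T p)
          * density g f ψ c 0 (extChartAt (𝓡 n) c p) := by
  obtain ⟨T, rfl⟩ : ∃ T' : S → Eu m, T' = T := ⟨T, rfl⟩
  have hd : u p ∈ (extChartAt (𝓡 m) (u p)).source := mem_extChartAt_source (u p)
  have ht := (extChartAt (𝓡 n) c).map_source hp
  have htd := (extChartAt (𝓡 m) (u p)).map_source hd
  have hm := isMetric_pullback hg hu
  obtain ⟨e, he⟩ := (hm c).exists_frame ht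
  have hon := isON_met hg hp hd hu.1 he
  have hev := eventually_inCharts hu hp hd
  have hT := contDiffAt_velocity hu hψ hp hd
  have hvel := velocity_eventuallyEq hu hψ hp hd
  have hUz := inCharts_self (m := m) (d := u p) (u := u) hp
  have hU := contDiffAt_inCharts hp hd hu.1
  have hΨ := contDiffAt_flow_chart hψ hp hd
  have hX := contDiffAt_accelField hg hu hψ hp
  have hlinQ := fun v => (contDiffAt_normalCov hg hp hd hu hT v).differentiableAt
    (n := ∞) (by simp)
  have hid : ∀ V : Eu m, dchart (k := m) (u p) (u p) V = V := fun V => by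
    rw [dchart_self (k := m)]; rfl
  have hTp : fieldInCharts c (u p) u T (extChartAt (𝓡 n) c p) = T p := by
    rw [fieldInCharts_self hp]; exact hid _
  -- notation
  set z := extChartAt (𝓡 n) c p with hz
  set Ψ : ℝ × Eu n → Eu m := fun q => extChartAt (𝓡 m) (u p) (flow ψ c q) with hΨdef
  set U : Eu n → Eu m := inCharts c (u p) u with hUdef
  set G := met g (u p) with hG
  set Γ := chr g (u p) with hΓ
  have hΨU : ∀ y, Ψ (0, y) = U y := fun y => by
    rw [hΨdef, hUdef]
    simp only [flow_zero hψ]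
    rfl
  have hΨ0 : Ψ (0, z) = extChartAt (𝓡 m) (u p) (u p) := (hΨU z).trans hUz
  have hzero : Filter.Tendsto (fun y : Eu n => ((0 : ℝ), y)) (𝓝 z) (𝓝 (0, z)) :=
    (Continuous.prodMk_right (0 : ℝ)).continuousAt
  have hΨ1 : ∀ᶠ y in 𝓝 z, ContDiffAt ℝ 2 Ψ (0, y) :=
    hzero.eventually ((hΨ.of_le (m := 2) (by norm_cast)).eventually (by simp))
  have hDU : ∀ᶠ y in 𝓝 z, ∀ v, fderiv ℝ Ψ (0, y) (0, v) = fderiv ℝ U y v := by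
    filter_upwards [hΨ1] with y hy v
    rw [← fderiv_comp_zero_prodMk (hy.differentiableAt (by norm_num))]
    simp only [hΨU]
  have hDz := hDU.self_of_nhds
  have hflow : ∀ᶠ q in 𝓝 ((0 : ℝ), z), ContMDiffAt 𝓘(ℝ, ℝ × Eu n) (𝓡 m) 1 (flow ψ c) q ∧
      flow ψ c q ∈ (extChartAt (𝓡 m) (u p)).source ∧ q.1 ∈ Set.Ioo (-ε) ε
      ∧ q.2 ∈ (extChartAt (𝓡 n) c).target := by
    have h0 := contMDiffAt_flow hψ hψ.zero_mem ht
    have h1 : flow (n := n) ψ c (0, z) = u p := by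
      rw [flow_zero hψ, inChart, hz, (extChartAt (𝓡 n) c).left_inv hp]
    have h2 := h0.continuousAt.tendsto
    rw [h1] at h2
    filter_upwards [eventually_contMDiffAt h0, h2 ((isOpen_extChartAt_source (I := 𝓡 m)
      (u p)).mem_nhds hd), (isOpen_Ioo.prod (isOpen_chart_target c)).mem_nhds
        (show ((0 : ℝ), z) ∈ _ from ⟨hψ.zero_mem, ht⟩)] with q h3 h4 h5
    exact ⟨h3, h4, h5.1, h5.2⟩
  have hform : ∀ᶠ q in 𝓝 ((0 : ℝ), z), ∀ a b, formAlong g (flow ψ c) q a b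
      = G (Ψ q) (fderiv ℝ Ψ q a) (fderiv ℝ Ψ q b) := by
    filter_upwards [hflow] with q h1 a b
    rw [formAlong_eq g (h1.1.mdifferentiableAt (by simp)) h1.2.1, hG, met,
      (hg (u p)).mk_apply ((extChartAt (𝓡 m) (u p)).map_source h1.2.1)]
  have hρ : ∀ v, DifferentiableAt ℝ (fun y => tanPart (G (U y)) (fderiv ℝ U y)
      (covAlong Γ U (fieldInCharts c (u p) u T) y v)) z := fun v => by
    refine (contDiffAt_tanPart (r := ∞) (e := e) ?_ (hU.fderiv_right (m := ∞) (by simp)) ?_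
      (by rw [hUz]; exact hon)).differentiableAt (by simp)
    · exact ContDiffAt.comp (g := G) _ ((hg (u p)).contDiffAt_mk (by rw [hUz]; exact htd)) hU
    · exact contDiffAt_covAlong ((hg (u p)).contDiffAt_christoffel (by rw [hUz]; exact htd)) hU hT v
  have htgt : ∀ᶠ y in 𝓝 (Ψ (0, z)), y ∈ (extChartAt (𝓡 m) (u p)).target := by
    rw [hΨ0]; exact (isOpen_chart_target (u p)).mem_nhds htd
  have hΨt : Ψ (0, z) ∈ (extChartAt (𝓡 m) (u p)).target := htgt.self_of_nhds
  have hpull : ∀ᶠ y in 𝓝 z, ∀ v w, met (pullbackForm n g u) c y v w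
      = G (Ψ (0, y)) (fderiv ℝ Ψ (0, y) (0, v)) (fderiv ℝ Ψ (0, y) (0, w)) := by
    filter_upwards [hDU, hev] with y hy ⟨q, hq, hdq, hqz⟩ v w
    rw [hy, hy, hΨU, ← hqz, met, (hm c).mk_apply ((extChartAt (𝓡 n) c).map_source hq),
      chartMetric_pullback_eq hg hq hdq hu.1, hUdef, inCharts_self hq]
  have hgz : ∀ v w, met (pullbackForm n g u) c z v w = chartMetric (pullbackForm n g u) c z v w :=
    fun v w => by rw [met, (hm c).mk_apply ht]
  have hnorm : ∀ᶠ y in 𝓝 z, ∀ v, G (U y) (fieldInCharts c (u p) u T y) (fderiv ℝ U y v) = 0 := by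
    filter_upwards [hev] with y ⟨q, hq, hdq, hqz⟩ v
    rw [← hqz, fieldInCharts_self hq, hUdef, inCharts_self hq, ← dchart_dsymm' hq v,
      fderiv_inCharts hq hdq hu.1, hG, ← rawForm_eq_met hg hdq]
    exact hTn q _
  have hvz : fderiv ℝ Ψ (0, z) (1, 0) = T p := hvel.self_of_nhds.symm.trans hTp
  have hcomp : ∀ {y : Eu n} {W : ℝ × Eu n → Eu m}, DifferentiableAt ℝ Ψ (0, y) →
      DifferentiableAt ℝ W (0, y) → ∀ v,
      covAlong Γ Ψ W (0, y) (0, v) = covAlong Γ U (fun y => W (0, y)) y v := fun h1 h2 v => by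
    have h3 := covAlong_comp (Γ := Γ) (hasFDerivAt_zero_prodMk _) h1 h2 v
    rw [ContinuousLinearMap.inr_apply] at h3
    rw [← h3]
    simp only [hΨU]
  have hΨ2 : ∀ {y : Eu n}, ContDiffAt ℝ 2 Ψ (0, y) → ∀ a,
      DifferentiableAt ℝ (fun q => fderiv ℝ Ψ q a) (0, y) := fun h1 a =>
    ((h1.fderiv_right (m := 1) (by norm_num)).differentiableAt (by norm_num)).clm_apply
      (differentiableAt_const _)
  have hcov : ∀ v w, covAlong Γ Ψ (fun q => fderiv ℝ Ψ q (0, w)) (0, z) (0, v)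
      = covAlong Γ U (fun y => fderiv ℝ U y w) z v := fun v w => by
    rw [hcomp (hΨ1.self_of_nhds.differentiableAt (by norm_num)) (hΨ2 hΨ1.self_of_nhds _)]
    exact covAlong_congr (by filter_upwards [hDU] with y hy using hy w) v
  have hfz : ∀ᶠ q in 𝓝 ((0 : ℝ), z), f (flow ψ c q) = inChart (u p) f (Ψ q) := by
    filter_upwards [hflow] with q hq
    rw [inChart, hΨdef]
    exact congrArg f ((extChartAt (𝓡 m) (u p)).left_inv hq.2.1).symm
  have hden : (fun t => density g f ψ c t z) =ᶠ[𝓝 0] fun t => Real.sqrt (gram fun v w =>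
      G (Ψ (t, z)) (fderiv ℝ Ψ (t, z) (0, v)) (fderiv ℝ Ψ (t, z) (0, w))).det
        * Real.exp (-(inChart (u p) f (Ψ (t, z)))) := by
    have hc : Filter.Tendsto (fun t : ℝ => (t, z)) (𝓝 0) (𝓝 (0, z)) :=
      (Continuous.prodMk_left z).continuousAt
    filter_upwards [hc.eventually hflow, hc.eventually hform, hc.eventually hfz] with t h1 h2 h3
    have h4 : chartMetric (pullbackForm n g (ψ t)) c z = fun v w =>
        G (Ψ (t, z)) (fderiv ℝ Ψ (t, z) (0, v)) (fderiv ℝ Ψ (t, z) (0, w)) := by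
      funext v w
      rw [chartMetric_flow hψ h1.2.2.1 ht, h2]
    rw [density, h4, ← h3]
    rfl
  have hden0 : (fun y => density g f ψ c 0 y) =ᶠ[𝓝 z] fun y => Real.sqrt (gram fun v w =>
      met (pullbackForm n g u) c y v w).det * Real.exp (-(inChart (u p) f (Ψ (0, y)))) := by
    filter_upwards [(isOpen_chart_target c).mem_nhds ht, hzero.eventually hfz] with y h1 h3
    have h4 : chartMetric (pullbackForm n g (ψ 0)) c y = fun v w =>
        met (pullbackForm n g u) c y v w := by
      funext v w
      rw [hψ.initial, met, (hm c).mk_apply h1]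
    rw [density, h4, ← h3]
    rfl
  -- The coordinate identity is applied with `Q` the normal part of `∇T`, with `ρ` the coordinates
  -- of its tangential part, and with `X` dual to the acceleration form.
  have hmain := second_variation_density (G := G) (Γ := Γ) (Ψ := Ψ) (f := inChart (u p) f) (x := z)
    (h := met (pullbackForm n g u) c) (γ := fun v w => chr (pullbackForm n g u) c z v w) (e := e)
    (X := fieldInCharts c c id (accelField (n := n) g ψ)) (Q := normalCov g c (u p) u T)
    (ρ := fun y v => tanPart (G (U y)) (fderiv ℝ U y)
      (covAlong Γ U (fieldInCharts c (u p) u T) y v))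
    ((hg (u p)).contDiffAt_mk hΨt) ((hg (u p)).contDiffAt_christoffel hΨt) hΨ
    (by rw [hΨ0]; exact contDiffAt_inChart_fun hd hf.contMDiffAt)
    (by
      filter_upwards [htgt] with y hy v w
      rw [hG, met, (hg (u p)).mk_apply hy, (hg (u p)).mk_apply hy, (hg (u p)).symm y hy])
    (by
      filter_upwards [htgt] with y hy v w
      rw [hΓ, chr, (hg (u p)).mkChristoffel_apply hy, (hg (u p)).mkChristoffel_apply hy,
        (hg (u p)).christoffel_symm hy])
    (by filter_upwards [htgt] with y hy using (hg (u p)).isCompat hy)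
    (((hm c).contDiffAt_mk ht).of_le (by norm_cast)) hpull
    (fun v w => by
      rw [chr, (hm c).mkChristoffel_apply ht, (hm c).mkChristoffel_apply ht,
        (hm c).christoffel_symm ht])
    ((hm c).isCompat ht)
    (fun i j => (hgz _ _).trans (he i j))
    (by
      filter_upwards [hDU, hnorm, hvel] with y h1 h2 h3 v
      rw [h1, hΨU, ← h3]
      exact h2 v)
    (fun V => by
      have h1 := minimal_inCharts hg hf hu hp hd hmin he (z := z) (U := U) rfl rfl rfl rfl rfl rfl V
      simp only [hcov, hDz, hΨ0]
      exact h1)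
    (hX.differentiableAt (by simp))
    (by
      filter_upwards [(isOpen_chart_target c).mem_nhds ht, hzero.eventually
        hform.eventually_nhds] with y hy hy2 v
      rw [met, (hm c).mk_apply hy, accelField_spec hψ hy hg hu]
      refine congrArg (fun L : ℝ × Eu n →L[ℝ] ℝ => L (1, 0)) (Filter.EventuallyEq.fderiv_eq ?_)
      filter_upwards [hy2] with q hq using hq _ _)
    hlinQ hρ
    (by
      filter_upwards [hΨ1, hDU, hvel.eventually_nhds] with y h1 h2 h3 v
      rw [hcomp (h1.differentiableAt (by norm_num)) (hΨ2 h1 _), h2, normalCov, norPart,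
        covAlong_congr (Filter.EventuallyEq.symm h3)]
      exact (sub_add_cancel _ _).symm)
    (fun v w => by
      rw [hDz, hΨ0]
      exact normalCov_normal hg hp hd hu T v w)
  have hTn' : ∀ w, G (extChartAt (𝓡 m) (u p) (u p)) (T p) (fderiv ℝ U z w) = 0 := fun w => by
    rw [← hTp, ← hUz]
    exact hnorm.self_of_nhds w
  have hin := inner_stabilityOperator hg hu hf hp he hT (z := z) (U := U) rfl rfl rfl rfl rfl rfl
    hTn' (ξ := T p) hTn'
  have hs := met_symm hg hd
  rw [hden.deriv.deriv_eq, hmain, hden0.eq_of_nhds]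
  refine congrArg₂ (· - ·) (Finset.sum_congr rfl fun i _ => ?_) ?_
  · refine congrArg (fun L : Eu n →L[ℝ] ℝ => L (stdVec i)) (Filter.EventuallyEq.fderiv_eq ?_)
    filter_upwards [hden0] with y hy
    rw [hy]
  · congr 1
    simp only [hcov, hDz, hΨ0, hvz]
    refine Eq.trans ?_ hin.symm
    refine congrArg₂ (· + ·) (congrArg₂ (· + ·) (Finset.sum_congr rfl fun i _ => ?_)
      (Finset.sum_congr rfl fun i _ => Finset.sum_congr rfl fun j _ => pow_two _)) rfl
    rw [covAlong, hUz, hs (T p), hs (T p), hs (T p)]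

end Pointwise

/-- The measure `ν + (⨆ i, μ i).restrict Eᶜ` dominates every `μ i`, hence the supremum. Restricting
to `E` removes its second summand. -/
theorem iSup_restrict_le {α ι : Type*} [MeasurableSpace α] {μ : ι → Measure α} {ν : Measure α}
    {E : Set α} (hE : MeasurableSet E) (h : ∀ i, (μ i).restrict E ≤ ν) :
    (⨆ i, μ i).restrict E ≤ ν := by
  have h1 : (⨆ i, μ i) ≤ ν + (⨆ i, μ i).restrict Eᶜ := by
    refine iSup_le fun i => ?_
    rw [← Measure.restrict_add_restrict_compl (μ := μ i) hE]
    exact add_le_add (h i) (Measure.restrict_mono le_rfl (le_iSup μ i))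
  calc (⨆ i, μ i).restrict E ≤ (ν + (⨆ i, μ i).restrict Eᶜ).restrict E :=
        Measure.restrict_mono le_rfl h1
    _ = ν.restrict E := by
        rw [Measure.restrict_add, Measure.restrict_restrict hE, Set.inter_compl_self,
          Measure.restrict_empty, add_zero]
    _ ≤ ν := Measure.restrict_le_self

/-! ### The Riemannian volume measure and integration in charts. -/

section Volume

variable {n : ℕ} {S : Type*} [TopologicalSpace S] [ChartedSpace (Eu n) S]
  [MeasurableSpace S] [BorelSpace S]

theorem measurableSet_chart_preimage (c : S) {B : Set S} (hB : MeasurableSet B) :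
    MeasurableSet ((extChartAt (𝓡 n) c).symm ⁻¹' B ∩ (extChartAt (𝓡 n) c).target) := by
  have h1 : Measurable ((extChartAt (𝓡 n) c).target.domRestrict (extChartAt (𝓡 n) c).symm) :=
    (continuousOn_iff_continuous_domRestrict.1 (continuousOn_extChartAt_symm c)).measurable
  have h2 := (isOpen_chart_target c).measurableSet.subtype_image (h1 hB)
  convert h2 using 1
  ext z
  constructor
  · rintro ⟨h3, h4⟩
    exact ⟨⟨z, h4⟩, h3, rfl⟩
  · rintro ⟨⟨z, hz⟩, h3, rfl⟩
    exact ⟨h3, hz⟩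

theorem aemeasurable_chart_symm (c : S) {A : Set (Eu n)} (hA : A ⊆ (extChartAt (𝓡 n) c).target)
    (hAm : MeasurableSet A) (ρ : Eu n → ENNReal) :
    AEMeasurable (extChartAt (𝓡 n) c).symm ((volume.restrict A).withDensity ρ) :=
  (((continuousOn_extChartAt_symm c).mono hA).aemeasurable hAm).mono_ac
    (withDensity_absolutelyContinuous _ _)

theorem chartVolume_apply (h : FormField n S) (c : S) {B : Set S} (hB : MeasurableSet B) :
    chartVolume h c B = ∫⁻ z in (extChartAt (𝓡 n) c).symm ⁻¹' B ∩ (extChartAt (𝓡 n) c).target,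
      ENNReal.ofReal (Real.sqrt (gram (chartMetric h c z)).det) := by
  have ht := (isOpen_chart_target (k := n) c).measurableSet
  rw [chartVolume, Measure.map_apply_of_aemeasurable (aemeasurable_chart_symm c le_rfl ht _) hB,
    ← restrict_withDensity ht, Measure.restrict_apply' ht,
    withDensity_apply _ (measurableSet_chart_preimage c hB)]

theorem chartVolume_inter_source (h : FormField n S) (c : S) {B : Set S} (hB : MeasurableSet B) :
    chartVolume h c (B ∩ (extChartAt (𝓡 n) c).source) = chartVolume h c B := by
  rw [chartVolume_apply h c hB, chartVolume_apply h c
    (hB.inter (isOpen_extChartAt_source (I := 𝓡 n) c).measurableSet)]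
  congr 2
  ext z
  simp only [Set.mem_inter_iff, Set.mem_preimage]
  exact ⟨fun h => ⟨h.1.1, h.2⟩, fun h => ⟨⟨h.1, (extChartAt (𝓡 n) c).map_target h.2⟩, h.2⟩⟩

/-- Form fields that agree on a set have the same volume there. -/
theorem chartVolume_restrict_congr {h h' : FormField n S} {E : Set S} (hE : MeasurableSet E)
    (hh : ∀ q ∈ E, h q = h' q) (c : S) :
    (chartVolume h c).restrict E = (chartVolume h' c).restrict E := by
  ext B hB
  rw [Measure.restrict_apply hB, Measure.restrict_apply hB, chartVolume_apply _ _ (hB.inter hE),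
    chartVolume_apply _ _ (hB.inter hE)]
  refine setLIntegral_congr_fun (measurableSet_chart_preimage c (hB.inter hE)) fun z hz => ?_
  have h1 : chartMetric h c z = chartMetric h' c z := by
    funext v w
    rw [chartMetric, hh _ hz.1.2, chartMetric]
  simp only [h1]

theorem riemannianVolume_restrict_congr {h h' : FormField n S} {E : Set S} (hE : MeasurableSet E)
    (hh : ∀ q ∈ E, h q = h' q) :
    (riemannianVolume h).restrict E = (riemannianVolume h').restrict E := by
  have key : ∀ h h' : FormField n S, (∀ q ∈ E, h q = h' q) →
      (riemannianVolume h).restrict E ≤ (riemannianVolume h').restrict E := fun h h' hh =>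
    iSup_restrict_le hE fun c => by
      rw [chartVolume_restrict_congr hE hh c]
      exact Measure.restrict_mono le_rfl (le_iSup (chartVolume h') c)
  exact le_antisymm (key h h' hh) (key h' h fun q hq => (hh q hq).symm)

variable [IsManifold (𝓡 n) ∞ S] {h : FormField n S} (hh : ∀ q, IsBil (rawForm h q))

include hh in
/-- The volume densities of two charts agree on the overlap. -/
theorem chartVolume_overlap (c c' : S) {B : Set S} (hB : MeasurableSet B)
    (hc : B ⊆ (extChartAt (𝓡 n) c).source) (hc' : B ⊆ (extChartAt (𝓡 n) c').source) :
    chartVolume h c B = chartVolume h c' B := by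
  rw [chartVolume_apply h c hB, chartVolume_apply h c' hB]
  set A := (extChartAt (𝓡 n) c).symm ⁻¹' B ∩ (extChartAt (𝓡 n) c).target with hA
  set τ : Eu n → Eu n := fun z => extChartAt (𝓡 n) c' ((extChartAt (𝓡 n) c).symm z) with hτ
  have himg : τ '' A = (extChartAt (𝓡 n) c').symm ⁻¹' B ∩ (extChartAt (𝓡 n) c').target := by
    ext y
    constructor
    · rintro ⟨z, hz, rfl⟩
      have h1 := (extChartAt (𝓡 n) c').left_inv (hc' hz.1)
      exact ⟨show (extChartAt (𝓡 n) c').symm (τ z) ∈ B from h1.symm ▸ hz.1,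
        (extChartAt (𝓡 n) c').map_source (hc' hz.1)⟩
    · rintro ⟨h1, h2⟩
      have h3 := (extChartAt (𝓡 n) c).left_inv (hc h1)
      refine ⟨extChartAt (𝓡 n) c ((extChartAt (𝓡 n) c').symm y), ⟨?_, ?_⟩, ?_⟩
      · rw [Set.mem_preimage, h3]; exact h1
      · exact (extChartAt (𝓡 n) c).map_source (hc h1)
      · simp only [hτ, h3, (extChartAt (𝓡 n) c').right_inv h2]
  have hd : ∀ z ∈ A, HasFDerivWithinAt τ (fderiv ℝ τ z) A z := fun z hz =>
    ((contDiffAt_chart_comp (contMDiffAt_symm hz.2) (hc' hz.1)).differentiableAt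
      (by simp)).hasFDerivAt.hasFDerivWithinAt
  have hinj : Set.InjOn τ A := by
    intro z hz y hy hzy
    have h1 := (extChartAt (𝓡 n) c').injOn (hc' hz.1) (hc' hy.1) hzy
    exact (extChartAt (𝓡 n) c).symm.injOn hz.2 hy.2 h1
  -- Change of variables along the transition map. Its Jacobian is absorbed by the transformation of
  -- the Gram determinant.
  rw [← himg, lintegral_image_eq_lintegral_abs_det_fderiv_mul volume
    (measurableSet_chart_preimage c hB) hd hinj]
  refine setLIntegral_congr_fun (measurableSet_chart_preimage c hB) fun z hz => ?_
  have h1 : chartMetric h c z = fun v w => chartMetric h c' (τ z) (fderiv ℝ τ z v) (fderiv ℝ τ z w) := by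
    funext v w
    exact formAlong_eq h (mdifferentiableAt_symm hz.2) (hc' hz.1) v w
  have hbil : IsBil (chartMetric h c' (τ z)) :=
    (hh _).comp (dsymm c' (τ z)).toLinearMap (LinearMap.id (R := ℝ))
  rw [h1, det_gram_comp hbil, Real.sqrt_mul (sq_nonneg _), Real.sqrt_sq_eq_abs,
    ENNReal.ofReal_mul (abs_nonneg _)]

include hh in
-- Another chart measure agrees with that of `c` on the overlap and vanishes outside its own domain.
-- On the domain of `c` the supremum is therefore attained by `c`.
theorem riemannianVolume_restrict (c : S) {E : Set S} (hE : MeasurableSet E)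
    (hc : E ⊆ (extChartAt (𝓡 n) c).source) :
    (riemannianVolume h).restrict E = (chartVolume h c).restrict E := by
  refine le_antisymm (iSup_restrict_le hE fun c' => ?_)
    (Measure.restrict_mono le_rfl (le_iSup (chartVolume h) c))
  refine Measure.le_iff.2 fun B hB => ?_
  have ho := (isOpen_extChartAt_source (I := 𝓡 n) c').measurableSet
  rw [Measure.restrict_apply hB, Measure.restrict_apply hB,
    ← chartVolume_inter_source h c' (hB.inter hE), ← chartVolume_overlap hh c c'
      ((hB.inter hE).inter ho) (fun x hx => hc hx.1.2) fun x hx => hx.2]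
  exact measure_mono Set.inter_subset_left

include hh in
theorem riemannianVolume_restrict_eq_map [T2Space S] {c : S} {E : Set S} (hE : IsCompact E)
    (hc : E ⊆ (extChartAt (𝓡 n) c).source) :
    (riemannianVolume h).restrict E = Measure.map (extChartAt (𝓡 n) c).symm
      ((volume.restrict (extChartAt (𝓡 n) c '' E)).withDensity fun z =>
        ENNReal.ofReal (Real.sqrt (gram (chartMetric h c z)).det)) := by
  have hA : IsCompact (extChartAt (𝓡 n) c '' E) :=
    hE.image_of_continuousOn ((continuousOn_extChartAt c).mono hc)
  have hAt : extChartAt (𝓡 n) c '' E ⊆ (extChartAt (𝓡 n) c).target := by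
    rintro _ ⟨q, hq, rfl⟩
    exact (extChartAt (𝓡 n) c).map_source (hc hq)
  rw [riemannianVolume_restrict hh c hE.measurableSet hc]
  ext B hB
  have hset : (extChartAt (𝓡 n) c).symm ⁻¹' (B ∩ E) ∩ (extChartAt (𝓡 n) c).target
      = (extChartAt (𝓡 n) c).symm ⁻¹' B ∩ extChartAt (𝓡 n) c '' E := by
    ext z
    constructor
    · rintro ⟨h1, h2⟩
      exact ⟨h1.1, _, h1.2, (extChartAt (𝓡 n) c).right_inv h2⟩
    · rintro ⟨h1, q, hq, rfl⟩
      have h3 := (extChartAt (𝓡 n) c).left_inv (hc hq)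
      refine ⟨⟨h1, ?_⟩, (extChartAt (𝓡 n) c).map_source (hc hq)⟩
      rw [h3]; exact hq
  have hm : MeasurableSet ((extChartAt (𝓡 n) c).symm ⁻¹' B ∩ extChartAt (𝓡 n) c '' E) := by
    rw [← hset]
    exact measurableSet_chart_preimage c (hB.inter hE.measurableSet)
  rw [Measure.restrict_apply hB, chartVolume_apply h c (hB.inter hE.measurableSet),
    Measure.map_apply_of_aemeasurable (aemeasurable_chart_symm c hAt hA.measurableSet _) hB,
    ← restrict_withDensity hA.measurableSet, Measure.restrict_apply' hA.measurableSet, hset,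
    withDensity_apply _ hm]

include hh in
/-- Integration over a compact subset of the domain of a chart. -/
theorem integral_chart [T2Space S] [SecondCountableTopology S] {c : S} {E : Set S}
    (hE : IsCompact E) (hc : E ⊆ (extChartAt (𝓡 n) c).source) {F : S → ℝ}
    (hF : ContinuousOn (inChart c F) (extChartAt (𝓡 n) c '' E))
    (hd : ContinuousOn (fun z => Real.sqrt (gram (chartMetric h c z)).det)
      (extChartAt (𝓡 n) c '' E)) :
    IntegrableOn F E (riemannianVolume h) ∧ ∫ q in E, F q ∂(riemannianVolume h)
      = ∫ z in extChartAt (𝓡 n) c '' E, inChart c F z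
        * Real.sqrt (gram (chartMetric h c z)).det := by
  have hA : IsCompact (extChartAt (𝓡 n) c '' E) :=
    hE.image_of_continuousOn ((continuousOn_extChartAt c).mono hc)
  have hAt : extChartAt (𝓡 n) c '' E ⊆ (extChartAt (𝓡 n) c).target := by
    rintro _ ⟨q, hq, rfl⟩
    exact (extChartAt (𝓡 n) c).map_source (hc hq)
  have hFE : ContinuousOn F E := by
    have h1 := hF.comp ((continuousOn_extChartAt c).mono hc) (Set.mapsTo_image _ _)
    refine h1.congr fun q hq => ?_
    simp only [Function.comp, inChart, (extChartAt (𝓡 n) c).left_inv (hc hq)]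
  have hFm := hFE.aestronglyMeasurable (μ := riemannianVolume h) hE.measurableSet
  have hρ : AEMeasurable (fun z => ENNReal.ofReal (Real.sqrt (gram (chartMetric h c z)).det))
      (volume.restrict (extChartAt (𝓡 n) c '' E)) :=
    (hd.aemeasurable hA.measurableSet).ennreal_ofReal
  have hs := aemeasurable_chart_symm c hAt hA.measurableSet
    fun z => ENNReal.ofReal (Real.sqrt (gram (chartMetric h c z)).det)
  have hmap := riemannianVolume_restrict_eq_map hh hE hc
  have hcongr : (fun z => (ENNReal.ofReal (Real.sqrt (gram (chartMetric h c z)).det)).toReal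
      • inChart c F z) = fun z => inChart c F z * Real.sqrt (gram (chartMetric h c z)).det := by
    funext z
    rw [ENNReal.toReal_ofReal (Real.sqrt_nonneg _), smul_eq_mul, mul_comm]
  rw [hmap] at hFm
  constructor
  · rw [IntegrableOn, hmap, integrable_map_measure hFm hs,
      integrable_withDensity_iff_integrable_smul₀' hρ (Filter.Eventually.of_forall fun _ =>
        ENNReal.ofReal_lt_top)]
    have h2 : IntegrableOn (fun z => inChart c F z * Real.sqrt (gram (chartMetric h c z)).det)
      (extChartAt (𝓡 n) c '' E) := (hF.mul hd).integrableOn_compact hA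
    rw [← hcongr] at h2
    exact h2
  · rw [hmap, integral_map hs hFm, integral_withDensity_eq_integral_toReal_smul₀ hρ
      (Filter.Eventually.of_forall fun _ => ENNReal.ofReal_lt_top)]
    exact congrArg (fun G => ∫ z in extChartAt (𝓡 n) c '' E, G z) hcongr

end Volume

/-! ### Differentiation under an integral over a compact set. -/

section Parametric

variable {d : ℕ} {μ : Measure (Eu d)} [IsFiniteMeasureOnCompacts μ] {A : Set (Eu d)} (hA : IsCompact A)

include hA in
/-- Differentiation of an integral over a compact set with respect to a parameter. -/
theorem hasDerivAt_integral_compact {W : ℝ × Eu d → ℝ} {a b t : ℝ} (ht : t ∈ Set.Ioo a b)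
    (hW : ∀ s ∈ Set.Ioo a b, ∀ z ∈ A, ContDiffAt ℝ 1 W (s, z)) :
    HasDerivAt (fun s => ∫ z in A, W (s, z) ∂μ) (∫ z in A, fderiv ℝ W (t, z) (1, 0) ∂μ) t := by
  -- A closed interval around `t` times `A` is compact, so the time derivative is bounded there by a
  -- constant, which is integrable on `A`.
  obtain ⟨r, hr, hrs⟩ := Metric.nhds_basis_closedBall.mem_iff.1 (Ioo_mem_nhds ht.1 ht.2)
  have hcont : ∀ s ∈ Set.Ioo a b, ContinuousOn (fun z => W (s, z)) A := fun s hs z hz =>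
    (ContinuousAt.comp (f := fun z => (s, z)) (hW s hs z hz).continuousAt
      (by fun_prop)).continuousWithinAt
  have hder : ∀ s ∈ Set.Ioo a b, ∀ z ∈ A,
      ContinuousAt (fun q : ℝ × Eu d => fderiv ℝ W q (1, 0)) (s, z) := fun s hs z hz =>
    (((hW s hs z hz).fderiv_right (m := 0) (by norm_num)).clm_apply
      contDiffAt_const).continuousAt
  have hcont' : ContinuousOn (fun q : ℝ × Eu d => fderiv ℝ W q (1, 0))
      (Metric.closedBall t r ×ˢ A) := fun q hq =>
    (hder q.1 (hrs hq.1) q.2 hq.2).continuousWithinAt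
  obtain ⟨C, hC⟩ := ((isCompact_closedBall t r).prod hA).exists_bound_of_continuousOn hcont'
  have hAm := hA.measurableSet
  refine (hasDerivAt_integral_of_dominated_loc_of_deriv_le (F := fun s z => W (s, z))
    (F' := fun s z => fderiv ℝ W (s, z) (1, 0)) (bound := fun _ => C)
    (Metric.closedBall_mem_nhds t hr) ?_ ((hcont t ht).integrableOn_compact hA) ?_ ?_ ?_ ?_).2
  · filter_upwards [Ioo_mem_nhds ht.1 ht.2] with s hs
    exact (hcont s hs).aestronglyMeasurable hAm
  · refine ContinuousOn.aestronglyMeasurable (fun z hz => ?_) hAm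
    exact (ContinuousAt.comp (f := fun z => (t, z)) (hder t ht z hz)
      (by fun_prop)).continuousWithinAt
  · filter_upwards [ae_restrict_mem hAm] with z hz s hs
    exact hC (s, z) ⟨hs, hz⟩
  · exact integrableOn_const hA.measure_ne_top
  · filter_upwards [ae_restrict_mem hAm] with z hz s hs
    have h1 := ((hW s (hrs hs) z hz).differentiableAt one_ne_zero).hasFDerivAt
    exact h1.comp_hasDerivAt s ((hasDerivAt_id s).prodMk (hasDerivAt_const s z))

include hA in
-- Induction on `k`, replacing `W` by its time derivative. One derivative more than in the
-- conclusion is assumed because continuity, too, is deduced from differentiation under the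
-- integral.
theorem contDiffOn_integral_compact {a b : ℝ} (k : ℕ) : ∀ {W : ℝ × Eu d → ℝ},
    (∀ s ∈ Set.Ioo a b, ∀ z ∈ A, ContDiffAt ℝ (k + 1) W (s, z)) →
    ContDiffOn ℝ k (fun s => ∫ z in A, W (s, z) ∂μ) (Set.Ioo a b) := by
  induction k with
  | zero =>
    intro W hW
    refine contDiffOn_zero.2 fun t ht => (hasDerivAt_integral_compact hA ht fun s hs z hz =>
      (hW s hs z hz).of_le (by simp)).continuousAt.continuousWithinAt
  | succ k ih =>
    intro W hW
    have hd : ∀ t ∈ Set.Ioo a b, HasDerivAt (fun s => ∫ z in A, W (s, z) ∂μ)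
        (∫ z in A, fderiv ℝ W (t, z) (1, 0) ∂μ) t := fun t ht =>
      hasDerivAt_integral_compact hA ht fun s hs z hz => (hW s hs z hz).of_le (by simp)
    push_cast
    refine (contDiffOn_succ_iff_deriv_of_isOpen isOpen_Ioo).2
      ⟨fun t ht => (hd t ht).differentiableAt.differentiableWithinAt, by simp, ?_⟩
    refine (ih (W := fun q => fderiv ℝ W q (1, 0)) fun s hs z hz => ?_).congr fun t ht =>
      (hd t ht).deriv
    exact ((hW s hs z hz).fderiv_right (by push_cast; exact le_rfl)).clm_apply contDiffAt_const

include hA in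
-- For finite `k` the points where `W` is `C^k` form an open set, so the tube lemma provides one
-- time interval for all of the compact set `A`.
theorem exists_Ioo_contDiffAt {W : ℝ × Eu d → ℝ} (hW : ∀ z ∈ A, ContDiffAt ℝ ∞ W (0, z)) (k : ℕ) :
    ∃ δ > 0, ∀ s ∈ Set.Ioo (-δ) δ, ∀ z ∈ A, ContDiffAt ℝ k W (s, z) := by
  have ho : IsOpen {q : ℝ × Eu d | ContDiffAt ℝ k W q} :=
    isOpen_iff_mem_nhds.2 fun q hq => ContDiffAt.eventually (n := (k : WithTop ℕ∞)) hq (by simp)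
  obtain ⟨U, V, hU, -, h0, hV, hUV⟩ := generalized_tube_lemma (isCompact_singleton (x := (0 : ℝ)))
    hA ho (by
      rintro ⟨s, z⟩ ⟨hs, hz⟩
      obtain rfl : s = 0 := hs
      exact (hW z hz).of_le (WithTop.coe_le_coe.2 le_top))
  obtain ⟨δ, hδ, hδU⟩ := Metric.isOpen_iff.1 hU 0 (h0 rfl)
  refine ⟨δ, hδ, fun s hs z hz => hUV ⟨hδU ?_, hV hz⟩⟩
  rw [Real.ball_eq_Ioo]
  simpa using hs

include hA in
/-- The second derivative of an integral over a compact set with respect to a parameter. -/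
theorem second_deriv_integral_compact {W : ℝ × Eu d → ℝ}
    (hW : ∀ z ∈ A, ContDiffAt ℝ ∞ W (0, z)) :
    ContDiffAt ℝ 2 (fun s => ∫ z in A, W (s, z) ∂μ) 0 ∧
    iteratedDeriv 2 (fun s => ∫ z in A, W (s, z) ∂μ) 0
      = ∫ z in A, deriv (deriv fun s => W (s, z)) 0 ∂μ := by
  -- Two derivatives for the conclusion and one to spare for differentiation under the integral.
  obtain ⟨δ, hδ, h3⟩ := exists_Ioo_contDiffAt hA hW 3
  have h0 : (0 : ℝ) ∈ Set.Ioo (-δ) δ := ⟨neg_lt_zero.2 hδ, hδ⟩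
  have hn : Set.Ioo (-δ) δ ∈ 𝓝 (0 : ℝ) := Ioo_mem_nhds h0.1 h0.2
  refine ⟨(contDiffOn_integral_compact hA 2 fun s hs z hz => ?_).contDiffAt hn, ?_⟩
  · have := h3 s hs z hz
    norm_num at this ⊢
    exact this
  · have h1 : deriv (fun s => ∫ z in A, W (s, z) ∂μ)
        =ᶠ[𝓝 0] fun t => ∫ z in A, fderiv ℝ W (t, z) (1, 0) ∂μ := by
      filter_upwards [hn] with t ht
      exact (hasDerivAt_integral_compact hA ht fun s hs z hz =>
        (h3 s hs z hz).of_le (by norm_num)).deriv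
    have h2 := hasDerivAt_integral_compact (μ := μ) hA (W := fun q => fderiv ℝ W q (1, 0)) h0
      fun s hs z hz => ((h3 s hs z hz).fderiv_right (m := 1) (by norm_num)).clm_apply
        contDiffAt_const
    rw [iteratedDeriv_succ, iteratedDeriv_one, h1.deriv_eq, h2.deriv]
    exact setIntegral_congr_fun hA.measurableSet fun z hz =>
      (deriv_deriv_prodMk_right (hW z hz)).symm

end Parametric

/-! ### Integration by parts in `ℝᵏ`. -/

section Divergence

variable {k : ℕ}

/-- The integral of the divergence of a compactly supported vector field vanishes. -/
theorem integral_divergence_eq_zero {Y : Eu k → Eu k} (hY : ContDiff ℝ 1 Y)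
    (hs : HasCompactSupport Y) :
    ∫ z, ∑ i, fderiv ℝ (fun y => Y y i) z (stdVec i) = 0 := by
  have hc : ∀ i, ContDiff ℝ 1 fun y => Y y i := fun i => by fun_prop
  have hsi : ∀ i, HasCompactSupport fun y => Y y i := fun i =>
    hs.comp_left (g := fun v : Eu k => v i) rfl
  have hint : ∀ i, Integrable fun z => fderiv ℝ (fun y => Y y i) z (stdVec i) := fun i =>
    (((hc i).continuous_fderiv one_ne_zero).clm_apply continuous_const).integrable_of_hasCompactSupport
      ((hsi i).fderiv_apply ℝ _)
  rw [integral_finsetSum _ fun i _ => hint i]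
  refine Finset.sum_eq_zero fun i _ => ?_
  -- Integration by parts against the constant function `1`, one coordinate at a time.
  have h1 := integral_mul_fderiv_eq_neg_fderiv_mul_of_integrable (μ := volume)
    (f := fun _ : Eu k => (1 : ℝ)) (g := fun y => Y y i) (v := stdVec i) (by simp)
    (by simpa using hint i)
    (by simpa using (hc i).continuous.integrable_of_hasCompactSupport (hsi i)) (by simp)
    (fun x _ => ((hc i).differentiable one_ne_zero) x)
  simpa using h1

end Divergence

/-- Integration by parts on a compact part `A` of an open set, for a vector field `ρ Z` that
vanishes outside `A`. -/
theorem integral_mul_divergence {k : ℕ} {O A : Set (Eu k)} (hO : IsOpen O) (hA : IsCompact A)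
    (hAO : A ⊆ O) {ρ : Eu k → ℝ} {Z : Eu k → Eu k} (hρ : ∀ z ∈ O, ContDiffAt ℝ ∞ ρ z)
    (hZ : ∀ z ∈ O, ContDiffAt ℝ ∞ Z z) (h0 : ∀ z ∈ O, z ∉ A → ρ z • Z z = 0) :
    ∫ z in A, ρ z * ∑ i, fderiv ℝ (fun y => Z y i) z (stdVec i)
      = -∫ z in A, fderiv ℝ ρ z (Z z) := by
  classical
  -- Extension of `ρ Z` by zero. Near a point of `A` it equals `ρ Z`, and near a point outside the
  -- closed set `A` it is zero. It is thus `C¹` without any regularity of the boundary of `A`.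
  set Y : Eu k → Eu k := fun z => if z ∈ O then ρ z • Z z else 0 with hYdef
  have hY1 : ∀ z ∈ O, Y =ᶠ[𝓝 z] fun y => ρ y • Z y := fun z hz => by
    filter_upwards [hO.mem_nhds hz] with y hy
    simp [hYdef, hy]
  have hYz : ∀ z ∉ A, Y z = 0 := fun z hz => by
    by_cases hzO : z ∈ O
    · simp [hYdef, hzO, h0 z hzO hz]
    · simp [hYdef, hzO]
  have hY2 : ∀ z ∉ A, Y =ᶠ[𝓝 z] fun _ => 0 := fun z hz => by
    filter_upwards [hA.isClosed.isOpen_compl.mem_nhds hz] with y hy using hYz y hy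
  have hY : ContDiff ℝ 1 Y := contDiff_iff_contDiffAt.2 fun z => by
    by_cases hz : z ∈ A
    · exact (((hρ z (hAO hz)).smul (hZ z (hAO hz))).of_le (by norm_cast)).congr_of_eventuallyEq
        (hY1 z (hAO hz))
    · exact contDiffAt_const.congr_of_eventuallyEq (hY2 z hz)
  have h1 := integral_divergence_eq_zero hY (HasCompactSupport.intro hA hYz)
  have h2 : ∀ z ∉ A, ∑ i, fderiv ℝ (fun y => Y y i) z (stdVec i) = 0 := fun z hz =>
    Finset.sum_eq_zero fun i _ => by
      have : (fun y => Y y i) =ᶠ[𝓝 z] fun _ => 0 := by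
        filter_upwards [hY2 z hz] with y hy
        rw [hy]; rfl
      rw [this.fderiv_eq]
      simp
  rw [← setIntegral_eq_integral_of_forall_compl_eq_zero h2] at h1
  have hZi : ∀ z ∈ O, ∀ i, ContDiffAt ℝ ∞ (fun y => Z y i) z := fun z hz i => by
    have := hZ z hz
    fun_prop
  have h3 : ∀ z ∈ A, ∑ i, fderiv ℝ (fun y => Y y i) z (stdVec i)
      = ρ z * ∑ i, fderiv ℝ (fun y => Z y i) z (stdVec i) + fderiv ℝ ρ z (Z z) := by
    intro z hz
    have hd := (hρ z (hAO hz)).differentiableAt (by simp)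
    have hi : ∀ i, fderiv ℝ (fun y => Y y i) z (stdVec i)
        = ρ z * fderiv ℝ (fun y => Z y i) z (stdVec i) + Z z i * fderiv ℝ ρ z (stdVec i) := by
      intro i
      have : (fun y => Y y i) =ᶠ[𝓝 z] fun y => ρ y * Z y i := by
        filter_upwards [hY1 z (hAO hz)] with y hy
        rw [hy]; rfl
      rw [this.fderiv_eq, fderiv_fun_mul hd ((hZi z (hAO hz) i).differentiableAt (by simp))]
      rfl
    simp only [hi, Finset.sum_add_distrib, ← Finset.mul_sum]
    congr 1
    conv_rhs => rw [eq_sum_stdVec (Z z), map_sum]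
    simp
  have hc1 : ContinuousOn (fun z => ρ z * ∑ i, fderiv ℝ (fun y => Z y i) z (stdVec i)) A :=
    fun z hz => by
      refine ContinuousAt.continuousWithinAt ((hρ z (hAO hz)).continuousAt.mul ?_)
      exact tendsto_finsetSum _ fun i _ =>
        (contDiffAt_fderiv_apply (hZi z (hAO hz) i) (stdVec i)).continuousAt
  have hc2 : ContinuousOn (fun z => fderiv ℝ ρ z (Z z)) A := fun z hz =>
    (((hρ z (hAO hz)).fderiv_right (m := ∞) (by simp)).clm_apply
      (hZ z (hAO hz))).continuousAt.continuousWithinAt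
  rw [setIntegral_congr_fun hA.measurableSet h3,
    integral_add (hc1.integrableOn_compact hA) (hc2.integrableOn_compact hA)] at h1
  linarith

/-! ### Partitions of unity and the divergence theorem on the manifold. -/

section Partition

variable {n : ℕ} {S : Type*} [TopologicalSpace S] [ChartedSpace (Eu n) S]

/-- A finite smooth partition of unity on `K`, subordinate to the charts. -/
structure ChartPartition (n : ℕ) {S : Type*} [TopologicalSpace S] [ChartedSpace (Eu n) S]
    (K : Set S) where
  index : Finset S
  fn : S → S → ℝ
  smooth : ∀ c, ContMDiff (𝓡 n) 𝓘(ℝ, ℝ) ∞ (fn c)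
  support : ∀ c, tsupport (fn c) ⊆ (extChartAt (𝓡 n) c).source
  sum_eq_one : ∀ q ∈ K, ∑ c ∈ index, fn c q = 1
  sum_le_one : ∀ q, ∑ c ∈ index, fn c q ≤ 1

/-- By local finiteness only finitely many functions of a subordinate partition meet the compact set
`K`. Nonnegativity keeps the sum of these at most `1` everywhere. -/
theorem exists_chartPartition [IsManifold (𝓡 n) ∞ S] [T2Space S] [SecondCountableTopology S]
    {K : Set S} (hK : IsCompact K) : Nonempty (ChartPartition n K) := by
  have : LocallyCompactSpace S := ChartedSpace.locallyCompactSpace (Eu n) S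
  obtain ⟨ρ, hρ⟩ := SmoothPartitionOfUnity.exists_isSubordinate (𝓡 n) hK.isClosed
    (fun c : S => (extChartAt (𝓡 n) c).source) (fun c => isOpen_extChartAt_source c)
    fun q _ => Set.mem_iUnion.2 ⟨q, mem_extChartAt_source q⟩
  have hfin := ρ.locallyFinite.finite_nonempty_inter_compact hK
  refine ⟨⟨hfin.toFinset, fun c => ρ c, fun c => (ρ c).contMDiff, hρ, fun q hq => ?_,
    fun q => ?_⟩⟩
  · rw [← ρ.sum_eq_one hq, finsum_eq_sum_of_support_subset]
    intro c hc
    simpa using ⟨q, hc, hq⟩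
  · refine le_trans ?_ (ρ.sum_le_one q)
    have h1 := ρ.locallyFinite.point_finite q
    have h2 : ∑ᶠ c, ρ c q = ∑ c ∈ h1.toFinset, ρ c q :=
      finsum_eq_sum_of_support_subset _ fun c hc => by simpa using hc
    rw [h2, ← Finset.sum_filter_ne_zero]
    refine Finset.sum_le_sum_of_subset_of_nonneg (fun c hc => ?_) fun c _ _ => ρ.nonneg c q
    simpa using (Finset.mem_filter.1 hc).2

namespace ChartPartition

variable {K : Set S} (P : ChartPartition n K)

/-- The part of `K` that meets the support of the function of the chart around `c`. -/
def part (c : S) : Set S := K ∩ tsupport (P.fn c)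

/-- The image of `part` in the chart. -/
def image (c : S) : Set (Eu n) := extChartAt (𝓡 n) c '' P.part c

theorem part_subset_left (c : S) : P.part c ⊆ K := Set.inter_subset_left

theorem part_subset (c : S) : P.part c ⊆ (extChartAt (𝓡 n) c).source :=
  Set.inter_subset_right.trans (P.support c)

theorem image_subset (c : S) : P.image c ⊆ (extChartAt (𝓡 n) c).target := by
  rintro _ ⟨q, hq, rfl⟩
  exact (extChartAt (𝓡 n) c).map_source (P.part_subset c hq)

theorem fn_eq_zero {c q : S} (hK : q ∈ K) (hq : q ∉ P.part c) : P.fn c q = 0 :=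
  image_eq_zero_of_notMem_tsupport fun h => hq ⟨hK, h⟩

theorem mem_image {c : S} {z : Eu n} (hz : z ∈ (extChartAt (𝓡 n) c).target) :
    z ∈ P.image c ↔ (extChartAt (𝓡 n) c).symm z ∈ P.part c := by
  constructor
  · rintro ⟨q, hq, rfl⟩
    rwa [(extChartAt (𝓡 n) c).left_inv (P.part_subset c hq)]
  · exact fun h => ⟨_, h, (extChartAt (𝓡 n) c).right_inv hz⟩

variable (hK : IsCompact K)

include hK in
theorem isCompact_part (c : S) : IsCompact (P.part c) := hK.inter_right (isClosed_tsupport _)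

include hK in
theorem isCompact_image (c : S) : IsCompact (P.image c) :=
  (P.isCompact_part hK c).image_of_continuousOn
    ((continuousOn_extChartAt c).mono (P.part_subset c))

variable [IsManifold (𝓡 n) ∞ S]

theorem contDiffAt_fn {c : S} {z : Eu n} (hz : z ∈ (extChartAt (𝓡 n) c).target) :
    ContDiffAt ℝ ∞ (inChart c (P.fn c)) z := by
  have h := contDiffAt_inChart_fun ((extChartAt (𝓡 n) c).map_target hz)
    (P.smooth c).contMDiffAt
  rwa [(extChartAt (𝓡 n) c).right_inv hz] at h

/-- The differentials of the functions of the partition cancel on `K`. -/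
theorem sum_dirDeriv {q : S} (hq : q ∈ K) (X : Eu n) :
    ∑ c ∈ P.index, dirDeriv (k := n) (P.fn c) q X = 0 := by
  have hx := mem_extChartAt_source (I := 𝓡 n) q
  have hd : ∀ c, DifferentiableAt ℝ (inChart q (P.fn c)) (extChartAt (𝓡 n) q q) := fun c =>
    (contDiffAt_inChart_fun hx (P.smooth c).contMDiffAt).differentiableAt (by simp)
  -- Off `K` the finite sum need not be `1`, so at a boundary point of `K` it may fail to be locally
  -- constant. But it attains its upper bound `1` there, which still makes its differential vanish.
  have hmax : IsLocalMax (fun z => ∑ c ∈ P.index, inChart q (P.fn c) z)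
      (extChartAt (𝓡 n) q q) := by
    refine Filter.Eventually.of_forall fun z => (P.sum_le_one _).trans ?_
    simp only [inChart, (extChartAt (𝓡 n) q).left_inv hx, P.sum_eq_one q hq, le_refl]
  have h1 := hmax.fderiv_eq_zero
  rw [fderiv_fun_sum fun c _ => hd c] at h1
  have h2 := congrArg (fun L : Eu n →L[ℝ] ℝ => L (dchart q q X)) h1
  rw [← (show _ = (0 : ℝ) from h2.trans rfl)]
  simp only [sum_apply]
  exact Finset.sum_congr rfl fun c _ =>
    (fderiv_inChart_fun hx ((P.smooth c).mdifferentiableAt (by simp)) X).symm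

variable [T2Space S] [SecondCountableTopology S] [MeasurableSpace S] [BorelSpace S]
  {h : FormField n S} (hh : ∀ q, IsBil (rawForm h q))

include hK hh in
/-- Integration over `K` by means of a partition of unity. -/
theorem integral_eq_sum {F : S → ℝ}
    (hF : ∀ c ∈ P.index, ContinuousOn (inChart c F) (P.image c))
    (hd : ∀ c ∈ P.index, ContinuousOn (fun z => Real.sqrt (gram (chartMetric h c z)).det)
      (P.image c)) :
    IntegrableOn F K (riemannianVolume h) ∧ ∫ q in K, F q ∂(riemannianVolume h)
      = ∑ c ∈ P.index, ∫ z in P.image c, inChart c (P.fn c) z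
        * (inChart c F z * Real.sqrt (gram (chartMetric h c z)).det) := by
  have hKm := hK.isClosed.measurableSet
  have hz : ∀ c, ∀ q ∈ K \ P.part c, P.fn c q * F q = 0 := fun c q hq => by
    rw [P.fn_eq_zero hq.1 hq.2, zero_mul]
  have h1 : ∀ c ∈ P.index, IntegrableOn (fun q => P.fn c q * F q) K (riemannianVolume h) ∧
      ∫ q in K, P.fn c q * F q ∂(riemannianVolume h) = ∫ z in P.image c, inChart c (P.fn c) z
        * (inChart c F z * Real.sqrt (gram (chartMetric h c z)).det) := fun c hc => by
    have hcont : ContinuousOn (inChart c (P.fn c)) (P.image c) := fun z hz =>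
      (P.contDiffAt_fn (P.image_subset c hz)).continuousAt.continuousWithinAt
    obtain ⟨h2, h3⟩ := integral_chart hh (P.isCompact_part hK c) (P.part_subset c)
      (F := fun q => P.fn c q * F q) (hcont.mul (hF c hc)) (hd c hc)
    refine ⟨h2.of_forall_sdiff_eq_zero hKm (hz c), ?_⟩
    rw [setIntegral_eq_of_subset_of_forall_sdiff_eq_zero hKm (P.part_subset_left c) (hz c), h3]
    exact integral_congr_ae (Filter.Eventually.of_forall fun z => mul_assoc _ _ _)
  have h4 : ∀ q ∈ K, ∑ c ∈ P.index, P.fn c q * F q = F q := fun q hq => by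
    rw [← Finset.sum_mul, P.sum_eq_one q hq, one_mul]
  constructor
  · exact IntegrableOn.congr_fun (integrable_finsetSum _ fun c hc => (h1 c hc).1) h4 hKm
  · rw [← setIntegral_congr_fun hKm h4, integral_finsetSum _ fun c hc => (h1 c hc).1]
    exact Finset.sum_congr rfl fun c hc => (h1 c hc).2

include hK hh in
/-- The divergence theorem, for a vector field `X` that vanishes outside `K`. -/
theorem sum_integral_divergence {η : S → ℝ} {X : S → Eu n} (hX : ∀ q ∉ K, X q = 0)
    (hXc : ∀ c, ∀ z ∈ (extChartAt (𝓡 n) c).target, ContDiffAt ℝ ∞ (fieldInCharts c c id X) z)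
    (hw : ∀ c, ∀ z ∈ (extChartAt (𝓡 n) c).target, ContDiffAt ℝ ∞
      (fun y => Real.sqrt (gram (chartMetric h c y)).det * inChart c η y) z)
    (hη : ∀ c, ∀ z ∈ (extChartAt (𝓡 n) c).target, ContinuousAt (inChart c η) z)
    (hd : ∀ c, ∀ z ∈ (extChartAt (𝓡 n) c).target,
      ContinuousAt (fun z => Real.sqrt (gram (chartMetric h c z)).det) z) :
    ∑ c ∈ P.index, ∫ z in P.image c, inChart c (P.fn c) z
      * ∑ i, fderiv ℝ (fun y => Real.sqrt (gram (chartMetric h c y)).det * inChart c η y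
        * fieldInCharts c c id X y i) z (stdVec i) = 0 := by
  have hKm := hK.isClosed.measurableSet
  have hX0 : ∀ (c : S) (z : Eu n), (extChartAt (𝓡 n) c).symm z ∉ K →
      fieldInCharts c c id X z = 0 := fun c z hz => by
    rw [fieldInCharts, hX _ hz, map_zero]
  -- integration by parts in a chart
  have h1 : ∀ c, ∫ z in P.image c, inChart c (P.fn c) z
      * ∑ i, fderiv ℝ (fun y => Real.sqrt (gram (chartMetric h c y)).det * inChart c η y
        * fieldInCharts c c id X y i) z (stdVec i)
      = -∫ z in P.image c, fderiv ℝ (inChart c (P.fn c)) z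
        ((Real.sqrt (gram (chartMetric h c z)).det * inChart c η z)
          • fieldInCharts c c id X z) := fun c => by
    refine integral_mul_divergence (isOpen_chart_target c) (P.isCompact_image hK c)
      (P.image_subset c) (fun z hz => P.contDiffAt_fn hz)
      (Z := fun y => (Real.sqrt (gram (chartMetric h c y)).det * inChart c η y)
          • fieldInCharts c c id X y) (fun z hz => (hw c z hz).smul (hXc c z hz))
      fun z hz hzA => ?_
    by_cases hzK : (extChartAt (𝓡 n) c).symm z ∈ K
    · rw [inChart, P.fn_eq_zero hzK fun h => hzA ((P.mem_image hz).2 h), zero_smul]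
    · rw [hX0 c z hzK, smul_zero, smul_zero]
  -- back to the manifold
  have hz : ∀ c, ∀ q ∈ K \ P.part c, dirDeriv (k := n) (P.fn c) q (X q) * η q = 0 :=
    fun c q hq => by
      have h2 : P.fn c =ᶠ[𝓝 q] fun _ => (0 : ℝ) :=
        notMem_tsupport_iff_eventuallyEq.1 fun h => hq.2 ⟨hq.1, h⟩
      have h3 : mfderiv (𝓡 n) 𝓘(ℝ, ℝ) (P.fn c) q = 0 := h2.mfderiv_eq.trans mfderiv_const
      exact (congrArg (fun L : Eu n →L[ℝ] ℝ => L (X q) * η q) h3).trans (zero_mul _)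
  have h3 : ∀ c, IntegrableOn (fun q => dirDeriv (k := n) (P.fn c) q (X q) * η q) K
      (riemannianVolume h) ∧ ∫ z in P.image c, fderiv ℝ (inChart c (P.fn c)) z
        ((Real.sqrt (gram (chartMetric h c z)).det * inChart c η z) • fieldInCharts c c id X z)
      = ∫ q in K, dirDeriv (k := n) (P.fn c) q (X q) * η q ∂(riemannianVolume h) := fun c => by
    have h4 : ∀ z ∈ (extChartAt (𝓡 n) c).target,
        inChart c (fun q => dirDeriv (k := n) (P.fn c) q (X q) * η q) z
          = fderiv ℝ (inChart c (P.fn c)) z (fieldInCharts c c id X z) * inChart c η z :=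
      fun z hz => by
        have h5 := fderiv_inChart_fun ((extChartAt (𝓡 n) c).map_target hz)
          ((P.smooth c).mdifferentiableAt (by simp)) (X ((extChartAt (𝓡 n) c).symm z))
        rw [(extChartAt (𝓡 n) c).right_inv hz] at h5
        exact congrArg (· * inChart c η z) h5.symm
    have h6 : ContinuousOn (inChart c fun q => dirDeriv (k := n) (P.fn c) q (X q) * η q)
        (P.image c) := by
      refine ContinuousOn.congr (fun z hz => ContinuousAt.continuousWithinAt ?_)
        fun z hz => h4 z (P.image_subset c hz)
      have hzt := P.image_subset c hz
      exact (((P.contDiffAt_fn hzt).fderiv_right (m := ∞) (by simp)).clm_apply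
        (hXc c z hzt)).continuousAt.mul (hη c z hzt)
    obtain ⟨h7, h8⟩ := integral_chart hh (P.isCompact_part hK c) (P.part_subset c) h6
      fun z hz => (hd c z (P.image_subset c hz)).continuousWithinAt
    refine ⟨h7.of_forall_sdiff_eq_zero hKm (hz c), ?_⟩
    rw [setIntegral_eq_of_subset_of_forall_sdiff_eq_zero hKm (P.part_subset_left c) (hz c), h8]
    refine setIntegral_congr_fun (P.isCompact_image hK c).measurableSet fun z hz => ?_
    rw [h4 z (P.image_subset c hz), map_smul, smul_eq_mul]
    ring
  simp only [h1, fun c => (h3 c).2]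
  -- Back on `K` the chart terms add up to one integral of `(∑ dρ_c)(X)`, whose integrand vanishes
  -- pointwise.
  rw [Finset.sum_neg_distrib, ← integral_finsetSum _ fun c _ => (h3 c).1, neg_eq_zero]
  refine setIntegral_eq_zero_of_forall_eq_zero fun q hq => ?_
  rw [← Finset.sum_mul, P.sum_dirDeriv hq, zero_mul]

end ChartPartition

end Partition

/-! ### The weighted volume of a variation as a function of time. -/

section Volume

variable {n m : ℕ} {S : Type*} [TopologicalSpace S] [ChartedSpace (Eu n) S]
  {M : Type*} [TopologicalSpace M] [ChartedSpace (Eu m) M]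
  [IsManifold (𝓡 n) ∞ S] [IsManifold (𝓡 m) ∞ M]
  {u : S → M} {T : ∀ p : S, TangentSpace (𝓡 m) (u p)} {ψ : ℝ → S → M} {ε : ℝ} {K : Set S}
  (hψ : IsVariation n u T ψ ε K) {c : S} {t : ℝ} (ht : t ∈ Set.Ioo (-ε) ε) {z : Eu n}
  (hz : z ∈ (extChartAt (𝓡 n) c).target)
  {g : FormField m M} (hg : IsMetric g) {f : M → ℝ} (hf : ContMDiff (𝓡 m) 𝓘(ℝ, ℝ) ∞ f)
  (hu : IsSmoothImmersion n m u)

include hψ ht hz hg in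
theorem contDiffAt_det_flow : ContDiffAt ℝ ∞
    (fun q : ℝ × Eu n => (gram (chartMetric (pullbackForm n g (ψ q.1)) c q.2)).det) (t, z) := by
  refine ContDiffAt.congr_of_eventuallyEq (f := fun q : ℝ × Eu n =>
    (gram fun v w => formAlong g (flow ψ c) q (0, v) (0, w)).det) ?_ ?_
  · exact contDiffAt_matrix_det fun i j =>
      contDiffAt_formAlong_flow hψ ht hz hg (0, stdVec i) (0, stdVec j)
  · filter_upwards [(isOpen_Ioo.prod (isOpen_chart_target c)).mem_nhds
      (show (t, z) ∈ _ from ⟨ht, hz⟩)] with q hq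
    have h1 : chartMetric (pullbackForm n g (ψ q.1)) c q.2
        = fun v w => formAlong g (flow ψ c) q (0, v) (0, w) :=
      funext fun v => funext fun w => chartMetric_flow hψ hq.1 hq.2 g v w
    rw [h1]

include hψ ht hz hg in
theorem continuousAt_sqrt_det_flow : ContinuousAt
    (fun y => Real.sqrt (gram (chartMetric (pullbackForm n g (ψ t)) c y)).det) z :=
  (ContinuousAt.comp (f := fun y : Eu n => (t, y)) (contDiffAt_det_flow hψ ht hz hg).continuousAt
    (by fun_prop)).sqrt

include hψ ht hz hf in
theorem contDiffAt_exp_flow :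
    ContDiffAt ℝ ∞ (fun q : ℝ × Eu n => Real.exp (-f (flow ψ c q))) (t, z) := by
  have h1 : ContDiffAt ℝ ∞ (fun q => f (flow ψ c q)) (t, z) := contMDiffAt_iff_contDiffAt.1
    (ContMDiffAt.comp (g := f) (t, z) hf.contMDiffAt (contMDiffAt_flow hψ ht hz))
  exact h1.neg.exp

include hψ ht hz hf in
theorem continuousAt_exp_flow : ContinuousAt (inChart c fun q => Real.exp (-f (ψ t q))) z :=
  ContinuousAt.comp (f := fun y : Eu n => (t, y)) (contDiffAt_exp_flow hψ ht hz hf).continuousAt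
    (by fun_prop)

include hψ hz hg hu in
theorem det_flow_pos : 0 < (gram (chartMetric (pullbackForm n g (ψ 0)) c z)).det := by
  rw [hψ.initial]
  exact (isMetric_pullback hg hu c).det_pos hz

include hψ hz hg hf hu in
-- The square root is smooth where the determinant is positive. This is known at `t = 0`, since `ψ
-- 0` is an immersion, and points of `{0} × target` are all that is needed.
theorem contDiffAt_density :
    ContDiffAt ℝ ∞ (fun q : ℝ × Eu n => density g f ψ c q.1 q.2) (0, z) :=
  ((contDiffAt_det_flow hψ hψ.zero_mem hz hg).sqrt (det_flow_pos hψ hz hg hu).ne').mul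
    (contDiffAt_exp_flow hψ hψ.zero_mem hz hf)

include hψ in
theorem IsVariation.dmap_time_eq_zero {q : S} (hq : q ∉ K) (ht : t ∈ Set.Ioo (-ε) ε) (s : ℝ) :
    dmap (k := m) (fun t => ψ t q) t s = 0 := by
  have h1 : (fun t => ψ t q) =ᶠ[𝓝 t] fun _ => u q := by
    filter_upwards [isOpen_Ioo.mem_nhds ht] with t ht using hψ.support t ht q hq
  have h2 : mfderiv 𝓘(ℝ, ℝ) (𝓡 m) (fun t => ψ t q) t = 0 := h1.mfderiv_eq.trans mfderiv_const
  exact congrArg (fun L : ℝ →L[ℝ] Eu m => L s) h2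

include hψ in
theorem IsVariation.velocity_eq_zero {q : S} (hq : q ∉ K) : T q = (0 : Eu m) :=
  (hψ.dmap_zero q).symm.trans (hψ.dmap_time_eq_zero hq hψ.zero_mem 1)

include hψ hg in
-- A point outside `K` does not move, so its velocity vanishes for all small times. This provides
-- the support condition for the divergence theorem.
theorem accelField_eq_zero {q : S} (hq : q ∉ K) : accelField (n := n) g ψ q = 0 := by
  have h1 : ∀ X : Eu n, accelForm g ψ q X = 0 := fun X => by
    have h2 : (fun t => rawForm g (ψ t q) (dmap (fun t => ψ t q) t (1 : ℝ)) (tmap (ψ t) q X))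
        =ᶠ[𝓝 0] fun _ => (0 : ℝ) := by
      filter_upwards [isOpen_Ioo.mem_nhds hψ.zero_mem] with t ht
      rw [hψ.dmap_time_eq_zero hq ht, ((hg.isBil _).left _).map_zero]
    rw [accelForm, h2.deriv_eq, deriv_const]
  simp [accelField, metricTrace, h1]

variable [T2Space S] [SecondCountableTopology S] [MeasurableSpace S] [BorelSpace S]

include hψ hg hf ht in
-- No immersion property of `ψ t` is used: bilinearity of the pulled back form and continuity of
-- `√det` suffice, so the formula holds on the whole time interval.
theorem integral_exp_flow (P : ChartPartition n K) :
    IntegrableOn (fun q => Real.exp (-f (ψ t q))) K (riemannianVolume (pullbackForm n g (ψ t))) ∧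
    ∫ q in K, Real.exp (-f (ψ t q)) ∂(riemannianVolume (pullbackForm n g (ψ t)))
      = ∑ c ∈ P.index, ∫ z in P.image c, inChart c (P.fn c) z * density g f ψ c t z := by
  obtain ⟨h1, h2⟩ := P.integral_eq_sum hψ.compact (isBil_pullback hg (ψ t))
    (F := fun q => Real.exp (-f (ψ t q)))
    (fun c _ z hz => (continuousAt_exp_flow hψ ht (P.image_subset c hz) hf).continuousWithinAt)
    (fun c _ z hz =>
      (continuousAt_sqrt_det_flow hψ ht (P.image_subset c hz) hg).continuousWithinAt)
  refine ⟨h1, h2.trans (Finset.sum_congr rfl fun c _ => ?_)⟩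
  refine integral_congr_ae (Filter.Eventually.of_forall fun z => ?_)
  exact congrArg (inChart c (P.fn c) z * ·) (mul_comm _ _)

include hψ ht in
-- The complement of the compact set `K` is open, so `ψ t` and `ψ 0` agree near `q` and have the
-- same derivative there.
theorem pullbackForm_eq_of_notMem {q : S} (hq : q ∉ K) :
    pullbackForm n g (ψ t) q = pullbackForm n g (ψ 0) q := by
  have h1 : ψ t =ᶠ[𝓝 q] ψ 0 := by
    filter_upwards [hψ.compact.isClosed.isOpen_compl.mem_nhds hq] with x hx
    rw [hψ.support t ht x hx, hψ.initial]
  have h2 : tmap (n := n) (m := m) (ψ t) q = tmap (ψ 0) q := h1.mfderiv_eq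
  funext X Y
  change rawForm g (ψ t q) (tmap (ψ t) q X) (tmap (ψ t) q Y)
    = rawForm g (ψ 0 q) (tmap (ψ 0) q X) (tmap (ψ 0) q Y)
  rw [h2, h1.eq_of_nhds]

include hψ hg hf ht in
/-- The weighted volume of a variation is the sum of a constant and the volume over `K`. -/
theorem weightedVolume_eq (P : ChartPartition n K) {D : Set S} (hD : MeasurableSet D)
    (hKD : K ⊆ D) :
    weightedVolume n g f (ψ t) D = weightedVolume n g f (ψ 0) (D \ K)
      + ENNReal.ofReal (∑ c ∈ P.index, ∫ z in P.image c, inChart c (P.fn c) z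
          * density g f ψ c t z) := by
  have hKm := hψ.compact.isClosed.measurableSet
  obtain ⟨h1, h2⟩ := integral_exp_flow hψ ht hg hf P
  have hoff : weightedVolume n g f (ψ t) (D \ K) = weightedVolume n g f (ψ 0) (D \ K) := by
    have h3 := riemannianVolume_restrict_congr (hD.diff hKm) (h := pullbackForm n g (ψ t))
      (h' := pullbackForm n g (ψ 0)) fun q hq => pullbackForm_eq_of_notMem hψ ht hq.2
    rw [weightedVolume, weightedVolume, h3]
    refine setLIntegral_congr_fun (hD.diff hKm) fun q hq => ?_
    have h4 : ψ t q = ψ 0 q := by rw [hψ.support t ht q hq.2, hψ.initial]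
    exact congrArg (fun x => ENNReal.ofReal (Real.exp (-f x))) h4
  have hon : weightedVolume n g f (ψ t) K = ENNReal.ofReal
      (∫ q in K, Real.exp (-f (ψ t q)) ∂(riemannianVolume (pullbackForm n g (ψ t)))) :=
    (ofReal_integral_eq_lintegral_ofReal h1
      (Filter.Eventually.of_forall fun q => (Real.exp_pos _).le)).symm
  have hsplit := lintegral_inter_add_sdiff (μ := riemannianVolume (pullbackForm n g (ψ t)))
    (fun q => ENNReal.ofReal (Real.exp (-f (ψ t q)))) D hKm
  rw [Set.inter_eq_right.2 hKD] at hsplit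
  rw [← hoff, ← h2, ← hon, add_comm]
  exact hsplit.symm

include hψ hg hf hu in
/-- The second derivative of the weighted volume in terms of the densities. -/
theorem hasSecondVariation_of_density (P : ChartPartition n K) : HasSecondVariation n g f ψ K
    (∑ c ∈ P.index, ∫ z in P.image c, inChart c (P.fn c) z
      * deriv (deriv fun t => density g f ψ c t z) 0) := by
  intro D hD hKD hfin
  set I : ℝ → ℝ := fun t => ∑ c ∈ P.index, ∫ z in P.image c, inChart c (P.fn c) z
      * density g f ψ c t z with hI
  have h0 := weightedVolume_eq hψ hψ.zero_mem hg hf P hD hKD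
  have hfin' : weightedVolume n g f (ψ 0) (D \ K) < ⊤ := by
    rw [h0] at hfin
    exact (ENNReal.add_lt_top.1 hfin).1
  have hev : ∀ᶠ t in 𝓝 (0 : ℝ), t ∈ Set.Ioo (-ε) ε := isOpen_Ioo.mem_nhds hψ.zero_mem
  have heq : (fun t => (weightedVolume n g f (ψ t) D).toReal)
      =ᶠ[𝓝 0] fun t => (weightedVolume n g f (ψ 0) (D \ K)).toReal + I t := by
    filter_upwards [hev] with t ht
    have hpos : 0 ≤ I t := by
      refine le_of_le_of_eq ?_ (integral_exp_flow hψ ht hg hf P).2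
      exact integral_nonneg fun q => (Real.exp_pos _).le
    rw [weightedVolume_eq hψ ht hg hf P hD hKD, ENNReal.toReal_add hfin'.ne ENNReal.ofReal_ne_top,
      ENNReal.toReal_ofReal hpos]
  have hW : ∀ c, ∀ z ∈ P.image c, ContDiffAt ℝ ∞
      (fun q : ℝ × Eu n => inChart c (P.fn c) q.2 * density g f ψ c q.1 q.2) (0, z) :=
    fun c z hz => (ContDiffAt.comp (g := inChart c (P.fn c)) ((0 : ℝ), z)
      (P.contDiffAt_fn (P.image_subset c hz)) contDiffAt_snd).mul
        (contDiffAt_density hψ (P.image_subset c hz) hg hf hu)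
  have h2 := fun c => second_deriv_integral_compact (μ := volume)
    (P.isCompact_image hψ.compact c) (hW c)
  refine ⟨?_, ?_, ?_⟩
  · filter_upwards [hev] with t ht
    rw [weightedVolume_eq hψ ht hg hf P hD hKD]
    exact ENNReal.add_lt_top.2 ⟨hfin', ENNReal.ofReal_lt_top⟩
  · exact (contDiffAt_const.add (ContDiffAt.sum fun c _ => (h2 c).1)).congr_of_eventuallyEq heq
  · rw [heq.iteratedDeriv_eq, iteratedDeriv_const_add two_pos]
    refine (iteratedDeriv_fun_sum fun c _ => (h2 c).1).trans ?_
    refine Finset.sum_congr rfl fun c _ => (h2 c).2.trans ?_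
    simp only [deriv_const_mul_field', deriv_const_mul_field]

end Volume

/-! ### The second variation formula. -/

section SecondVariation

variable {n m : ℕ} {S : Type*} [TopologicalSpace S] [ChartedSpace (Eu n) S]
  {M : Type*} [TopologicalSpace M] [ChartedSpace (Eu m) M]
  [IsManifold (𝓡 n) ∞ S] [IsManifold (𝓡 m) ∞ M]
  [T2Space S] [SecondCountableTopology S] [MeasurableSpace S] [BorelSpace S]
  {u : S → M} {T : ∀ p : S, TangentSpace (𝓡 m) (u p)} {ψ : ℝ → S → M} {ε : ℝ} {K : Set S}
  (hψ : IsVariation n u T ψ ε K)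
  {g : FormField m M} (hg : IsMetric g) {f : M → ℝ} (hf : ContMDiff (𝓡 m) 𝓘(ℝ, ℝ) ∞ f)
  (hu : IsSmoothImmersion n m u) (hTn : IsNormal n g u T) (hmin : IsFMinimal n g f u)

include hψ hg hf hu hTn hmin in
/-- The second variation formula for the weighted volume of an `f`-minimal immersion. -/
theorem second_variation :
    Integrable (fun p => g (u p) (T p) (stabilityOperator n g f u T p) * Real.exp (-f (u p)))
      (riemannianVolume (pullbackForm n g u)) ∧
    HasSecondVariation n g f ψ K
      (-∫ p, g (u p) (T p) (stabilityOperator n g f u T p) * Real.exp (-f (u p))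
        ∂(riemannianVolume (pullbackForm n g u))) := by
  obtain ⟨P⟩ := exists_chartPartition (n := n) hψ.compact
  have hKm := hψ.compact.isClosed.measurableSet
  set Q : S → ℝ := fun p => rawForm g (u p) (stabilityOperator n g f u T p) (T p) with hQ
  set w : S → Eu n → ℝ := fun c z => density g f ψ c 0 z with hw
  set X : S → Eu n := accelField g ψ with hX
  set div : S → Eu n → ℝ := fun c z =>
    ∑ i, fderiv ℝ (fun y => w c y * fieldInCharts c c id X y i) z (stdVec i) with hdiv
  have hpt : ∀ c, ∀ z ∈ (extChartAt (𝓡 n) c).target,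
      deriv (deriv fun t => density g f ψ c t z) 0 = div c z - inChart c Q z * w c z :=
    fun c z hz => by
      have h1 := deriv_deriv_density hg hf hu hψ ((extChartAt (𝓡 n) c).map_target hz) hTn (hmin _)
      rw [(extChartAt (𝓡 n) c).right_inv hz] at h1
      exact h1
  have hXs : ∀ c, ∀ z ∈ (extChartAt (𝓡 n) c).target,
      ContDiffAt ℝ ∞ (fieldInCharts c c id X) z := fun c z hz => by
    have h1 := contDiffAt_accelField hg hu hψ ((extChartAt (𝓡 n) c).map_target hz)
    rwa [(extChartAt (𝓡 n) c).right_inv hz] at h1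
  have hws : ∀ c, ∀ z ∈ (extChartAt (𝓡 n) c).target, ContDiffAt ℝ ∞ (w c) z := fun c z hz =>
    ContDiffAt.comp (g := fun q : ℝ × Eu n => density g f ψ c q.1 q.2) z
      (contDiffAt_density hψ hz hg hf hu) (contDiffAt_const.prodMk contDiffAt_id)
  have hdivc : ∀ c, ∀ z ∈ (extChartAt (𝓡 n) c).target, ContinuousAt (div c) z := fun c z hz => by
    refine tendsto_finsetSum _ fun i _ => ?_
    have h1 := hXs c z hz
    exact (contDiffAt_fderiv_apply ((hws c z hz).mul (by fun_prop)) (stdVec i)).continuousAt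
  have hddc : ∀ c, ∀ z ∈ (extChartAt (𝓡 n) c).target,
      ContinuousAt (fun z => deriv (deriv fun t => density g f ψ c t z) 0) z := fun c z hz => by
    have h1 := contDiffAt_density hψ hz hg hf hu
    have h2 := ContinuousAt.comp (f := fun y : Eu n => ((0 : ℝ), y)) (x := z)
      (contDiffAt_fderiv_apply (contDiffAt_fderiv_apply h1 (1, 0)) (1, 0)).continuousAt
      (by fun_prop)
    refine h2.congr ?_
    filter_upwards [(isOpen_chart_target c).mem_nhds hz] with y hy
    exact (deriv_deriv_prodMk_right (contDiffAt_density hψ hy hg hf hu)).symm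
  have hwpos : ∀ c, ∀ z ∈ (extChartAt (𝓡 n) c).target, 0 < w c z := fun c z hz =>
    mul_pos (Real.sqrt_pos.2 (det_flow_pos hψ hz hg hu)) (Real.exp_pos _)
  -- Continuity of `⟨L_f T, T⟩` is not read off from the definition of `L_f`. The pointwise identity
  -- expresses it as `(div - ∂ₜ² w) / w`, with continuous terms and `w > 0`.
  have hQc : ∀ c, ∀ z ∈ (extChartAt (𝓡 n) c).target, ContinuousAt (inChart c Q) z :=
    fun c z hz => by
      refine (((hdivc c z hz).sub (hddc c z hz)).div (hws c z hz).continuousAt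
        (hwpos c z hz).ne').congr ?_
      filter_upwards [(isOpen_chart_target c).mem_nhds hz] with y hy
      simp only [Pi.div_apply, Pi.sub_apply, hpt c y hy]
      have := (hwpos c y hy).ne'
      field_simp
      ring
  -- the integral of the stability form
  obtain ⟨h1, h2⟩ := P.integral_eq_sum hψ.compact (isBil_pullback hg (ψ 0))
    (F := fun p => Q p * Real.exp (-f (ψ 0 p)))
    (fun c _ z hz => ContinuousAt.continuousWithinAt ((hQc c z (P.image_subset c hz)).mul
      (continuousAt_exp_flow hψ hψ.zero_mem (P.image_subset c hz) hf)))
    (fun c _ z hz => (continuousAt_sqrt_det_flow hψ hψ.zero_mem (P.image_subset c hz)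
      hg).continuousWithinAt)
  -- the divergence theorem
  have h3 := P.sum_integral_divergence hψ.compact (isBil_pullback hg (ψ 0))
    (η := fun p => Real.exp (-f (ψ 0 p))) (X := X) (fun q hq => accelField_eq_zero hψ hg hq) hXs hws
    (fun c z hz => continuousAt_exp_flow hψ hψ.zero_mem hz hf)
    (fun c z hz => continuousAt_sqrt_det_flow hψ hψ.zero_mem hz hg)
  have h4 : ∑ c ∈ P.index, ∫ z in P.image c, inChart c (P.fn c) z
      * deriv (deriv fun t => density g f ψ c t z) 0
      = -∫ p in K, Q p * Real.exp (-f (ψ 0 p)) ∂(riemannianVolume (pullbackForm n g (ψ 0))) := by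
    -- By the pointwise identity, the difference of the two sides is the sum of the integrals of
    -- `ρ_c div(w X)`, which `h3` evaluates to zero.
    rw [h2, eq_neg_iff_add_eq_zero, ← Finset.sum_add_distrib]
    refine Eq.trans (Finset.sum_congr rfl fun c _ => ?_) h3
    have hA := P.isCompact_image hψ.compact c
    have hρ : ContinuousOn (inChart c (P.fn c)) (P.image c) := fun z hz =>
      (P.contDiffAt_fn (P.image_subset c hz)).continuousAt.continuousWithinAt
    rw [← integral_add]
    · refine setIntegral_congr_fun hA.measurableSet fun z hz => ?_
      have h5 : inChart c (fun p => Q p * Real.exp (-f (ψ 0 p))) z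
          * Real.sqrt (gram (chartMetric (pullbackForm n g (ψ 0)) c z)).det
          = inChart c Q z * w c z := by
        change Q _ * Real.exp _ * Real.sqrt _ = Q _ * (Real.sqrt _ * Real.exp _)
        ring
      change inChart c (P.fn c) z * deriv (deriv fun t => density g f ψ c t z) 0
        + inChart c (P.fn c) z * (inChart c (fun p => Q p * Real.exp (-f (ψ 0 p))) z
          * Real.sqrt (gram (chartMetric (pullbackForm n g (ψ 0)) c z)).det)
        = inChart c (P.fn c) z * div c z
      rw [h5, hpt c z (P.image_subset c hz)]
      ring
    · exact (hρ.mul fun z hz =>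
        (hddc c z (P.image_subset c hz)).continuousWithinAt).integrableOn_compact hA
    · refine (hρ.mul fun z hz => ContinuousAt.continuousWithinAt ?_).integrableOn_compact hA
      have hzt := P.image_subset c hz
      exact ((hQc c z hzt).mul (continuousAt_exp_flow hψ hψ.zero_mem hzt hf)).mul
        (continuousAt_sqrt_det_flow hψ hψ.zero_mem hzt hg)
  rw [hψ.initial] at h1 h4
  have hsymm : ∀ p, g (u p) (T p) (stabilityOperator n g f u T p) = Q p := fun p =>
    hg.symm (u p) _ _
  -- The velocity `T` vanishes off `K`, so both the integral and the integrability over `Σ` reduce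
  -- to `K`.
  have hoff : ∀ p ∉ K, Q p * Real.exp (-f (u p)) = 0 := fun p hp => by
    have h5 : Q p = 0 :=
      (congrArg (rawForm g (u p) (stabilityOperator n g f u T p)) (hψ.velocity_eq_zero hp)).trans
        ((hg.isBil _).right _).map_zero
    rw [h5, zero_mul]
  simp only [hsymm]
  refine ⟨(integrableOn_iff_integrable_of_support_subset fun p hp => ?_).1 h1, ?_⟩
  · by_contra hpK
    exact hp (hoff p hpK)
  · rw [← setIntegral_eq_integral_of_forall_compl_eq_zero hoff, ← h4]
    exact hasSecondVariation_of_density hψ hg hf hu P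

end SecondVariation

/-! ### Normality of the stability operator. -/

section Normal

variable {n m : ℕ} {S : Type*} [TopologicalSpace S] [ChartedSpace (Eu n) S]
  {M : Type*} [TopologicalSpace M] [ChartedSpace (Eu m) M]
  [IsManifold (𝓡 n) ∞ S] [IsManifold (𝓡 m) ∞ M]
  {g : FormField m M} (hg : IsMetric g) {u : S → M} (hu : IsSmoothImmersion n m u)
  {f : M → ℝ} (hf : ContMDiff (𝓡 m) 𝓘(ℝ, ℝ) ∞ f) {p c : S} {d : M}
  (hp : p ∈ (extChartAt (𝓡 n) c).source) (hd : u p ∈ (extChartAt (𝓡 m) d).source)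
  {e : Fin n → Eu n}
  (he : IsON (chartMetric (pullbackForm n g u) c (extChartAt (𝓡 n) c p)) e)

include hg hu hp hd he in
theorem secondForm_normal (v w a : Eu n) : met g d (extChartAt (𝓡 m) d (u p))
    (secondForm g c d u (extChartAt (𝓡 n) c p) v w)
    (fderiv ℝ (inCharts (m := m) c d u) (extChartAt (𝓡 n) c p) a) = 0 := by
  have hon := isON_met hg hp hd hu.1 he
  rw [secondForm, inCharts_self (d := d) (u := u) hp]
  exact norPart_normal hon _ _

include hg hu hp hd he in
theorem normalHess_normal (W : S → Eu m) (v w a : Eu n) : met g d (extChartAt (𝓡 m) d (u p))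
    (normalHess g c d u W (extChartAt (𝓡 n) c p) v w)
    (fderiv ℝ (inCharts (m := m) c d u) (extChartAt (𝓡 n) c p) a) = 0 := by
  have hon := isON_met hg hp hd hu.1 he
  rw [normalHess, inCharts_self (d := d) (u := u) hp, map_sub, sub_apply,
    normalCov_normal hg hp hd hu, sub_zero]
  exact norPart_normal hon _ _

include hg hu hf hp he in
/-- The stability operator takes values in the normal bundle. -/
theorem stabilityOperator_normal {T : S → Eu m}
    (hT : ContDiffAt ℝ ∞ (fieldInCharts c (u p) u T) (extChartAt (𝓡 n) c p)) (w : Eu n) :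
    met g (u p) (extChartAt (𝓡 m) (u p) (u p)) (stabilityOperator n g f u T p)
      (fderiv ℝ (inCharts (m := m) c (u p) u) (extChartAt (𝓡 n) c p) w) = 0 := by
  have hd : u p ∈ (extChartAt (𝓡 m) (u p)).source := mem_extChartAt_source (u p)
  have hon := isON_met hg hp hd hu.1 he
  have hid : ∀ V : Eu m, dchart (k := m) (u p) (u p) V = V := fun V => by
    rw [dchart_self (k := m)]; rfl
  have h1 := (hid _).symm.trans (weightedNormalLaplacian_inCharts hg hu hf hp hd he hT)
  have h2 := (hid _).symm.trans (curvatureTerm_inCharts hg hu hp he (T p))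
  have h3 := (hid _).symm.trans (secondFundamentalTerm_inCharts hg hu hp hd he (T p))
  have h4 := (hid _).symm.trans (normalPart_inCharts hg hp hd hu (hessian g f (u p) (T p)))
  have hmap := fun {a b : Eu m} (h : a = b) =>
    congrArg (fun V => met g (u p) (extChartAt (𝓡 m) (u p) (u p)) V
      (fderiv ℝ (inCharts (m := m) c (u p) u) (extChartAt (𝓡 n) c p) w)) h
  have key : ∀ a b c' e' : Eu m, ∀ L : Eu m →L[ℝ] ℝ, L (a + b + c' + e')
      = L a + L b + L c' + L e' := fun a b c' e' L => by simp only [map_add]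
  refine (key _ _ _ _ ((met g (u p) (extChartAt (𝓡 m) (u p) (u p))).flip
      (fderiv ℝ (inCharts (m := m) c (u p) u) (extChartAt (𝓡 n) c p) w))).trans
    ((congrArg₂ (· + ·) (congrArg₂ (· + ·) (congrArg₂ (· + ·) (hmap h1)
    (hmap h2)) (hmap h3)) (hmap h4)).trans ?_)
  simp only [map_sub, map_sum, sub_apply, sum_apply, map_smul, smul_apply,
    normalHess_normal hg hu hp hd he, normalCov_normal hg hp hd hu, norPart_normal hon,
    secondForm_normal hg hu hp hd he]
  simp

end Normal

/-! ### Linear algebra in codimension one. -/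

section LinearAlgebra

variable {n : ℕ} {B : Eu (n + 1) →L[ℝ] Eu (n + 1) →L[ℝ] ℝ} {A : Eu n →L[ℝ] Eu (n + 1)}
  {e : Fin n → Eu n} {ν : Eu (n + 1)} (he : IsON (fun v w => B (A v) (A w)) e)
  (hs : ∀ v w, B v w = B w v) (hν : ∀ w, B ν (A w) = 0) (hν1 : B ν ν = 1)

include he hs hν hν1 in
theorem isON_snoc : IsON (fun v w => B v w)
    (Fin.snoc (α := fun _ => Eu (n + 1)) (fun i => A (e i)) ν) := by
  intro i j
  refine Fin.lastCases ?_ (fun i => ?_) i <;> refine Fin.lastCases ?_ (fun j => ?_) j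
  · simp [hν1]
  · simp [hν, (Fin.castSucc_lt_last j).ne']
  · simp [hs _ ν, hν, (Fin.castSucc_lt_last i).ne]
  · simpa [Fin.castSucc_inj] using he i j

include he hs hν hν1 in
/-- Normal vectors of a hypersurface are multiples of the unit normal. -/
theorem eq_smul_of_normal {W : Eu (n + 1)} (hW : ∀ w, B W (A w) = 0) : W = B W ν • ν := by
  conv_lhs => rw [(isON_snoc he hs hν hν1).expand (isBil_clm B) W]
  rw [Fin.sum_univ_castSucc]
  simp [hs _ W, hW]

end LinearAlgebra

/-! ### Derivatives of the unit normal and of `φν`. -/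

section Hypersurface

variable {n : ℕ} {S : Type*} [TopologicalSpace S] [ChartedSpace (Eu n) S]
  {M : Type*} [TopologicalSpace M] [ChartedSpace (Eu (n + 1)) M]
  [IsManifold (𝓡 n) ∞ S] [IsManifold (𝓡 (n + 1)) ∞ M]
  {g : FormField (n + 1) M} (hg : IsMetric g) {u : S → M} (hu : IsSmoothImmersion n (n + 1) u)
  {f : M → ℝ} (hf : ContMDiff (𝓡 (n + 1)) 𝓘(ℝ, ℝ) ∞ f)
  {ν : S → Eu (n + 1)} (hνn : IsNormal n g u ν) (hν1 : ∀ p, rawForm g (u p) (ν p) (ν p) = 1)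
  {φ : S → ℝ} (hφ : ContMDiff (𝓡 n) 𝓘(ℝ, ℝ) ∞ φ)
  {p c : S} {d : M}
  (hp : p ∈ (extChartAt (𝓡 n) c).source) (hd : u p ∈ (extChartAt (𝓡 (n + 1)) d).source)
  (hν : ContDiffAt ℝ ∞ (fieldInCharts c d u ν) (extChartAt (𝓡 n) c p))

include hg hνn hu hp hd in
theorem unitNormal_normal (w : Eu n) : met g d (extChartAt (𝓡 (n + 1)) d (u p))
    (fieldInCharts c d u ν (extChartAt (𝓡 n) c p))
    (fderiv ℝ (inCharts (m := n + 1) c d u) (extChartAt (𝓡 n) c p) w) = 0 := by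
  rw [fieldInCharts_self hp, ← dchart_dsymm' hp w, fderiv_inCharts hp hd hu.1,
    ← rawForm_eq_met hg hd]
  exact hνn p _

include hg hν1 hp hd in
theorem unitNormal_unit : met g d (extChartAt (𝓡 (n + 1)) d (u p))
    (fieldInCharts c d u ν (extChartAt (𝓡 n) c p))
    (fieldInCharts c d u ν (extChartAt (𝓡 n) c p)) = 1 := by
  rw [fieldInCharts_self hp, ← rawForm_eq_met hg hd, hν1]

include hg hu hν1 hp hd hν in
-- Differentiate `⟨ν, ν⟩ = 1`, which holds on a neighbourhood.
theorem covAlong_unitNormal (v : Eu n) : met g d (extChartAt (𝓡 (n + 1)) d (u p))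
    (covAlong (chr g d) (inCharts c d u) (fieldInCharts c d u ν) (extChartAt (𝓡 n) c p) v)
    (fieldInCharts c d u ν (extChartAt (𝓡 n) c p)) = 0 := by
  have htd := (extChartAt (𝓡 (n + 1)) d).map_source hd
  have hUz := inCharts_self (m := n + 1) (d := d) (u := u) hp
  have hU := contDiffAt_inCharts hp hd hu.1
  have hd1 := hν.differentiableAt (by simp)
  have h1 := fderiv_metric (G := met g d) (Γ := chr g d) (z := extChartAt (𝓡 n) c p)
    (Ψ := inCharts (m := n + 1) c d u)
    (by rw [hUz]; exact ((hg d).contDiffAt_mk htd).differentiableAt (by simp))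
    (by rw [hUz]; exact (hg d).isCompat htd) (hU.differentiableAt (by simp)) hd1 hd1 v
  have h2 : (fun z : Eu n => met g d (inCharts (m := n + 1) c d u z) (fieldInCharts c d u ν z) (fieldInCharts c d u ν z))
      =ᶠ[𝓝 (extChartAt (𝓡 n) c p)] fun _ => 1 := by
    filter_upwards [eventually_inCharts hu hp hd] with z ⟨q, hq, hdq, hz⟩
    rw [← hz, inCharts_self (n := n) hq, unitNormal_unit hg hν1 hq hdq]
  rw [h2.fderiv_eq, hUz, met_symm hg hd (fieldInCharts c d u ν _)] at h1
  simp only [fderiv_fun_const, Pi.zero_apply, zero_apply] at h1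
  linarith

include hg hu hνn hν1 hφ hp hd hν in
-- In `∇(φν) = dφ ν + φ ∇ν` the normal part of `∇ν` is a multiple of `ν`, because the codimension is
-- one, and it is orthogonal to `ν`. It therefore vanishes.
theorem normalCov_unitNormal (v : Eu n) :
    normalCov g c d u (fun q => φ q • ν q) (extChartAt (𝓡 n) c p) v
      = fderiv ℝ (inChart c φ) (extChartAt (𝓡 n) c p) v
        • fieldInCharts c d u ν (extChartAt (𝓡 n) c p) := by
  obtain ⟨e, he⟩ := (isMetric_pullback hg hu c).exists_frame ((extChartAt (𝓡 n) c).map_source hp)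
  have hon := isON_met hg hp hd hu.1 he
  have hs := met_symm hg hd
  have h1 : fieldInCharts c d u (fun q => φ q • ν q)
      = fun z : Eu n => inChart c φ z • fieldInCharts c d u ν z :=
    funext fun z => map_smul (dchart d (inChart c u z)) _ _
  have hφd := (contDiffAt_inChart_fun hp hφ.contMDiffAt).differentiableAt (n := ∞) (by simp)
  have hNn := unitNormal_normal hg hu hνn hp hd
  rw [normalCov, inCharts_self (n := n) hp, h1, covAlong_smul hφd (hν.differentiableAt (by simp)),
    norPart_add hon, norPart_smul hon, norPart_smul hon, norPart_of_normal hon hNn,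
    eq_smul_of_normal hon hs hNn (unitNormal_unit hg hν1 hp hd) (norPart_normal hon _),
    norPart_inner hs _ hNn, covAlong_unitNormal hg hu hν1 hp hd hν, zero_smul, smul_zero, add_zero]

end Hypersurface

/-! ### The weighted Laplacian and the Ricci tensor as frame sums. -/

section Laplacian

variable {k : ℕ} {N : Type*} [TopologicalSpace N] [ChartedSpace (Eu k) N] [IsManifold (𝓡 k) ∞ N]
  {h : FormField k N} (hh : IsMetric h) {φ w : N → ℝ} (hφ : ContMDiff (𝓡 k) 𝓘(ℝ, ℝ) ∞ φ) {x : N}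
  {e : Fin k → Eu k} (he : IsON (chartMetric h x (extChartAt (𝓡 k) x x)) e)

include hh in
theorem rawForm_eq_met_self (V W : Eu k) :
    rawForm h x V W = met h x (extChartAt (𝓡 k) x x) V W := by
  have h1 := rawForm_eq_met (u := (id : N → N)) hh (mem_extChartAt_source (I := 𝓡 k) x) V W
  refine h1.trans ?_
  have h2 : dchart (k := k) x (id x) = ContinuousLinearMap.id ℝ (Eu k) := dchart_self x
  rw [h2]
  rfl

include hh hφ in
theorem rawForm_hessian (V W : Eu k) : rawForm h x (hessian h φ x V) W
    = fderiv ℝ (fun y => fderiv ℝ (inChart x φ) y W) (extChartAt (𝓡 k) x x) V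
      - fderiv ℝ (inChart x φ) (extChartAt (𝓡 k) x x) (chr h x (extChartAt (𝓡 k) x x) V W) := by
  have h1 := hessian_inCharts hh hφ (mem_extChartAt_source (I := 𝓡 k) x) V W
  rw [dchart_self] at h1
  exact (rawForm_eq_met_self hh _ _).trans h1

include hh hφ he in
theorem weightedLaplacian_inCharts : weightedLaplacian h w φ x
    = ∑ i, (fderiv ℝ (fun y => fderiv ℝ (inChart x φ) y (e i)) (extChartAt (𝓡 k) x x) (e i)
        - fderiv ℝ (inChart x φ) (extChartAt (𝓡 k) x x)
          (chr h x (extChartAt (𝓡 k) x x) (e i) (e i)))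
      - ∑ i, dirDeriv (k := k) w x (e i)
        * fderiv ℝ (inChart x φ) (extChartAt (𝓡 k) x x) (e i) := by
  have hx := mem_extChartAt_source (I := 𝓡 k) x
  have hφx := contDiffAt_inChart_fun hx hφ.contMDiffAt
  have hid : ∀ V : Eu k, dchart (k := k) x x V = V := fun V => by
    rw [dchart_self (k := k)]; rfl
  have hraw : rawForm h x = chartMetric h x (extChartAt (𝓡 k) x x) := by
    funext V W
    rw [rawForm_eq_chartMetric h hx, hid, hid]
  have hD2 : ∀ v w, fderiv ℝ (fun y => fderiv ℝ (inChart x φ) y w) (extChartAt (𝓡 k) x x) v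
      = fderiv ℝ (fderiv ℝ (inChart x φ)) (extChartAt (𝓡 k) x x) v w := fun v w => by
    rw [fderiv_clm_apply ((hφx.fderiv_right (m := ∞) (by simp)).differentiableAt (by simp))
      (differentiableAt_const w)]
    simp
  have h1 := tangentTrace_inCharts (V := ℝ) (V' := ℝ) hh hx he (L := LinearMap.id)
    (fun _ _ h => h) (Q := fun X Y => rawForm h x (hessian h φ x X) Y)
    (Q' := fun v w => fderiv ℝ (fun y => fderiv ℝ (inChart x φ) y w) (extChartAt (𝓡 k) x x) v
      - fderiv ℝ (inChart x φ) (extChartAt (𝓡 k) x x) (chr h x (extChartAt (𝓡 k) x x) v w))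
    (by
      simp only [hD2]
      exact isBil_clm (fderiv ℝ (fderiv ℝ (inChart x φ)) (extChartAt (𝓡 k) x x)
        - ((ContinuousLinearMap.compL ℝ (Eu k) (Eu k) ℝ
          (fderiv ℝ (inChart x φ) (extChartAt (𝓡 k) x x))).comp
            (chr h x (extChartAt (𝓡 k) x x)))))
    (fun X Y => by
      rw [hid, hid]
      exact rawForm_hessian hh hφ X Y)
  have h2 : rawForm h x (rawGradient h w x) (rawGradient h φ x) = ∑ i, dirDeriv (k := k) w x (e i)
      * fderiv ℝ (inChart x φ) (extChartAt (𝓡 k) x x) (e i) := by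
    rw [gradient_spec hh, he.expand (hraw ▸ hh.isBil x) (rawGradient h φ x)]
    refine (map_sum (mfderiv (𝓡 k) 𝓘(ℝ, ℝ) w x) _ _).trans (Finset.sum_congr rfl fun i _ => ?_)
    refine (map_smul (mfderiv (𝓡 k) 𝓘(ℝ, ℝ) w x) _ _).trans ?_
    rw [← hraw, hh.symm, gradient_spec hh,
      ← fderiv_inChart_fun hx (hφ.mdifferentiableAt (by simp)), hid]
    exact mul_comm (fderiv ℝ (inChart x φ) (extChartAt (𝓡 k) x x) (e i)) (dirDeriv (k := k) w x (e i))
  exact congrArg₂ (· - ·) h1 h2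

include hh he in
theorem ricci_inCharts (Y Z : Eu k) : ricci h x Y Z
    = -∑ i, met h x (extChartAt (𝓡 k) x x)
      (curv (chr h x) (extChartAt (𝓡 k) x x) (e i) Y (e i)) Z := by
  have hx := mem_extChartAt_source (I := 𝓡 k) x
  have hid : ∀ V : Eu k, dchart (k := k) x x V = V := fun V => by
    rw [dchart_self (k := k)]; rfl
  have hb : IsBil fun X X' : Eu k => -curv (chr h x) (extChartAt (𝓡 k) x x) X Y X' := by
    constructor
    · exact fun w => ⟨fun a b => by simp [curv]; abel, fun a b => by
        simp only [curv, map_smul, smul_apply, ← smul_add, ← smul_sub, ← smul_neg]⟩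
    · exact fun w => ⟨fun a b => by simp [curv]; abel, fun a b => by
        simp only [curv, map_smul, smul_apply, ← smul_add, ← smul_sub, ← smul_neg]⟩
  have h1 := tangentTrace_inCharts (V := ℝ) (V' := ℝ) hh hx he (L := LinearMap.id)
    (fun _ _ h => h) (Q := fun X X' => rawForm h x (curvature h x X Y X') Z)
    (Q' := fun v w => met h x (extChartAt (𝓡 k) x x)
      (-curv (chr h x) (extChartAt (𝓡 k) x x) v Y w) Z)
    (hb.comp LinearMap.id ((met h x (extChartAt (𝓡 k) x x)).flip Z).toLinearMap)
    (fun X X' => by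
      rw [hid, hid, ← curvature_eq hh]
      exact rawForm_eq_met_self hh _ _)
  refine h1.trans ?_
  simp

end Laplacian

/-! ### The norm of the second fundamental form as a frame sum. -/

section Immersion

variable {n m : ℕ} {S : Type*} [TopologicalSpace S] [ChartedSpace (Eu n) S]
  {M : Type*} [TopologicalSpace M] [ChartedSpace (Eu m) M]
  [IsManifold (𝓡 n) ∞ S] [IsManifold (𝓡 m) ∞ M]
  {g : FormField m M} (hg : IsMetric g) {u : S → M} (hu : IsSmoothImmersion n m u)
  {p c : S} {d : M}
  (hp : p ∈ (extChartAt (𝓡 n) c).source) (hd : u p ∈ (extChartAt (𝓡 m) d).source)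
  {e : Fin n → Eu n}
  (he : IsON (chartMetric (pullbackForm n g u) c (extChartAt (𝓡 n) c p)) e)

include hg hu hp hd he in
theorem normSqSecondFundamentalForm_inCharts : normSqSecondFundamentalForm n g u p
    = ∑ i, ∑ j, met g d (extChartAt (𝓡 m) d (u p))
        (secondForm g c d u (extChartAt (𝓡 n) c p) (e i) (e j))
        (secondForm g c d u (extChartAt (𝓡 n) c p) (e i) (e j)) := by
  have hb := isBil_secondForm hg hu hp hd
  have hS := secondFundamentalForm_inCharts hg hu hp hd
  have hm := isMetric_pullback hg hu
  set B := met g d (extChartAt (𝓡 m) d (u p))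
  set A := secondForm g c d u (extChartAt (𝓡 n) c p)
  have h0 : ∀ X X' : Eu n, (tangentTrace (pullbackForm n g u) p fun Y Y' =>
      rawForm g (u p) (secondFundamentalForm n g u p X Y) (secondFundamentalForm n g u p X' Y'))
      = ∑ j, B (A (dchart c p X) (e j)) (A (dchart c p X') (e j)) := fun X X' =>
    tangentTrace_inCharts (V := ℝ) (V' := ℝ) hm hp he (L := LinearMap.id) (fun _ _ h => h)
      (Q := fun Y Y' => rawForm g (u p) (secondFundamentalForm n g u p X Y)
        (secondFundamentalForm n g u p X' Y'))
      (Q' := fun v w => B (A (dchart c p X) v) (A (dchart c p X') w))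
      ⟨fun w => ⟨fun a b => by simp only [(hb.right _).map_add, map_add, add_apply],
        fun a b => by simp only [(hb.right _).map_smul, map_smul, smul_apply]⟩,
      fun v => ⟨fun a b => by simp only [(hb.right _).map_add, map_add],
        fun a b => by simp only [(hb.right _).map_smul, map_smul]⟩⟩
      fun Y Y' => (rawForm_eq_met hg hd _ _).trans
        (congrArg₂ (fun V W => B V W) (hS X Y) (hS X' Y'))
  refine tangentTrace_inCharts (V := ℝ) (V' := ℝ) hm hp he (L := LinearMap.id) (fun _ _ h => h)
    (Q := fun X X' => tangentTrace (pullbackForm n g u) p fun Y Y' =>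
      rawForm g (u p) (secondFundamentalForm n g u p X Y) (secondFundamentalForm n g u p X' Y'))
    (Q' := fun v w => ∑ j, B (A v (e j)) (A w (e j))) ?_ h0
  exact ⟨fun w => ⟨fun a b => by
        simp only [(hb.left _).map_add, map_add, add_apply, Finset.sum_add_distrib],
      fun a b => by simp only [(hb.left _).map_smul, map_smul, smul_apply, Finset.smul_sum]⟩,
    fun v => ⟨fun a b => by simp only [(hb.left _).map_add, map_add, Finset.sum_add_distrib],
      fun a b => by simp only [(hb.left _).map_smul, map_smul, Finset.smul_sum]⟩⟩

end Immersion

/-! ### Reduction of the stability operator to functions. -/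

section Hypersurface

variable {n : ℕ} {S : Type*} [TopologicalSpace S] [ChartedSpace (Eu n) S]
  {M : Type*} [TopologicalSpace M] [ChartedSpace (Eu (n + 1)) M]
  [IsManifold (𝓡 n) ∞ S] [IsManifold (𝓡 (n + 1)) ∞ M]
  {g : FormField (n + 1) M} (hg : IsMetric g) {u : S → M} (hu : IsSmoothImmersion n (n + 1) u)
  {f : M → ℝ} (hf : ContMDiff (𝓡 (n + 1)) 𝓘(ℝ, ℝ) ∞ f)
  {ν : S → Eu (n + 1)} (hνs : ContMDiff (𝓡 n) (𝓡 (n + 1)).tangent ∞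
    (fun p => (⟨u p, ν p⟩ : TangentBundle (𝓡 (n + 1)) M)))
  (hνn : IsNormal n g u ν) (hν1 : ∀ p, rawForm g (u p) (ν p) (ν p) = 1)
  {φ : S → ℝ} (hφ : ContMDiff (𝓡 n) 𝓘(ℝ, ℝ) ∞ φ) (p : S)

include hg hu hf hνs hνn hν1 hφ in
/-- On a two-sided hypersurface the stability operator reduces to an operator on functions. -/
theorem stabilityOperator_smul_unitNormal :
    (stabilityOperator n g f u (fun q => φ q • ν q) p : Eu (n + 1))
      = hypersurfaceOperator n g f u ν φ p • ν p := by
  have hp := mem_extChartAt_source (I := 𝓡 n) p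
  have hd : u p ∈ (extChartAt (𝓡 (n + 1)) (u p)).source := mem_extChartAt_source (u p)
  have ht := (extChartAt (𝓡 n) p).map_source hp
  have hm := isMetric_pullback hg hu
  obtain ⟨e, he⟩ := (hm p).exists_frame ht
  have hon := isON_met hg hp hd hu.1 he
  have hs := met_symm hg hd
  have hidp : ∀ V : Eu n, dchart (k := n) p p V = V := fun V => by
    rw [dchart_self (k := n)]; rfl
  have hid : ∀ V : Eu (n + 1), dchart (k := n + 1) (u p) (u p) V = V := fun V => by
    rw [dchart_self (k := n + 1)]; rfl
  have hN : ∀ q ∈ (extChartAt (𝓡 n) p).source, u q ∈ (extChartAt (𝓡 (n + 1)) (u p)).source →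
      ContDiffAt ℝ ∞ (fieldInCharts p (u p) u ν) (extChartAt (𝓡 n) p q) := fun q hq hdq =>
    contDiffAt_fieldInCharts (by norm_cast) le_rfl hq hdq (hνs q)
  have hNp := hN p hp hd
  have hNz : fieldInCharts p (u p) u ν (extChartAt (𝓡 n) p p) = ν p := by
    rw [fieldInCharts_self hp]; exact hid _
  have hφp := contDiffAt_inChart_fun hp (hφ.contMDiffAt (x := p))
  have hT : ContDiffAt ℝ ∞ (fieldInCharts p (u p) u fun q => φ q • ν q) (extChartAt (𝓡 n) p p) := by
    refine (hφp.smul hNp).congr_of_eventuallyEq (Filter.Eventually.of_forall fun z => ?_)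
    exact map_smul (dchart (u p) (inChart p u z)) _ _
  have hνn' := unitNormal_normal hg hu hνn hp hd
  have hν1' := unitNormal_unit hg hν1 hp hd
  have hcovν := covAlong_unitNormal hg hu hν1 hp hd hNp
  have hQ : ∀ᶠ z in 𝓝 (extChartAt (𝓡 n) p p), ∀ v,
      normalCov g p (u p) u (fun q => φ q • ν q) z v
        = fderiv ℝ (inChart p φ) z v • fieldInCharts p (u p) u ν z := by
    filter_upwards [eventually_inCharts hu hp hd] with z ⟨q, hq, hdq, hz⟩ v
    rw [← hz]
    exact normalCov_unitNormal hg hu hνn hν1 hφ hq hdq (hN q hq hdq) v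
  have hnor := stabilityOperator_normal hg hu hf hp he hT
  have hsecond := secondForm_normal hg hu hp hd he
  rw [hNz] at hνn' hν1' hcovν
  have hin := inner_stabilityOperator hg hu hf hp he hT rfl rfl rfl rfl rfl rfl
    (fun w => by rw [map_smul, smul_apply, hνn' w, smul_zero]) hνn'
  have hlap := weightedLaplacian_inCharts hm hφ (w := fun q => f (u q)) he
  -- The ambient trace is taken over the tangent frame completed by `ν`. The entry of `ν` vanishes
  -- (`hcurv0`), so the Ricci curvature is the tangential trace occurring in `R`.
  have hric := ricci_inCharts hg (x := u p) (e := Fin.snoc (α := fun _ => Eu (n + 1)) (fun i =>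
    fderiv ℝ (inCharts (m := n + 1) p (u p) u) (extChartAt (𝓡 n) p p) (e i)) (ν p))
    (by
      have h1 := isON_snoc hon hs hνn' hν1'
      intro i j
      exact ((hg (u p)).mk_apply ((extChartAt (𝓡 (n + 1)) (u p)).map_source hd) _ _).symm.trans
        (h1 i j))
    (ν p) (ν p)
  have hhess := rawForm_hessian hg hf (ν p) (ν p) (x := u p)
  have hA := normSqSecondFundamentalForm_inCharts hg hu hp hd he
  have hS : ∀ v w, met g (u p) (extChartAt (𝓡 (n + 1)) (u p) (u p))
      (secondForm g p (u p) u (extChartAt (𝓡 n) p p) v w) (ν p)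
      = met g (u p) (extChartAt (𝓡 (n + 1)) (u p) (u p)) (covAlong (chr g (u p))
        (inCharts p (u p) u) (fun z => fderiv ℝ (inCharts (m := n + 1) p (u p) u) z w)
        (extChartAt (𝓡 n) p p) v) (ν p) := fun v w => by
    rw [secondForm, inCharts_self (n := n) hp]
    exact norPart_inner hs _ hνn'
  have hSS : ∀ v w, met g (u p) (extChartAt (𝓡 (n + 1)) (u p) (u p))
      (secondForm g p (u p) u (extChartAt (𝓡 n) p p) v w)
      (secondForm g p (u p) u (extChartAt (𝓡 n) p p) v w)
      = met g (u p) (extChartAt (𝓡 (n + 1)) (u p) (u p))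
        (secondForm g p (u p) u (extChartAt (𝓡 n) p p) v w) (ν p) ^ 2 := fun v w => by
    conv_lhs => rw [eq_smul_of_normal hon hs hνn' hν1' (hsecond v w)]
    simp only [map_smul, smul_apply, smul_eq_mul, hν1']
    ring
  have hcov : ∀ i, met g (u p) (extChartAt (𝓡 (n + 1)) (u p) (u p)) (covAlong (chr g (u p))
      (inCharts p (u p) u) (fun z => normalCov g p (u p) u (fun q => φ q • ν q) z (e i))
      (extChartAt (𝓡 n) p p) (e i)) (ν p)
      = fderiv ℝ (fun y => fderiv ℝ (inChart p φ) y (e i)) (extChartAt (𝓡 n) p p) (e i) :=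
    fun i => by
      have h1 : (fun z => normalCov g p (u p) u (fun q => φ q • ν q) z (e i))
          =ᶠ[𝓝 (extChartAt (𝓡 n) p p)]
          fun z => fderiv ℝ (inChart p φ) z (e i) • fieldInCharts p (u p) u ν z := by
        filter_upwards [hQ] with z hz using hz _
      rw [covAlong_congr h1, covAlong_smul ((contDiffAt_fderiv_apply hφp
        (e i)).differentiableAt (by simp)) (hNp.differentiableAt (by simp)), map_add, add_apply,
        map_smul, map_smul, smul_apply, smul_apply, hcovν, hNz, hν1']
      simp
  have hQz : ∀ v, met g (u p) (extChartAt (𝓡 (n + 1)) (u p) (u p))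
      (normalCov g p (u p) u (fun q => φ q • ν q) (extChartAt (𝓡 n) p p) v) (ν p)
      = fderiv ℝ (inChart p φ) (extChartAt (𝓡 n) p p) v := fun v => by
    rw [hQ.self_of_nhds, hNz, map_smul, smul_apply, hν1', smul_eq_mul, mul_one]
  have hdir : ∀ i, dirDeriv (k := n) (fun q => f (u q)) p (e i)
      = fderiv ℝ (inChart (u p) f) (extChartAt (𝓡 (n + 1)) (u p) (u p))
        (fderiv ℝ (inCharts (m := n + 1) p (u p) u) (extChartAt (𝓡 n) p p) (e i)) := fun i => by
    have h1 := dirDeriv_comp hu hf hp hd (e i)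
    rwa [hidp] at h1
  have hcurv : ∀ X : Eu (n + 1), curv (chr g (u p)) (extChartAt (𝓡 (n + 1)) (u p) (u p)) X
      (φ p • ν p) X
      = φ p • curv (chr g (u p)) (extChartAt (𝓡 (n + 1)) (u p) (u p)) X (ν p) X := fun X => by
    simp only [curv, map_smul, smul_apply, smul_sub, smul_add]
  have hcurv0 : curv (chr g (u p)) (extChartAt (𝓡 (n + 1)) (u p) (u p)) (ν p) (ν p) (ν p) = 0 := by
    simp [curv]
  -- Since `L_f(φν)` is normal, its `ν`-component determines it.
  have hval : met g (u p) (extChartAt (𝓡 (n + 1)) (u p) (u p))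
      (stabilityOperator n g f u (fun q => φ q • ν q) p) (ν p)
      = hypersurfaceOperator n g f u ν φ p := by
    refine (rawForm_eq_met_self hg _ _).symm.trans (hin.trans ?_)
    have hop : hypersurfaceOperator n g f u ν φ p
        = weightedLaplacian (pullbackForm n g u) (fun q => f (u q)) φ p
          + normSqSecondFundamentalForm n g u p * φ p
          + (ricci g (u p) (ν p) (ν p) + rawForm g (u p) (hessian g f (u p) (ν p)) (ν p)) * φ p := rfl
    rw [hop, hlap, hA, hric, hhess, Fin.sum_univ_castSucc]
    simp only [Fin.snoc_castSucc, Fin.snoc_last, hcurv0, hcov, hQz, hdir, hcurv, hSS, hS,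
      map_smul, smul_apply, smul_eq_mul, map_zero, zero_apply, Finset.sum_sub_distrib]
    simp only [← Finset.mul_sum, mul_assoc, ← pow_two]
    ring
  exact (eq_smul_of_normal hon hs hνn' hν1' hnor).trans (congrArg (fun a : ℝ => a • ν p) hval)

end Hypersurface

end FMinimal

end

/-! ### The theorem for a smooth Riemannian metric. -/

theorem mainTheorem10 {n m : ℕ} (hnm : n < m)
    {S : Type*} [TopologicalSpace S] [T2Space S] [SecondCountableTopology S]
    [ChartedSpace (EuclideanSpace ℝ (Fin n)) S] [IsManifold (𝓡 n) ∞ S]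
    [MeasurableSpace S] [BorelSpace S]
    {M : Type*} [TopologicalSpace M] [T2Space M] [SecondCountableTopology M]
    [ChartedSpace (EuclideanSpace ℝ (Fin m)) M] [IsManifold (𝓡 m) ∞ M]
    (G : Bundle.ContMDiffRiemannianMetric (𝓡 m) ∞ (EuclideanSpace ℝ (Fin m))
      (fun x : M => TangentSpace (𝓡 m) x))
    (f : M → ℝ) (hf : ContMDiff (𝓡 m) 𝓘(ℝ, ℝ) ∞ f)
    (u : S → M) (hu : FMinimal.IsSmoothImmersion n m u)
    (hmin : FMinimal.IsFMinimal n (FMinimal.metricForm G) f u) :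
    -- the second variation formula for a compactly supported variation with normal field `T`
    (∀ (T : ∀ p : S, TangentSpace (𝓡 m) (u p)) (ψ : ℝ → S → M) (ε : ℝ) (K : Set S),
      FMinimal.IsNormal n (FMinimal.metricForm G) u T → FMinimal.IsVariation n u T ψ ε K →
      Integrable (fun p =>
          G.inner (u p) (T p) (FMinimal.stabilityOperator n (FMinimal.metricForm G) f u T p)
            * Real.exp (-f (u p)))
        (FMinimal.riemannianVolume (FMinimal.pullbackForm n (FMinimal.metricForm G) u)) ∧
      FMinimal.HasSecondVariation n (FMinimal.metricForm G) f ψ K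
        (-∫ p, G.inner (u p) (T p) (FMinimal.stabilityOperator n (FMinimal.metricForm G) f u T p)
            * Real.exp (-f (u p))
          ∂(FMinimal.riemannianVolume (FMinimal.pullbackForm n (FMinimal.metricForm G) u)))) ∧
    -- two-sided hypersurfaces, with smooth unit normal field `ν`
    (m = n + 1 → ∀ ν : ∀ p : S, TangentSpace (𝓡 m) (u p),
      ContMDiff (𝓡 n) (𝓡 m).tangent ∞ (fun p => (⟨u p, ν p⟩ : TangentBundle (𝓡 m) M)) →
      FMinimal.IsNormal n (FMinimal.metricForm G) u ν → (∀ p : S, G.inner (u p) (ν p) (ν p) = 1) →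
      ∀ φ : S → ℝ, ContMDiff (𝓡 n) 𝓘(ℝ, ℝ) ∞ φ →
        (∀ p : S, FMinimal.stabilityOperator n (FMinimal.metricForm G) f u (fun q => φ q • ν q) p
          = FMinimal.hypersurfaceOperator n (FMinimal.metricForm G) f u ν φ p • ν p) ∧
        (∀ (ψ : ℝ → S → M) (ε : ℝ) (K : Set S),
          FMinimal.IsVariation n u (fun q => φ q • ν q) ψ ε K →
          Integrable (fun p => φ p * FMinimal.hypersurfaceOperator n (FMinimal.metricForm G) f u ν φ p
              * Real.exp (-f (u p)))
            (FMinimal.riemannianVolume (FMinimal.pullbackForm n (FMinimal.metricForm G) u)) ∧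
          FMinimal.HasSecondVariation n (FMinimal.metricForm G) f ψ K
            (-∫ p, φ p * FMinimal.hypersurfaceOperator n (FMinimal.metricForm G) f u ν φ p
                * Real.exp (-f (u p))
              ∂(FMinimal.riemannianVolume (FMinimal.pullbackForm n (FMinimal.metricForm G) u))))) := by
  have hg := FMinimal.isMetric_metricForm G
  have hsv := fun (T : ∀ p : S, TangentSpace (𝓡 m) (u p)) (ψ : ℝ → S → M) (ε : ℝ) (K : Set S)
    (hT : FMinimal.IsNormal n (FMinimal.metricForm G) u T)
    (hψ : FMinimal.IsVariation n u T ψ ε K) => FMinimal.second_variation hψ hg hf hu hT hmin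
  refine ⟨hsv, ?_⟩
  rintro rfl ν hνs hνn hν1 φ hφ
  have hop := FMinimal.stabilityOperator_smul_unitNormal hg hu hf hνs hνn hν1 hφ
  refine ⟨hop, fun ψ ε K hψ => ?_⟩
  have hn : FMinimal.IsNormal n (FMinimal.metricForm G) u fun q => φ q • ν q := fun p X =>
    ((((hg.isBil (u p)).left _).map_smul (φ p) (ν p)).trans
      (congrArg (φ p * ·) (hνn p X))).trans (mul_zero _)
  have heq : ∀ p, FMinimal.metricForm G (u p) (φ p • ν p) (FMinimal.stabilityOperator n
      (FMinimal.metricForm G) f u (fun q => φ q • ν q) p)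
      = φ p * FMinimal.hypersurfaceOperator n (FMinimal.metricForm G) f u ν φ p := fun p => by
    have hb := hg.isBil (u p)
    refine (congrArg (FMinimal.rawForm (FMinimal.metricForm G) (u p) (φ p • ν p))
      (hop p)).trans ((((hb.right _).map_smul _ _).trans (congrArg (_ * ·)
        (((hb.left _).map_smul _ _).trans (congrArg (φ p * ·) (hν1 p))))).trans ?_)
    ring
  have h := hsv _ ψ ε K hn hψ
  simp only [heq] at h
  exact h
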